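/- Consider the star formed by three edges $e_j$, identified with the intervals $(0,l_j)$, $l_j>0$, $j=1,2,3$, joined at the central vertex $v_2$, which is $x=0$ on every edge. Let $q_j$ be a bounded, continuous, real valued function on $(0,l_j)$, and let $T>0$ and $g,h_1,h_2,h_3\in L^2(0,T)$ (real valued). Consider the problem $$\partial_t^2u_j-\partial_x^2u_j+q_j(x)u_j=0\quad (0<x<l_j,\ 0<t<T,\ j=1,2,3),$$ $$u_2(0,t)-u_1(0,t)=0,\qquad u_3(0,t)-u_1(0,t)=g(t),\qquad \sum_{j=1}^3\partial_xu_j(0,t)=0,$$ $$u_j(l_j,t)=h_j(t)\ (j=1,2,3),\qquad u|_{t=0}=u_t|_{t=0}=0 .$$ A generalized solution is a family $u_j\in C([0,T];L^2(0,l_j))$ such that $$\sum_{j=1}^3\int_0^T\!\!\int_0^{l_j}u_j\,(\partial_t^2\varphi_j-\partial_x^2\varphi_j+q_j\varphi_j)\,dx\,dt=\int_0^Tg(t)\,\partial_x\varphi_3(0,t)\,dt-\sum_{j=1}^3\int_0^Th_j(t)\,\partial_x\varphi_j(l_j,t)\,dt$$ for all $\varphi_j\in C^2([0,l_j]\times[0,T])$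 with $\varphi_j(\cdot,T)=\partial_t\varphi_j(\cdot,T)=0$, $\varphi_j(l_j,\cdot)=0$, $\varphi_1(0,\cdot)=\varphi_2(0,\cdot)=\varphi_3(0,\cdot)$ and $\sum_j\partial_x\varphi_j(0,\cdot)=0$. For all $g,h_1,h_2,h_3\in L^2(0,T)$ there is a unique generalized solution $u$, and it has a trace $o(t)=u_1(0,t)$ in $L^2(0,T)$, that is, $u_1(x,\cdot)\to o$ in $L^2(0,T)$ as $x\to0^+$ (outside a null set of $x$). Moreover, for all fixed $h_1,h_2,h_3\in L^2(0,T)$: A) The mapping $g\mapsto z:=o+g$ is a surjection of $L^2(0,T)$ onto $L^2(0,T)$. B) This mapping is injective, and its inverse $z\mapsto g$ is bounded from $L^2(0,T)$ to $L^2(0,T)$: there is a constant $C$, depending only on $T$, the $l_j$ and the $q_j$, such that $\|g\|\le C\bigl(\|z\|+\sum_{j=1}^3\|h_j\|\bigr)$, and $\|g-g'\|\le C\|z-z'\|$ whenever $z,z'$ correspond to $g,g'$ with the same $h_1,h_2,h_3$. All norms are those of $L^2(0,T)$. -/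

import Mathlib

open MeasureTheory Set Filter Topology

noncomputable section

namespace StarWave

/-- The real Hilbert space `L²(0,T)` of controls, boundary data and observations. -/
abbrev L2 (T : ℝ) : Type := Lp ℝ 2 (volume.restrict (Ioo (0 : ℝ) T))

/-- `∂_x φ (x,t)` for a function `φ` on `[0,L] × [0,T]` (one-sided at the end points of `[0,L]`). -/
def dx (L : ℝ) (φ : ℝ → ℝ → ℝ) (x t : ℝ) : ℝ :=
  derivWithin (fun y => φ y t) (Icc 0 L) x

/-- `∂_x² φ (x,t)`. -/
def dxx (L : ℝ) (φ : ℝ → ℝ → ℝ) (x t : ℝ) : ℝ :=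
  iteratedDerivWithin 2 (fun y => φ y t) (Icc 0 L) x

/-- `∂_t φ (x,t)` for a function `φ` on `[0,L] × [0,T]` (one-sided at the end points of `[0,T]`). -/
def dt (T : ℝ) (φ : ℝ → ℝ → ℝ) (x t : ℝ) : ℝ :=
  derivWithin (fun s => φ x s) (Icc 0 T) t

/-- `∂_t² φ (x,t)`. -/
def dtt (T : ℝ) (φ : ℝ → ℝ → ℝ) (x t : ℝ) : ℝ :=
  iteratedDerivWithin 2 (fun s => φ x s) (Icc 0 T) t

/-- Test functions on the star with edges `e_j = (0, l j)`, `j = 0, 1, 2`; the centre is `x = 0` on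
every edge and the boundary vertex of `e_j` is `x = l j`. They are of class `C²` on the closed
rectangles, have zero Cauchy data at the final time `T`, vanish at the boundary vertices, and
satisfy the homogeneous Kirchhoff-Neumann conditions (continuity and zero sum of the derivatives
pointing away from the vertex) at the centre. There is no condition at `t = 0`. -/
structure IsTest (l : Fin 3 → ℝ) (T : ℝ) (φ : Fin 3 → ℝ → ℝ → ℝ) : Prop where
  contDiffOn : ∀ j, ContDiffOn ℝ 2 (fun p : ℝ × ℝ => φ j p.1 p.2) (Icc 0 (l j) ×ˢ Icc 0 T)
  final : ∀ j, ∀ x ∈ Icc 0 (l j), φ j x T = 0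
  final_dt : ∀ j, ∀ x ∈ Icc 0 (l j), dt T (φ j) x T = 0
  boundary : ∀ j, ∀ t ∈ Icc 0 T, φ j (l j) t = 0
  continuous_centre : ∀ i j, ∀ t ∈ Icc 0 T, φ i 0 t = φ j 0 t
  kirchhoff : ∀ t ∈ Icc 0 T, ∑ j, dx (l j) (φ j) 0 t = 0

/-- `u j x t` is the generalized solution, in `C([0,T]; L²)` and in the sense of transposition, of
* `u_tt - u_xx + q u = 0` on each edge `(0, l j)`, for `0 < t < T`;
* `u_0(0,t) = u_1(0,t)` and `u_2(0,t) - u_0(0,t) = g(t)` at the centre;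
* `∑_j ∂_x u_j(0,t) = 0` at the centre;
* `u_j(l_j,t) = h_j(t)` at the boundary vertices;
* `u = u_t = 0` at `t = 0`.

The identity `weak` is what integration by parts gives for a classical solution: all the conditions
above are encoded in it. The edges `e_1, e_2, e_3` are indexed by `0, 1, 2`. -/
structure IsSolution (l : Fin 3 → ℝ) (q : Fin 3 → ℝ → ℝ) (T : ℝ) (g : ℝ → ℝ) (h : Fin 3 → ℝ → ℝ)
    (u : Fin 3 → ℝ → ℝ → ℝ) : Prop where
  measurable : ∀ j, AEStronglyMeasurable (fun p : ℝ × ℝ => u j p.1 p.2)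
    ((volume.restrict (Ioo 0 (l j))).prod (volume.restrict (Ioo 0 T)))
  memLp : ∀ j, ∀ t ∈ Icc 0 T, MemLp (fun x => u j x t) 2 (volume.restrict (Ioo 0 (l j)))
  continuous_time : ∀ j, ∀ t₀ ∈ Icc 0 T,
    Tendsto (fun t => eLpNorm (fun x => u j x t - u j x t₀) 2 (volume.restrict (Ioo 0 (l j))))
      (𝓝[Icc 0 T] t₀) (𝓝 0)
  weak : ∀ φ : Fin 3 → ℝ → ℝ → ℝ, IsTest l T φ →
    ∑ j, (∫ t in Ioo 0 T, ∫ x in Ioo 0 (l j),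
        u j x t * (dtt T (φ j) x t - dxx (l j) (φ j) x t + q j x * φ j x t)) =
      (∫ t in Ioo 0 T, g t * dx (l 2) (φ 2) 0 t)
        - ∑ j, ∫ t in Ioo 0 T, h j t * dx (l j) (φ j) (l j) t

/-- `v(0,·) = o` in the sense of traces: `v(x,·) → o` in `L²(0,T)` as `x → 0+`. The limit is an
essential one (null sets of `x` are disregarded), so that it does not depend on the choice of a
representative of the function `v`. -/
def HasTraceAtZero (T : ℝ) (v : ℝ → ℝ → ℝ) (o : ℝ → ℝ) : Prop :=
  Tendsto (fun x => eLpNorm (fun t => v x t - o t) 2 (volume.restrict (Ioo 0 T)))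
    (𝓝[>] 0 ⊓ ae volume) (𝓝 0)

end StarWave

end

/-! On each edge a solution is a superposition `a_j(t - x) + b_j(t - (l_j - x)) + D f_j`, where
`a_j` leaves the centre, `b_j` leaves the boundary vertex, `f_j = -q_j u_j`, and `D` integrates half
of the right hand side over the backward light cone. Let `B_j` be the value at the centre of
everything arriving there along edge `j`: the delayed `b_j` plus the trace of `D f_j`. The centre
conditions then say that `a_j + B_j` equals `o` on the first two edges and `o + g` on the third, and
that `∑ a_j = ∑ B_j`. Solving them gives `o = (2/3) ∑ B_i - g/3` and `a_j = (2/3) ∑ B_i - B_j +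
(δ_{j,2} - 1/3) g` (edges numbered from 0). Together with the boundary conditions and the formula
for `u` this is a fixed point system `y = K y + d` for the triple `y = (a, b, u)`.

Every entry of `K` contains a positive delay or an application of `D`, so with the weight `e^{-λt}`
its norm tends to 0 as `λ → ∞` (`stateNorm_sysK_le`). Hence `1 - K` is invertible on `L²` for every
`T`, however large (`exists_sysK_resolvent`).

The crucial point is that `z = o + g = (2/3)(∑ B_i + g)` can be solved for `g`: `g = (3/2) z - ∑
B_i`. Inserting this in the equation for `a_j` gives a system of the same kind, with `z` as datum
and another constant scattering matrix (`sysK_scattering_eq`). It has a bounded resolvent too, so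
both `g ↦ z` and `z ↦ g` are given by bounded operators, and these are inverse to each other for
fixed `h` (`control_response`, `response_control`). Surjectivity, injectivity and the estimates
follow at once.

It remains to identify generalized solutions with solutions of the system. Existence is integration
by parts along characteristics (`sum_integral_edgeSol_mul_box`). For uniqueness, a weak solution is
compared with the waves generated by its own right hand side; their difference is orthogonal to all
`(∂_t² - ∂_x²) φ`, and it vanishes because the backward problem on the star has test functions with
arbitrary smooth compactly supported right hand sides (`exists_isTest`). -/

noncomputable section

namespace StarWave

section

/-! ### Operators between `L²` spaces given by formulas on functions -/

section Operators

variable {X Y : Type*} [MeasurableSpace X] [MeasurableSpace Y] {μ : Measure X} {ν : Measure Y}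

/-- `op` is linear, preserves measurability and is bounded in `L²`. -/
structure IsL2Op (μ : Measure X) (ν : Measure Y) (op : (X → ℝ) → Y → ℝ) : Prop where
  meas : ∀ f, StronglyMeasurable f → StronglyMeasurable (op f)
  add : ∀ f g, MemLp f 2 μ → MemLp g 2 μ → op (f + g) = op f + op g
  smul : ∀ (c : ℝ) f, op (c • f) = c • op f
  bound : ∃ C : NNReal, ∀ f, StronglyMeasurable f → eLpNorm (op f) 2 ν ≤ C * eLpNorm f 2 μ

theorem stronglyMeasurable_coe (f : Lp ℝ 2 μ) : StronglyMeasurable (f : X → ℝ) :=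
  Lp.stronglyMeasurable f

namespace IsL2Op

variable {op : (X → ℝ) → Y → ℝ}

/-- The operators act on genuine functions, so passing to classes in `L²` needs this: the difference
has norm 0, hence by the bound so has its image. -/
theorem congr (h : IsL2Op μ ν op) {f g : X → ℝ} (hf : StronglyMeasurable f)
    (hg : StronglyMeasurable g) (hg2 : MemLp g 2 μ) (hfg : f =ᵐ[μ] g) : op f =ᵐ[ν] op g := by
  have hd : f - g =ᵐ[μ] 0 := by
    filter_upwards [hfg] with x hx
    simp [hx]
  have hd2 : MemLp (f - g) 2 μ := MemLp.zero.ae_eq hd.symm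
  have e : op f = op g + op (f - g) := by
    rw [← h.add _ _ hg2 hd2, add_sub_cancel]
  obtain ⟨C, hC⟩ := h.bound
  have h0 : eLpNorm (op (f - g)) 2 ν = 0 := by
    have := hC (f - g) (hf.sub hg)
    rw [eLpNorm_congr_ae hd, eLpNorm_zero, mul_zero] at this
    exact le_antisymm this (zero_le)
  have h1 := (eLpNorm_eq_zero_iff (h.meas _ (hf.sub hg)).aestronglyMeasurable (by norm_num)).1 h0
  rw [e]
  filter_upwards [h1] with y hy
  simp [hy]

theorem memLp (h : IsL2Op μ ν op) (f : Lp ℝ 2 μ) : MemLp (op f) 2 ν := by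
  obtain ⟨C, hC⟩ := h.bound
  refine ⟨(h.meas _ (stronglyMeasurable_coe f)).aestronglyMeasurable, ?_⟩
  exact (hC f (stronglyMeasurable_coe f)).trans_lt
    (ENNReal.mul_lt_top ENNReal.coe_lt_top (Lp.eLpNorm_lt_top f))

/-- The continuous linear map on `L²` defined by `op`. -/
def toCLM (h : IsL2Op μ ν op) : Lp ℝ 2 μ →L[ℝ] Lp ℝ 2 ν :=
  LinearMap.mkContinuous
    { toFun := fun f => (h.memLp f).toLp
      map_add' := fun f g => by
        rw [← MemLp.toLp_add]
        refine (MemLp.toLp_eq_toLp_iff _ _).2 ?_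
        rw [← h.add _ _ (Lp.memLp f) (Lp.memLp g)]
        exact h.congr (stronglyMeasurable_coe _)
          ((stronglyMeasurable_coe f).add (stronglyMeasurable_coe g))
          ((Lp.memLp f).add (Lp.memLp g)) (Lp.coeFn_add f g)
      map_smul' := fun c f => by
        rw [RingHom.id_apply, ← MemLp.toLp_const_smul]
        refine (MemLp.toLp_eq_toLp_iff _ _).2 ?_
        rw [← h.smul]
        exact h.congr (stronglyMeasurable_coe _) ((stronglyMeasurable_coe f).const_smul c)
          ((Lp.memLp f).const_smul c) (Lp.coeFn_smul c f) }
    h.bound.choose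
    (fun f => by
      have := h.bound.choose_spec f (stronglyMeasurable_coe f)
      simp only [LinearMap.coe_mk, AddHom.coe_mk]
      rw [Lp.norm_toLp, Lp.norm_def, ← ENNReal.coe_toReal, ← ENNReal.toReal_mul]
      exact ENNReal.toReal_mono (ENNReal.mul_ne_top ENNReal.coe_ne_top (Lp.eLpNorm_ne_top f)) this)

theorem coeFn_toCLM (h : IsL2Op μ ν op) (f : Lp ℝ 2 μ) : h.toCLM f =ᵐ[ν] op f :=
  (h.memLp f).coeFn_toLp

end IsL2Op

/-! ### Exponentially weighted norms -/

/-- The `L²` norm of `e^{-λθ} f`. -/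
def wNorm (θ : X → ℝ) (μ : Measure X) (lam : ℝ) (f : X → ℝ) : ENNReal :=
  eLpNorm (fun x => Real.exp (-lam * θ x) * f x) 2 μ

theorem wNorm_congr {θ : X → ℝ} {lam : ℝ} {f g : X → ℝ} (h : f =ᵐ[μ] g) :
    wNorm θ μ lam f = wNorm θ μ lam g := by
  refine eLpNorm_congr_ae ?_
  filter_upwards [h] with x hx
  rw [hx]

theorem wNorm_le_eLpNorm {θ : X → ℝ} {lam : ℝ} (hl : 0 ≤ lam) (hθ : ∀ᵐ x ∂μ, 0 ≤ θ x)
    (f : X → ℝ) : wNorm θ μ lam f ≤ eLpNorm f 2 μ := by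
  refine eLpNorm_mono_ae ?_
  filter_upwards [hθ] with x hx
  rw [norm_mul, Real.norm_eq_abs, Real.abs_exp]
  refine mul_le_of_le_one_left (norm_nonneg _) (Real.exp_le_one_iff.2 ?_)
  nlinarith

theorem eLpNorm_le_wNorm {θ : X → ℝ} {lam T : ℝ} (hl : 0 ≤ lam) (hθ : ∀ᵐ x ∂μ, θ x ≤ T)
    (f : X → ℝ) : eLpNorm f 2 μ ≤ ENNReal.ofReal (Real.exp (lam * T)) * wNorm θ μ lam f := by
  refine eLpNorm_le_mul_eLpNorm_of_ae_le_mul ?_ 2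
  filter_upwards [hθ] with x hx
  rw [norm_mul, Real.norm_eq_abs (Real.exp _), Real.abs_exp, ← mul_assoc, ← Real.exp_add]
  refine le_mul_of_one_le_left (norm_nonneg _) (Real.one_le_exp_iff.2 ?_)
  nlinarith

theorem wNorm_add_le {θ : X → ℝ} (hθ : Measurable θ) {lam : ℝ} (f g : Lp ℝ 2 μ) :
    wNorm θ μ lam (f + g : Lp ℝ 2 μ) ≤ wNorm θ μ lam f + wNorm θ μ lam g := by
  rw [wNorm_congr (Lp.coeFn_add f g)]
  have hm : Measurable (fun x => Real.exp (-lam * θ x)) := by fun_prop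
  refine le_trans (le_of_eq ?_) (eLpNorm_add_le
    (hm.aestronglyMeasurable.mul (Lp.aestronglyMeasurable f))
    (hm.aestronglyMeasurable.mul (Lp.aestronglyMeasurable g)) (by norm_num))
  unfold wNorm
  congr 1
  ext x
  simp [mul_add]

theorem wNorm_smul {θ : X → ℝ} {lam : ℝ} (c : ℝ) (f : Lp ℝ 2 μ) :
    wNorm θ μ lam (c • f : Lp ℝ 2 μ) = ‖c‖ₑ * wNorm θ μ lam f := by
  rw [wNorm_congr (Lp.coeFn_smul c f), wNorm, wNorm, ← eLpNorm_const_smul]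
  congr 1
  ext x
  simp only [Pi.smul_apply, smul_eq_mul]
  ring

theorem wNorm_neg {θ : X → ℝ} {lam : ℝ} (f : Lp ℝ 2 μ) :
    wNorm θ μ lam (-f : Lp ℝ 2 μ) = wNorm θ μ lam f := by
  have := wNorm_smul (θ := θ) (lam := lam) (-1) f
  simpa using this

theorem wNorm_zero {θ : X → ℝ} {lam : ℝ} :
    wNorm θ μ lam (0 : Lp ℝ 2 μ) = 0 := by
  have := wNorm_smul (θ := θ) (lam := lam) (0 : ℝ) (0 : Lp ℝ 2 μ)
  simpa using this

theorem wNorm_sum_le {θ : X → ℝ} (hθ : Measurable θ) {lam : ℝ} {ι : Type*} (s : Finset ι)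
    (f : ι → Lp ℝ 2 μ) :
    wNorm θ μ lam (∑ i ∈ s, f i : Lp ℝ 2 μ) ≤ ∑ i ∈ s, wNorm θ μ lam (f i) := by
  classical
  induction s using Finset.induction_on with
  | empty => rw [Finset.sum_empty, wNorm_zero, Finset.sum_empty]
  | insert i s hi ih =>
    rw [Finset.sum_insert hi, Finset.sum_insert hi]
    exact (wNorm_add_le hθ _ _).trans (by gcongr)

/-- The norm of `op` with respect to the weights `e^{-λθ}`, `e^{-λθ'}` tends to `0` as
`λ → ∞`. -/
def IsWSmall (θ : X → ℝ) (θ' : Y → ℝ) (μ : Measure X) (ν : Measure Y)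
    (op : (X → ℝ) → Y → ℝ) : Prop :=
  ∀ ε : ENNReal, ε ≠ 0 → ∀ᶠ lam in atTop, ∀ f, StronglyMeasurable f →
    wNorm θ' ν lam (op f) ≤ ε * wNorm θ μ lam f

/-- On a bounded time interval the weighted and unweighted norms are equivalent for each fixed `λ ≥
0`, so smallness at a single `λ` already gives boundedness. -/
theorem IsWSmall.bound {θ : X → ℝ} {θ' : Y → ℝ} {op : (X → ℝ) → Y → ℝ}
    (h : IsWSmall θ θ' μ ν op) {T : ℝ} (hθ : ∀ᵐ x ∂μ, 0 ≤ θ x) (hθ' : ∀ᵐ y ∂ν, θ' y ≤ T) :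
    ∃ C : NNReal, ∀ f, StronglyMeasurable f → eLpNorm (op f) 2 ν ≤ C * eLpNorm f 2 μ := by
  obtain ⟨lam, h1, h2⟩ := ((h 1 one_ne_zero).and (eventually_ge_atTop 0)).exists
  refine ⟨Real.toNNReal (Real.exp (lam * T)), fun f hf => ?_⟩
  calc eLpNorm (op f) 2 ν ≤ ENNReal.ofReal (Real.exp (lam * T)) * wNorm θ' ν lam (op f) :=
        eLpNorm_le_wNorm h2 hθ' _
    _ ≤ ENNReal.ofReal (Real.exp (lam * T)) * eLpNorm f 2 μ := by
        gcongr
        exact (h1 f hf).trans (by rw [one_mul]; exact wNorm_le_eLpNorm h2 hθ f)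

theorem IsWSmall.toCLM {θ : X → ℝ} {θ' : Y → ℝ} {op : (X → ℝ) → Y → ℝ}
    (h : IsWSmall θ θ' μ ν op) (hop : IsL2Op μ ν op) (ε : ENNReal) (hε : ε ≠ 0) :
    ∀ᶠ lam in atTop, ∀ f : Lp ℝ 2 μ, wNorm θ' ν lam (hop.toCLM f) ≤ ε * wNorm θ μ lam f := by
  filter_upwards [h ε hε] with lam hl f
  rw [wNorm_congr (hop.coeFn_toCLM f)]
  exact hl f (stronglyMeasurable_coe f)

end Operators

theorem eLpNorm_two_sq {X : Type*} [MeasurableSpace X] (μ : Measure X) (f : X → ℝ) :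
    eLpNorm f 2 μ ^ 2 = ∫⁻ x, ‖f x‖ₑ ^ 2 ∂μ := by
  have := eLpNorm_nnreal_pow_eq_lintegral (f := f) (μ := μ) (p := 2) (by norm_num)
  have h2 : ((2 : NNReal) : ℝ) = ((2 : ℕ) : ℝ) := by norm_num
  simp only [h2, ENNReal.rpow_natCast] at this
  exact_mod_cast this

/-! ### Shifts, travelling waves and the d'Alembert operator -/

/-- Lebesgue measure on `(0,T)`. -/
abbrev mT (T : ℝ) : Measure ℝ := volume.restrict (Ioo (0 : ℝ) T)

/-- Lebesgue measure on the rectangle `(0,l) × (0,T)`. -/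
abbrev mQ (l T : ℝ) : Measure (ℝ × ℝ) := (mT l).prod (mT T)

/-- The Hilbert space `L²((0,l) × (0,T))`. -/
abbrev L2Q (l T : ℝ) : Type := Lp ℝ 2 (mQ l T)

theorem mQ_eq (l T : ℝ) : mQ l T = volume.restrict (Ioo 0 l ×ˢ Ioo 0 T) := by
  rw [mQ, mT, mT, Measure.prod_restrict]; rfl

theorem ae_mT (T : ℝ) : ∀ᵐ t ∂(mT T), t ∈ Ioo 0 T := ae_restrict_mem measurableSet_Ioo

theorem ae_mQ (l T : ℝ) : ∀ᵐ p ∂(mQ l T), p.1 ∈ Ioo 0 l ∧ p.2 ∈ Ioo 0 T := by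
  rw [mQ_eq]
  exact ae_restrict_mem (measurableSet_Ioo.prod measurableSet_Ioo)

/-- Extension by zero of a function on `(0,T)`. -/
def ext (T : ℝ) (a : ℝ → ℝ) : ℝ → ℝ := (Ioo 0 T).indicator a

theorem ext_add (T : ℝ) (a b : ℝ → ℝ) (t : ℝ) : ext T (a + b) t = ext T a t + ext T b t := by
  by_cases h : t ∈ Ioo 0 T <;> simp [ext, h]

theorem ext_smul (T c : ℝ) (a : ℝ → ℝ) (t : ℝ) : ext T (c • a) t = c * ext T a t := by
  by_cases h : t ∈ Ioo 0 T <;> simp [ext, h]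

theorem stronglyMeasurable_ext {T : ℝ} {a : ℝ → ℝ} (ha : StronglyMeasurable a) :
    StronglyMeasurable (ext T a) := ha.indicator measurableSet_Ioo

theorem wNorm_ext (T lam : ℝ) (a : ℝ → ℝ) :
    wNorm id volume lam (ext T a) = wNorm id (mT T) lam a := by
  rw [wNorm, wNorm, mT, ← eLpNorm_indicator_eq_eLpNorm_restrict measurableSet_Ioo]
  congr 1
  ext t
  by_cases h : t ∈ Ioo 0 T <;> simp [ext, h]

/-- `(x,t) ↦ a(t - ρ(x))`, with `a` extended by zero. -/
def waveOp (T : ℝ) (ρ : ℝ → ℝ) (a : ℝ → ℝ) (p : ℝ × ℝ) : ℝ := ext T a (p.2 - ρ p.1)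

/-- `t ↦ a(t - r)`, with `a` extended by zero. -/
def shiftOp (T r : ℝ) (a : ℝ → ℝ) (t : ℝ) : ℝ := ext T a (t - r)

/-- Writing `e^{-λt} = e^{-λr} e^{-λ(t - r)}` turns the weighted delay into a factor times a
translation, and translations of the line preserve the norm. -/
theorem wNorm_shiftOp_le (T r lam : ℝ) {a : ℝ → ℝ} (ha : StronglyMeasurable a) :
    wNorm id (mT T) lam (shiftOp T r a)
      ≤ ENNReal.ofReal (Real.exp (-lam * r)) * wNorm id (mT T) lam a := by
  rw [← wNorm_ext T lam a, wNorm, wNorm]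
  have hm : StronglyMeasurable (fun t => Real.exp (-lam * t) * ext T a t) :=
    (by fun_prop : Measurable fun t : ℝ => Real.exp (-lam * t)).stronglyMeasurable.mul
      (stronglyMeasurable_ext ha)
  have := eLpNorm_comp_measurePreserving (p := 2) hm.aestronglyMeasurable
    (measurePreserving_sub_right volume r)
  simp only [id]
  rw [← this, ← Real.enorm_of_nonneg (Real.exp_pos _).le, ← eLpNorm_const_smul]
  refine (eLpNorm_restrict_le _ _ _ _).trans (le_of_eq ?_)
  congr 1
  ext t
  simp only [shiftOp, Pi.smul_apply, Function.comp, smul_eq_mul]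
  rw [← mul_assoc, ← Real.exp_add]
  congr 2
  ring

theorem isWSmall_shiftOp (T : ℝ) {r : ℝ} (hr : 0 < r) :
    IsWSmall id id (mT T) (mT T) (shiftOp T r) := by
  intro ε hε
  have h : Tendsto (fun lam : ℝ => ENNReal.ofReal (Real.exp (-lam * r))) atTop (𝓝 0) := by
    rw [← ENNReal.ofReal_zero]
    refine ENNReal.tendsto_ofReal (Real.tendsto_exp_atBot.comp ?_)
    simp only [neg_mul]
    exact tendsto_neg_atTop_atBot.comp (tendsto_id.atTop_mul_const hr)
  filter_upwards [h.eventually_le_const (pos_iff_ne_zero.2 hε)] with lam hl f hf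
  exact (wNorm_shiftOp_le T r lam hf).trans (by gcongr)

theorem isL2Op_shiftOp (T : ℝ) {r : ℝ} (hr : 0 < r) : IsL2Op (mT T) (mT T) (shiftOp T r) where
  meas f hf := (stronglyMeasurable_ext hf).comp_measurable (by fun_prop)
  add f g _ _ := by ext t; simp [shiftOp, ext_add]
  smul c f := by ext t; simp [shiftOp, ext_smul]
  bound := (isWSmall_shiftOp T hr).bound ((ae_mT T).mono fun t h => h.1.le)
    ((ae_mT T).mono fun t h => h.2.le)

theorem stronglyMeasurable_waveOp {T : ℝ} {ρ : ℝ → ℝ} (hρ : Measurable ρ) {a : ℝ → ℝ}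
    (ha : StronglyMeasurable a) : StronglyMeasurable (waveOp T ρ a) :=
  (stronglyMeasurable_ext ha).comp_measurable (by fun_prop)

/-- For each `x` this is a delay by `ρ x`, so the squared norm is at most `∫ e^{-2λρ(x)} dx` times
that of the datum. The delay may degenerate at an end of the edge, so there is no uniform gain in
`x`; dominated convergence replaces it. -/
theorem isWSmall_waveOp (l T : ℝ) {ρ : ℝ → ℝ} (hρ : Measurable ρ) (hρ0 : ∀ x ∈ Ioo 0 l, 0 < ρ x) :
    IsWSmall id Prod.snd (mT T) (mQ l T) (waveOp T ρ) := by
  intro ε hε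
  have h : Tendsto (fun lam : ℝ => ∫⁻ x in Ioo 0 l, ENNReal.ofReal (Real.exp (-lam * ρ x)) ^ 2)
      atTop (𝓝 0) := by
    have h0 : (∫⁻ _ in Ioo (0 : ℝ) l, (0 : ENNReal) ∂volume) = 0 := by simp
    rw [← h0]
    refine tendsto_lintegral_filter_of_dominated_convergence (fun _ => 1) ?_ ?_ (by simp) ?_
    · exact Eventually.of_forall fun lam => by fun_prop
    · filter_upwards [eventually_ge_atTop 0] with lam hl
      filter_upwards [ae_mT l] with x hx
      refine pow_le_one₀ (zero_le) (ENNReal.ofReal_le_one.2 (Real.exp_le_one_iff.2 ?_))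
      nlinarith [hρ0 x hx]
    · filter_upwards [ae_mT l] with x hx
      rw [show (0 : ENNReal) = ENNReal.ofReal 0 ^ 2 by simp]
      refine ENNReal.Tendsto.pow (ENNReal.tendsto_ofReal (Real.tendsto_exp_atBot.comp ?_))
      simp only [neg_mul]
      exact tendsto_neg_atTop_atBot.comp (tendsto_id.atTop_mul_const (hρ0 x hx))
  have hε2 : 0 < ε ^ 2 := pos_iff_ne_zero.2 (pow_ne_zero 2 hε)
  filter_upwards [h.eventually_le_const hε2] with lam hl f hf
  have hsq : wNorm Prod.snd (mQ l T) lam (waveOp T ρ f) ^ 2 ≤ (ε * wNorm id (mT T) lam f) ^ 2 := by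
    rw [wNorm, eLpNorm_two_sq, mul_pow, mQ]
    have hm : StronglyMeasurable (fun p : ℝ × ℝ => Real.exp (-lam * p.2) * waveOp T ρ f p) :=
      (by fun_prop : Measurable fun p : ℝ × ℝ => Real.exp (-lam * p.2)).stronglyMeasurable.mul
        (stronglyMeasurable_waveOp hρ hf)
    rw [lintegral_prod _ (hm.enorm.pow_const 2).aemeasurable]
    calc _ ≤ ∫⁻ x in Ioo 0 l, ENNReal.ofReal (Real.exp (-lam * ρ x)) ^ 2
              * wNorm id (mT T) lam f ^ 2 := by
          refine lintegral_mono fun x => ?_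
          have := wNorm_shiftOp_le T (ρ x) lam hf
          rw [← mul_pow]
          refine le_trans (le_of_eq ?_) (pow_le_pow_left' this 2)
          rw [wNorm, eLpNorm_two_sq]
          rfl
      _ = (∫⁻ x in Ioo 0 l, ENNReal.ofReal (Real.exp (-lam * ρ x)) ^ 2)
              * wNorm id (mT T) lam f ^ 2 := by
          rw [lintegral_mul_const _ (by fun_prop)]
      _ ≤ _ := by gcongr
  exact (ENNReal.pow_le_pow_left_iff two_ne_zero).1 hsq

theorem isL2Op_waveOp (l T : ℝ) {ρ : ℝ → ℝ} (hρ : Measurable ρ) (hρ0 : ∀ x ∈ Ioo 0 l, 0 < ρ x) :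
    IsL2Op (mT T) (mQ l T) (waveOp T ρ) where
  meas f hf := stronglyMeasurable_waveOp hρ hf
  add f g _ _ := by ext t; simp [waveOp, ext_add]
  smul c f := by ext t; simp [waveOp, ext_smul]
  bound := (isWSmall_waveOp l T hρ hρ0).bound ((ae_mT T).mono fun t h => h.1.le)
    ((ae_mQ l T).mono fun t h => h.2.2.le)

/-! ### The d'Alembert operator in weighted norms -/

/-- The solution of `u_tt - u_xx = f` on the line, with zero initial data and `f` extended by zero
outside the rectangle. -/
def dAlembert (l T : ℝ) (f : ℝ × ℝ → ℝ) (p : ℝ × ℝ) : ℝ :=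
  (1 / 2) * ∫ z, {z : ℝ × ℝ | |p.1 - z.1| < p.2 - z.2}.indicator f z ∂(mQ l T)

theorem measurableSet_cone (p : ℝ × ℝ) :
    MeasurableSet {z : ℝ × ℝ | |p.1 - z.1| < p.2 - z.2} :=
  measurableSet_lt (by fun_prop) (by fun_prop)

theorem stronglyMeasurable_dAlembert (l T : ℝ) {f : ℝ × ℝ → ℝ} (hf : StronglyMeasurable f) :
    StronglyMeasurable (dAlembert l T f) := by
  have hS : MeasurableSet {w : (ℝ × ℝ) × (ℝ × ℝ) | |w.1.1 - w.2.1| < w.1.2 - w.2.2} :=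
    measurableSet_lt (by fun_prop) (by fun_prop)
  have h : StronglyMeasurable (Function.uncurry fun p z : ℝ × ℝ =>
      {z : ℝ × ℝ | |p.1 - z.1| < p.2 - z.2}.indicator f z) :=
    (hf.comp_measurable measurable_snd).indicator hS
  exact (h.integral_prod_right (ν := mQ l T)).const_mul (1 / 2)

theorem dAlembert_add (l T : ℝ) {f g : ℝ × ℝ → ℝ} (hf : MemLp f 2 (mQ l T))
    (hg : MemLp g 2 (mQ l T)) : dAlembert l T (f + g) = dAlembert l T f + dAlembert l T g := by
  ext p
  simp only [dAlembert, Pi.add_apply, indicator_add']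
  rw [integral_add, mul_add]
  · exact (hf.integrable (by norm_num)).indicator (measurableSet_cone p)
  · exact (hg.integrable (by norm_num)).indicator (measurableSet_cone p)

theorem dAlembert_smul (l T c : ℝ) (f : ℝ × ℝ → ℝ) :
    dAlembert l T (c • f) = c • dAlembert l T f := by
  ext p
  have h : ∀ z, {z : ℝ × ℝ | |p.1 - z.1| < p.2 - z.2}.indicator (c • f) z
      = c * {z : ℝ × ℝ | |p.1 - z.1| < p.2 - z.2}.indicator f z := fun z => by
    by_cases hz : |p.1 - z.1| < p.2 - z.2 <;> simp [hz]
  simp only [dAlembert, Pi.smul_apply, smul_eq_mul, h]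
  rw [integral_const_mul]
  ring

/-- The constant in the weighted bound of the d'Alembert operator. -/
def coneConst (l lam : ℝ) : ENNReal := (ENNReal.ofReal l * ENNReal.ofReal (1 / (2 * lam))) ^ (1 / 2 : ℝ)

theorem lintegral_exp_le {lam : ℝ} (hl : 0 < lam) (t : ℝ) :
    ∫⁻ s in Iio t, ENNReal.ofReal (Real.exp (-lam * (t - s))) ^ 2
      ≤ ENNReal.ofReal (1 / (2 * lam)) := by
  have e : ∀ s : ℝ, ENNReal.ofReal (Real.exp (-lam * (t - s))) ^ 2
      = ENNReal.ofReal (Real.exp (-(2 * lam) * t) * Real.exp ((2 * lam) * s)) := fun s => by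
    rw [← ENNReal.ofReal_pow (Real.exp_pos _).le, ← Real.exp_nat_mul, ← Real.exp_add]
    congr 2
    push_cast
    ring
  simp only [e]
  have hi : IntegrableOn (fun s => Real.exp ((2 * lam) * s)) (Iio t) := by
    exact (integrableOn_exp_mul_Iic (by positivity) t).mono_set Iio_subset_Iic_self
  rw [← ofReal_integral_eq_lintegral_ofReal (hi.const_mul _)
    (Eventually.of_forall fun s => by positivity)]
  refine ENNReal.ofReal_le_ofReal (le_of_eq ?_)
  rw [integral_const_mul, ← integral_Iic_eq_integral_Iio, integral_exp_mul_Iic (by positivity),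
    ← mul_div_assoc, ← Real.exp_add]
  simp

/-- Cauchy-Schwarz after splitting `e^{-λt} = e^{-λ(t - s)} e^{-λs}`, with the cone enlarged to the
half plane `s < t`. The estimate is pointwise in the evaluation point, so it controls traces on
vertical lines as well as values in the rectangle. -/
theorem enorm_dAlembert_le (l T : ℝ) {lam : ℝ} (hl : 0 < lam) {f : ℝ × ℝ → ℝ}
    (hf : StronglyMeasurable f) (p : ℝ × ℝ) :
    ‖Real.exp (-lam * p.2) * dAlembert l T f p‖ₑ
      ≤ coneConst l lam * wNorm Prod.snd (mQ l T) lam f := by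
  set k : ℝ × ℝ → ENNReal := fun z =>
    {z : ℝ × ℝ | z.2 < p.2}.indicator (fun z => ENNReal.ofReal (Real.exp (-lam * (p.2 - z.2)))) z
  have hS : MeasurableSet {z : ℝ × ℝ | z.2 < p.2} := measurableSet_lt (by fun_prop) (by fun_prop)
  have hk : Measurable k := Measurable.indicator (by fun_prop) hS
  have hw : StronglyMeasurable (fun z : ℝ × ℝ => Real.exp (-lam * z.2) * f z) :=
    (by fun_prop : Measurable fun z : ℝ × ℝ => Real.exp (-lam * z.2)).stronglyMeasurable.mul hf
  have h1 : ‖Real.exp (-lam * p.2) * dAlembert l T f p‖ₑ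
      ≤ ∫⁻ z, (k * fun z => ‖Real.exp (-lam * z.2) * f z‖ₑ) z ∂(mQ l T) := by
    rw [dAlembert, ← mul_assoc, enorm_mul]
    calc _ ≤ ‖Real.exp (-lam * p.2)‖ₑ *
          ∫⁻ z, ‖{z : ℝ × ℝ | |p.1 - z.1| < p.2 - z.2}.indicator f z‖ₑ ∂(mQ l T) := by
          refine mul_le_mul' ?_ (enorm_integral_le_lintegral_enorm _)
          rw [enorm_mul]
          refine mul_le_of_le_one_right' ?_
          rw [Real.enorm_of_nonneg (by norm_num)]
          exact ENNReal.ofReal_le_one.2 (by norm_num)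
      _ = ∫⁻ z, ‖Real.exp (-lam * p.2)‖ₑ *
          ‖{z : ℝ × ℝ | |p.1 - z.1| < p.2 - z.2}.indicator f z‖ₑ ∂(mQ l T) := by
          rw [lintegral_const_mul']
          exact enorm_ne_top
      _ ≤ _ := by
          refine lintegral_mono fun z => ?_
          by_cases hz : |p.1 - z.1| < p.2 - z.2
          · have hz2 : z.2 < p.2 := by
              have := (abs_nonneg (p.1 - z.1)).trans_lt hz
              linarith
            simp only [Pi.mul_apply, k]
            rw [indicator_of_mem (show z ∈ {z : ℝ × ℝ | |p.1 - z.1| < p.2 - z.2} from hz),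
              indicator_of_mem (show z ∈ {z : ℝ × ℝ | z.2 < p.2} from hz2),
              enorm_mul, ← mul_assoc, Real.enorm_of_nonneg (Real.exp_pos _).le,
              Real.enorm_of_nonneg (Real.exp_pos _).le,
              ← ENNReal.ofReal_mul (Real.exp_pos _).le, ← Real.exp_add]
            gcongr
            nlinarith
          · rw [indicator_of_notMem (show z ∉ {z : ℝ × ℝ | |p.1 - z.1| < p.2 - z.2} from hz)]
            simp
  have h2 := ENNReal.lintegral_mul_le_Lp_mul_Lq (mQ l T) Real.HolderConjugate.two_two
    hk.aemeasurable hw.enorm.aemeasurable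
  refine (h1.trans h2).trans ?_
  have h3 : wNorm Prod.snd (mQ l T) lam f
      = (∫⁻ z, ‖Real.exp (-lam * z.2) * f z‖ₑ ^ (2 : ℝ) ∂(mQ l T)) ^ (1 / 2 : ℝ) := by
    rw [wNorm, eLpNorm_eq_lintegral_rpow_enorm_toReal (by norm_num) (by norm_num)]
    simp
  rw [h3]
  refine mul_le_mul' (ENNReal.rpow_le_rpow ?_ (by norm_num)) le_rfl
  have h4 : ∀ z, k z ^ (2 : ℝ) = {z : ℝ × ℝ | z.2 < p.2}.indicator
      (fun z => ENNReal.ofReal (Real.exp (-lam * (p.2 - z.2))) ^ 2) z := fun z => by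
    rw [show (2 : ℝ) = ((2 : ℕ) : ℝ) by norm_num, ENNReal.rpow_natCast]
    by_cases hz : z.2 < p.2 <;> simp [k, hz]
  simp only [h4]
  rw [mQ, lintegral_prod _ ((Measurable.indicator (by fun_prop) hS).aemeasurable)]
  calc _ ≤ ∫⁻ _ in Ioo 0 l, ENNReal.ofReal (1 / (2 * lam)) := by
        refine lintegral_mono fun x => ?_
        refine le_trans ?_ (lintegral_exp_le hl p.2)
        rw [← lintegral_indicator measurableSet_Iio]
        refine (lintegral_mono' Measure.restrict_le_self le_rfl).trans (le_of_eq ?_)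
        refine lintegral_congr fun s => ?_
        by_cases hs : s < p.2 <;> simp [hs]
    _ = _ := by
        rw [lintegral_const, mul_comm]
        simp

theorem tendsto_coneConst (l : ℝ) : Tendsto (coneConst l) atTop (𝓝 0) := by
  have h1 : Tendsto (fun lam : ℝ => ENNReal.ofReal (1 / (2 * lam))) atTop (𝓝 0) := by
    rw [← ENNReal.ofReal_zero]
    refine ENNReal.tendsto_ofReal ?_
    simp only [one_div]
    exact tendsto_inv_atTop_zero.comp (tendsto_id.const_mul_atTop (by norm_num))
  have h2 := ENNReal.Tendsto.const_mul (a := ENNReal.ofReal l) h1 (Or.inr ENNReal.ofReal_ne_top)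
  rw [mul_zero] at h2
  have h3 := (ENNReal.continuous_rpow_const (y := 1 / 2)).continuousAt.tendsto.comp h2
  rw [ENNReal.zero_rpow_of_pos (by norm_num)] at h3
  exact h3

/-- Sections `y ↦ D f (γ y)` of the d'Alembert operator which preserve the time variable. -/
theorem isWSmall_dAlembert_comp {Y : Type*} [MeasurableSpace Y] (l T : ℝ) (ν : Measure Y)
    [IsFiniteMeasure ν] (γ : Y → ℝ × ℝ) :
    IsWSmall Prod.snd (fun y => (γ y).2) (mQ l T) ν (fun f y => dAlembert l T f (γ y)) := by
  intro ε hε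
  have h1 : Tendsto (fun lam => coneConst l lam * ν univ ^ ((2 : ENNReal).toReal⁻¹)) atTop (𝓝 0) := by
    have := ENNReal.Tendsto.mul_const (b := ν univ ^ ((2 : ENNReal).toReal⁻¹)) (tendsto_coneConst l)
      (Or.inr (ENNReal.rpow_ne_top_of_nonneg (by simp) (measure_ne_top _ _)))
    simpa using this
  filter_upwards [h1.eventually_le_const (pos_iff_ne_zero.2 hε), eventually_gt_atTop 0]
    with lam hl hl0 f hf
  refine (eLpNorm_le_of_ae_enorm_bound
    (Eventually.of_forall fun y => enorm_dAlembert_le l T hl0 hf (γ y))).trans ?_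
  rw [smul_eq_mul, mul_right_comm]
  gcongr

theorem isL2Op_dAlembert_comp {Y : Type*} [MeasurableSpace Y] (l T : ℝ) (ν : Measure Y)
    [IsFiniteMeasure ν] {γ : Y → ℝ × ℝ} (hγ : Measurable γ) (hγT : ∀ᵐ y ∂ν, (γ y).2 ≤ T) :
    IsL2Op (mQ l T) ν (fun f y => dAlembert l T f (γ y)) where
  meas f hf := (stronglyMeasurable_dAlembert l T hf).comp_measurable hγ
  add f g hf hg := by ext y; simp [dAlembert_add l T hf hg]
  smul c f := by ext y; simp [dAlembert_smul]
  bound := (isWSmall_dAlembert_comp l T ν γ).bound ((ae_mQ l T).mono fun t h => h.2.1.le) hγT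

end

section

/-! ### The system for the travelling waves and the solution -/

/-- `N` stands for a norm equivalent to the given one in which `K` is a contraction; none of the
norm axioms is needed. Some power of `K` is then small in the original operator norm, and `1 - K`
divides `1 - K ^ n`. -/
theorem exists_resolvent_of_contracting {E : Type*} [NormedAddCommGroup E] [NormedSpace ℝ E]
    [CompleteSpace E] (K : E →L[ℝ] E) (N : E → ENNReal) {C C' : ENNReal} (hC : C ≠ ⊤)
    (hC' : C' ≠ ⊤) (h1 : ∀ y, ‖y‖ₑ ≤ C * N y) (h2 : ∀ y, N y ≤ C' * ‖y‖ₑ)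
    (hK : ∀ y, N (K y) ≤ 2⁻¹ * N y) :
    ∃ R : E →L[ℝ] E, ∀ y d, y = K y + d ↔ y = R d := by
  have hpow : ∀ (n : ℕ) y, N ((K ^ n) y) ≤ 2⁻¹ ^ n * N y := by
    intro n
    induction n with
    | zero => intro y; simp
    | succ n ih =>
      intro y
      rw [pow_succ', pow_succ', mul_assoc]
      exact (hK _).trans (by gcongr; exact ih y)
  have hlim : Tendsto (fun n : ℕ => C * (2⁻¹ ^ n * C')) atTop (𝓝 0) := by
    have h := ENNReal.tendsto_pow_atTop_nhds_zero_of_lt_one (r := 2⁻¹) (by norm_num)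
    have h' := ENNReal.Tendsto.const_mul (a := C) (ENNReal.Tendsto.mul_const (b := C') h
      (Or.inr hC')) (Or.inr hC)
    simpa using h'
  obtain ⟨n, hn⟩ := (hlim.eventually_le_const (show (0 : ENNReal) < 2⁻¹ by simp)).exists
  have hnorm : ‖K ^ n‖ < 1 := by
    refine lt_of_le_of_lt (ContinuousLinearMap.opNorm_le_bound (M := 1 / 2) _ (by norm_num)
      fun y => ?_) (by norm_num)
    have : ‖(K ^ n) y‖ₑ ≤ 2⁻¹ * ‖y‖ₑ := by
      calc ‖(K ^ n) y‖ₑ ≤ C * (2⁻¹ ^ n * (C' * ‖y‖ₑ)) := by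
            refine (h1 _).trans ?_
            gcongr
            refine (hpow n y).trans ?_
            gcongr
            exact h2 y
        _ = C * (2⁻¹ ^ n * C') * ‖y‖ₑ := by ring
        _ ≤ _ := by gcongr
    have h3 := ENNReal.toReal_mono (ENNReal.mul_ne_top (by simp) enorm_ne_top) this
    simpa [ENNReal.toReal_mul] using h3
  -- A product of commuting elements is a unit only if both factors are, so the factorization of `1
  -- - K ^ n` by the geometric sum passes invertibility to `1 - K`.
  have hu : IsUnit (1 - K ^ n) := isUnit_one_sub_of_norm_lt_one hnorm
  have hcomm : Commute (1 - K) (∑ i ∈ Finset.range n, K ^ i) := by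
    unfold Commute SemiconjBy
    rw [mul_neg_geom_sum, geom_sum_mul_neg]
  rw [← mul_neg_geom_sum] at hu
  obtain ⟨U, hU⟩ := (hcomm.isUnit_mul_iff.1 hu).1
  refine ⟨↑U⁻¹, fun y d => ?_⟩
  have e : y = K y + d ↔ (U : E →L[ℝ] E) y = d := by
    rw [hU, sub_apply, one_apply_eq_self, sub_eq_iff_eq_add']
  rw [e]
  constructor
  · rintro rfl
    rw [← mul_apply_eq_comp, Units.inv_mul, one_apply_eq_self]
  · rintro rfl
    rw [← mul_apply_eq_comp, Units.mul_inv, one_apply_eq_self]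

variable {l : Fin 3 → ℝ} (hl : ∀ j, 0 < l j) (T : ℝ)

/-- The delay by the length of an edge. -/
def tau (j : Fin 3) : L2 T →L[ℝ] L2 T := (isL2Op_shiftOp T (hl j)).toCLM

theorem isL2Op_outgoing (L : ℝ) : IsL2Op (mT T) (mQ L T) (waveOp T fun x => x) :=
  isL2Op_waveOp L T measurable_id fun _ hx => hx.1

theorem isL2Op_incoming (L : ℝ) : IsL2Op (mT T) (mQ L T) (waveOp T fun x => L - x) :=
  isL2Op_waveOp L T (by fun_prop) fun _ hx => sub_pos.2 hx.2

theorem isL2Op_dAlembert (L : ℝ) : IsL2Op (mQ L T) (mQ L T) (dAlembert L T) :=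
  isL2Op_dAlembert_comp L T (mQ L T) measurable_id ((ae_mQ L T).mono fun _ h => h.2.2.le)

theorem isL2Op_traceD (L x : ℝ) :
    IsL2Op (mQ L T) (mT T) (fun f t => dAlembert L T f (x, t)) :=
  isL2Op_dAlembert_comp L T (mT T) (γ := fun t => (x, t)) (by fun_prop)
    ((ae_mT T).mono fun _ h => h.2.le)

/-- The trace of the d'Alembert operator at `x`. -/
def traceD (L x : ℝ) : L2Q L T →L[ℝ] L2 T := (isL2Op_traceD T L x).toCLM

/-- The wave in the edge with outgoing part `a`, incoming part `b` and right hand side `f`. -/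
def edgeSol (L : ℝ) (a b : L2 T) (f : L2Q L T) : L2Q L T :=
  (isL2Op_outgoing T L).toCLM a + (isL2Op_incoming T L).toCLM b + (isL2Op_dAlembert T L).toCLM f

/-- Triples `(a, b, u)` of the waves leaving the centre, the waves leaving the boundary vertices
and the solution. -/
abbrev State (l : Fin 3 → ℝ) (T : ℝ) : Type :=
  (Fin 3 → L2 T) × (Fin 3 → L2 T) × ((j : Fin 3) → L2Q (l j) T)

/-- The value at the centre of the wave which arrives there along the edge `j`. -/
def arriving (M : ∀ j, L2Q (l j) T →L[ℝ] L2Q (l j) T) (j : Fin 3) : State l T →L[ℝ] L2 T :=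
  (tau hl T j).comp ((ContinuousLinearMap.proj j).comp
    ((ContinuousLinearMap.fst ℝ _ _).comp (ContinuousLinearMap.snd ℝ _ _))) +
  ((traceD T (l j) 0).comp (M j)).comp ((ContinuousLinearMap.proj j).comp
    ((ContinuousLinearMap.snd ℝ _ _).comp (ContinuousLinearMap.snd ℝ _ _)))

theorem arriving_apply (M : ∀ j, L2Q (l j) T →L[ℝ] L2Q (l j) T) (j : Fin 3) (y : State l T) :
    arriving hl T M j y = tau hl T j (y.2.1 j) + traceD T (l j) 0 (M j (y.2.2 j)) := rfl

/-- The linear part of the system for the waves: scattering at the centre with the matrix `c`,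
reflection at the boundary vertices, and the right hand side `M u` in the edges. -/
def sysK (c : Fin 3 → Fin 3 → ℝ) (M : ∀ j, L2Q (l j) T →L[ℝ] L2Q (l j) T) :
    State l T →L[ℝ] State l T :=
  (ContinuousLinearMap.pi fun j => ∑ i, c j i • arriving hl T M i).prod
    ((ContinuousLinearMap.pi fun j =>
      -((tau hl T j).comp ((ContinuousLinearMap.proj j).comp (ContinuousLinearMap.fst ℝ _ _))) -
      ((traceD T (l j) (l j)).comp (M j)).comp ((ContinuousLinearMap.proj j).comp
        ((ContinuousLinearMap.snd ℝ _ _).comp (ContinuousLinearMap.snd ℝ _ _)))).prod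
    (ContinuousLinearMap.pi fun j =>
      (isL2Op_outgoing T (l j)).toCLM.comp
        ((ContinuousLinearMap.proj j).comp (ContinuousLinearMap.fst ℝ _ _)) +
      (isL2Op_incoming T (l j)).toCLM.comp ((ContinuousLinearMap.proj j).comp
        ((ContinuousLinearMap.fst ℝ _ _).comp (ContinuousLinearMap.snd ℝ _ _))) +
      ((isL2Op_dAlembert T (l j)).toCLM.comp (M j)).comp ((ContinuousLinearMap.proj j).comp
        ((ContinuousLinearMap.snd ℝ _ _).comp (ContinuousLinearMap.snd ℝ _ _)))))

theorem sysK_apply (c : Fin 3 → Fin 3 → ℝ) (M : ∀ j, L2Q (l j) T →L[ℝ] L2Q (l j) T)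
    (y : State l T) :
    sysK hl T c M y = (fun j => ∑ i, c j i • arriving hl T M i y,
      fun j => -tau hl T j (y.1 j) - traceD T (l j) (l j) (M j (y.2.2 j)),
      fun j => edgeSol T (l j) (y.1 j) (y.2.1 j) (M j (y.2.2 j))) := by
  refine Prod.ext ?_ (Prod.ext rfl rfl)
  ext1 j
  simp [sysK]

/-- The weighted norm of a state. -/
def stateNorm (lam : ℝ) (y : State l T) : ENNReal :=
  ∑ j, (wNorm id (mT T) lam (y.1 j) + wNorm id (mT T) lam (y.2.1 j)
    + wNorm Prod.snd (mQ (l j) T) lam (y.2.2 j))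

variable {T}

theorem le_stateNorm (lam : ℝ) (y : State l T) (j : Fin 3) :
    wNorm id (mT T) lam (y.1 j) ≤ stateNorm T lam y ∧
    wNorm id (mT T) lam (y.2.1 j) ≤ stateNorm T lam y ∧
    wNorm Prod.snd (mQ (l j) T) lam (y.2.2 j) ≤ stateNorm T lam y := by
  have h := Finset.single_le_sum (f := fun j => wNorm id (mT T) lam (y.1 j)
    + wNorm id (mT T) lam (y.2.1 j) + wNorm Prod.snd (mQ (l j) T) lam (y.2.2 j))
    (fun _ _ => zero_le) (Finset.mem_univ j)
  exact ⟨(le_self_add.trans le_self_add).trans h, (le_add_self.trans le_self_add).trans h,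
    le_add_self.trans h⟩

theorem enorm_le_stateNorm {lam : ℝ} (hlam : 0 ≤ lam) (y : State l T) :
    ‖y‖ₑ ≤ ENNReal.ofReal (Real.exp (lam * T)) * stateNorm T lam y := by
  have h1 : ∀ a : L2 T, ‖a‖ₑ ≤ ENNReal.ofReal (Real.exp (lam * T)) * wNorm id (mT T) lam a :=
    fun a => by
      rw [Lp.enorm_def]
      exact eLpNorm_le_wNorm hlam ((ae_mT T).mono fun t h => h.2.le) _
  have h2 : ∀ j, ∀ a : L2Q (l j) T, ‖a‖ₑ ≤ ENNReal.ofReal (Real.exp (lam * T))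
      * wNorm Prod.snd (mQ (l j) T) lam a := fun j a => by
    rw [Lp.enorm_def]
    exact eLpNorm_le_wNorm hlam ((ae_mQ (l j) T).mono fun t h => h.2.2.le) _
  set B := ENNReal.ofReal (Real.exp (lam * T)) * stateNorm T lam y with hB
  -- The weighted norm takes values in `ENNReal` and is not yet known to be finite; the infinite
  -- case is trivial and is removed in order to compare real norms.
  by_cases hT : B = ⊤
  · rw [hT]
    exact le_top
  have h3 : ∀ {E : Type} [NormedAddCommGroup E] (x : E), ‖x‖ₑ ≤ B ↔ ‖x‖ ≤ B.toReal :=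
    fun x => by rw [← toReal_enorm, ENNReal.toReal_le_toReal enorm_ne_top hT]
  have hB0 : 0 ≤ B.toReal := ENNReal.toReal_nonneg
  rw [h3, Prod.norm_def, Prod.norm_def, max_le_iff, max_le_iff, pi_norm_le_iff_of_nonneg hB0,
    pi_norm_le_iff_of_nonneg hB0, pi_norm_le_iff_of_nonneg hB0]
  refine ⟨fun j => (h3 _).1 ((h1 _).trans ?_), fun j => (h3 _).1 ((h1 _).trans ?_),
    fun j => (h3 _).1 ((h2 j _).trans ?_)⟩ <;> rw [hB] <;> gcongr
  · exact (le_stateNorm lam y j).1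
  · exact (le_stateNorm lam y j).2.1
  · exact (le_stateNorm lam y j).2.2

theorem stateNorm_le_enorm {lam : ℝ} (hlam : 0 ≤ lam) (y : State l T) :
    stateNorm T lam y ≤ 9 * ‖y‖ₑ := by
  have h1 : ∀ a : L2 T, ‖a‖ ≤ ‖y‖ → wNorm id (mT T) lam a ≤ ‖y‖ₑ := fun a ha => by
    refine (wNorm_le_eLpNorm hlam ((ae_mT T).mono fun t h => h.1.le) _).trans ?_
    rw [← Lp.enorm_def, ← ofReal_norm, ← ofReal_norm]
    exact ENNReal.ofReal_le_ofReal ha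
  have h2 : ∀ j, ∀ a : L2Q (l j) T, ‖a‖ ≤ ‖y‖ → wNorm Prod.snd (mQ (l j) T) lam a ≤ ‖y‖ₑ :=
    fun j a ha => by
      refine (wNorm_le_eLpNorm hlam ((ae_mQ (l j) T).mono fun t h => h.2.1.le) _).trans ?_
      rw [← Lp.enorm_def, ← ofReal_norm, ← ofReal_norm]
      exact ENNReal.ofReal_le_ofReal ha
  calc stateNorm T lam y ≤ ∑ _j : Fin 3, (‖y‖ₑ + ‖y‖ₑ + ‖y‖ₑ) := by
        refine Finset.sum_le_sum fun j _ => add_le_add (add_le_add ?_ ?_) ?_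
        · exact h1 _ ((norm_le_pi_norm y.1 j).trans (norm_fst_le y))
        · exact h1 _ ((norm_le_pi_norm y.2.1 j).trans ((norm_fst_le y.2).trans (norm_snd_le y)))
        · exact h2 j _ ((norm_le_pi_norm y.2.2 j).trans ((norm_snd_le y.2).trans (norm_snd_le y)))
    _ = 9 * ‖y‖ₑ := by
        rw [Finset.sum_const, Finset.card_univ, Fintype.card_fin, nsmul_eq_mul]
        push_cast
        ring

/-- Every building block is small for large `λ`, while the scattering coefficients and the bound of
`M` do not depend on `λ`. Only the size of the coefficients enters, so the same estimate serves the
direct and the inverse problem. -/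
theorem stateNorm_sysK_le {c : Fin 3 → Fin 3 → ℝ} (hc : ∀ i j, |c i j| ≤ 1)
    {M : ∀ j, L2Q (l j) T →L[ℝ] L2Q (l j) T} {m : NNReal}
    (hM : ∀ j lam f, wNorm Prod.snd (mQ (l j) T) lam (M j f)
      ≤ m * wNorm Prod.snd (mQ (l j) T) lam f) :
    ∀ᶠ lam in atTop, ∀ y, stateNorm T lam (sysK hl T c M y) ≤ 2⁻¹ * stateNorm T lam y := by
  -- Each edge contributes 6 + 2 + 3 terms bounded by `e`, which makes 33 on the star, and 33 / 66 =
  -- 1 / 2. The factor `1 + m` allows the same `ε` for terms with and without `M`.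
  set ε : ENNReal := (66 * (1 + (m : ENNReal)))⁻¹ with hε
  have hε0 : ε ≠ 0 := ENNReal.inv_ne_zero.2
    (ENNReal.mul_ne_top (by norm_num) (ENNReal.add_ne_top.2 ⟨by simp, by simp⟩))
  have hm0 : (1 + (m : ENNReal)) ≠ 0 := by simp
  have hε1 : ε * (1 + m) = 66⁻¹ := by
    rw [hε, ENNReal.mul_inv (by simp) (by simp), mul_assoc, ENNReal.inv_mul_cancel hm0 (by simp),
      mul_one]
  have e1 : ∀ j, ∀ᶠ lam in atTop, ∀ f : L2 T,
      wNorm id (mT T) lam (tau hl T j f) ≤ ε * wNorm id (mT T) lam f := fun j =>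
    (isWSmall_shiftOp T (hl j)).toCLM _ ε hε0
  have e2 : ∀ j, ∀ᶠ lam in atTop, ∀ f : L2 T,
      wNorm Prod.snd (mQ (l j) T) lam ((isL2Op_outgoing T (l j)).toCLM f)
        ≤ ε * wNorm id (mT T) lam f := fun j =>
    (isWSmall_waveOp (l j) T measurable_id fun _ hx => hx.1).toCLM _ ε hε0
  have e3 : ∀ j, ∀ᶠ lam in atTop, ∀ f : L2 T,
      wNorm Prod.snd (mQ (l j) T) lam ((isL2Op_incoming T (l j)).toCLM f)
        ≤ ε * wNorm id (mT T) lam f := fun j =>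
    (isWSmall_waveOp (l j) T (by fun_prop) fun _ hx => sub_pos.2 hx.2).toCLM _ ε hε0
  have e4 : ∀ j, ∀ᶠ lam in atTop, ∀ f : L2Q (l j) T,
      wNorm Prod.snd (mQ (l j) T) lam ((isL2Op_dAlembert T (l j)).toCLM f)
        ≤ ε * wNorm Prod.snd (mQ (l j) T) lam f := fun j =>
    (isWSmall_dAlembert_comp (l j) T (mQ (l j) T) id).toCLM _ ε hε0
  have e5 : ∀ j, ∀ x : ℝ, ∀ᶠ lam in atTop, ∀ f : L2Q (l j) T,
      wNorm id (mT T) lam (traceD T (l j) x f)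
        ≤ ε * wNorm Prod.snd (mQ (l j) T) lam f := fun j x =>
    (isWSmall_dAlembert_comp (l j) T (mT T) fun t => (x, t)).toCLM _ ε hε0
  filter_upwards [eventually_all.2 e1, eventually_all.2 e2, eventually_all.2 e3,
    eventually_all.2 e4, eventually_all.2 fun j => e5 j 0, eventually_all.2 fun j => e5 j (l j)]
    with lam h1 h2 h3 h4 h5 h6 y
  set e : ENNReal := 66⁻¹ * stateNorm T lam y with he
  have hεe : ε * stateNorm T lam y ≤ e := by
    rw [he, ← hε1]
    gcongr
    exact le_mul_of_one_le_right' le_self_add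
  have hεm : ε * (m * stateNorm T lam y) ≤ e := by
    rw [he, ← hε1, ← mul_assoc]
    gcongr
    exact le_add_self
  have hMe : ∀ j, ε * wNorm Prod.snd (mQ (l j) T) lam (M j (y.2.2 j)) ≤ e := fun j =>
    le_trans (by gcongr; exact (hM j lam _).trans (by gcongr; exact (le_stateNorm lam y j).2.2)) hεm
  have hae : ∀ j, ε * wNorm id (mT T) lam (y.1 j) ≤ e := fun j =>
    le_trans (by gcongr; exact (le_stateNorm lam y j).1) hεe
  have hbe : ∀ j, ε * wNorm id (mT T) lam (y.2.1 j) ≤ e := fun j =>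
    le_trans (by gcongr; exact (le_stateNorm lam y j).2.1) hεe
  have harr : ∀ j, wNorm id (mT T) lam (arriving hl T M j y) ≤ e + e := fun j => by
    rw [arriving_apply]
    exact (wNorm_add_le measurable_id _ _).trans
      (add_le_add ((h1 j _).trans (hbe j)) ((h5 j _).trans (hMe j)))
  rw [sysK_apply]
  have A : ∀ j, wNorm id (mT T) lam (∑ i, c j i • arriving hl T M i y : L2 T) ≤ 6 * e := fun j => by
    refine (wNorm_sum_le measurable_id _ _).trans ?_
    calc _ ≤ ∑ _i : Fin 3, (e + e) := by
          refine Finset.sum_le_sum fun i _ => ?_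
          rw [wNorm_smul]
          refine le_trans (mul_le_of_le_one_left' ?_) (harr i)
          rw [← ofReal_norm, Real.norm_eq_abs]
          exact ENNReal.ofReal_le_one.2 (hc j i)
      _ = 6 * e := by
          rw [Finset.sum_const, Finset.card_univ, Fintype.card_fin, nsmul_eq_mul]
          push_cast
          ring
  have B : ∀ j, wNorm id (mT T) lam
      (-tau hl T j (y.1 j) - traceD T (l j) (l j) (M j (y.2.2 j)) : L2 T) ≤ 2 * e := fun j => by
    rw [sub_eq_add_neg, two_mul]
    refine (wNorm_add_le measurable_id _ _).trans ?_
    rw [wNorm_neg, wNorm_neg]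
    exact add_le_add ((h1 j _).trans (hae j)) ((h6 j _).trans (hMe j))
  have D : ∀ j, wNorm Prod.snd (mQ (l j) T) lam
      (edgeSol T (l j) (y.1 j) (y.2.1 j) (M j (y.2.2 j))) ≤ 3 * e := fun j => by
    rw [show (3 : ENNReal) * e = e + e + e by ring]
    refine (wNorm_add_le measurable_snd _ _).trans
      (add_le_add ((wNorm_add_le measurable_snd _ _).trans (add_le_add ?_ ?_)) ?_)
    · exact (h2 j _).trans (hae j)
    · exact (h3 j _).trans (hbe j)
    · exact (h4 j _).trans (hMe j)
  calc _ ≤ ∑ _j : Fin 3, (6 * e + 2 * e + 3 * e) :=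
        Finset.sum_le_sum fun j _ => add_le_add (add_le_add (A j) (B j)) (D j)
    _ = 33 * e := by
        rw [Finset.sum_const, Finset.card_univ, Fintype.card_fin, nsmul_eq_mul]
        push_cast
        ring
    _ = 2⁻¹ * stateNorm T lam y := by
        rw [he, ← mul_assoc]
        congr 1
        rw [show (66 : ENNReal) = 33 * 2 by norm_num, ENNReal.mul_inv (by simp) (by simp),
          ← mul_assoc, ENNReal.mul_inv_cancel (by simp) (by simp), one_mul]

theorem exists_sysK_resolvent {c : Fin 3 → Fin 3 → ℝ} (hc : ∀ i j, |c i j| ≤ 1)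
    {M : ∀ j, L2Q (l j) T →L[ℝ] L2Q (l j) T} {m : NNReal}
    (hM : ∀ j lam f, wNorm Prod.snd (mQ (l j) T) lam (M j f)
      ≤ m * wNorm Prod.snd (mQ (l j) T) lam f) :
    ∃ R : State l T →L[ℝ] State l T, ∀ y d, y = sysK hl T c M y + d ↔ y = R d := by
  obtain ⟨lam, h1, h2⟩ := ((stateNorm_sysK_le hl hc hM).and (eventually_ge_atTop 0)).exists
  exact exists_resolvent_of_contracting _ (stateNorm T lam) ENNReal.ofReal_ne_top
    (by norm_num) (enorm_le_stateNorm h2) (stateNorm_le_enorm h2) h1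

/-! ### The potential as a bounded multiplication operator -/

/-- Multiplication by `-q(x)` in `L²((0,L) × (0,T))`. -/
theorem isL2Op_potential (L T : ℝ) {q : ℝ → ℝ} (hq : Measurable q) {m : NNReal}
    (hm : ∀ x, |q x| ≤ m) :
    IsL2Op (mQ L T) (mQ L T) (fun f p => -(q p.1 * f p)) where
  meas f hf := ((hq.comp measurable_fst).stronglyMeasurable.mul hf).neg
  add f g _ _ := by ext p; simp only [Pi.add_apply]; ring
  smul c f := by ext p; simp only [Pi.smul_apply, smul_eq_mul]; ring
  bound := ⟨m, fun f _ => eLpNorm_le_nnreal_smul_eLpNorm_of_ae_le_mul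
    (Eventually.of_forall fun p => by
      rw [nnnorm_neg, nnnorm_mul]
      gcongr
      exact hm p.1) 2⟩

theorem wNorm_potential_le (L T : ℝ) {q : ℝ → ℝ} (hq : Measurable q) {m : NNReal}
    (hm : ∀ x, |q x| ≤ m) (lam : ℝ) (f : L2Q L T) :
    wNorm Prod.snd (mQ L T) lam ((isL2Op_potential L T hq hm).toCLM f)
      ≤ m * wNorm Prod.snd (mQ L T) lam f := by
  rw [wNorm_congr ((isL2Op_potential L T hq hm).coeFn_toCLM f)]
  refine eLpNorm_le_nnreal_smul_eLpNorm_of_ae_le_mul (Eventually.of_forall fun p => ?_) 2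
  rw [nnnorm_mul, nnnorm_neg, nnnorm_mul, nnnorm_mul, mul_left_comm]
  gcongr
  exact hm p.1

end

section

/-! ### Integration along characteristics -/

theorem integral_mT_eq_ext (T : ℝ) (a : ℝ → ℝ) : ∫ t in Ioo 0 T, a t = ∫ t, ext T a t :=
  (integral_indicator measurableSet_Ioo).symm

/-- Integration by parts for a travelling wave: if `ψ` vanishes at time `T` and
`(∂_t + ∂_x) ψ = G`, then the integral of `a(t - x) G(x,t)` reduces to integrals over the ends. -/
theorem integral_wave_mul {L T K : ℝ} (hL : 0 ≤ L) {a : ℝ → ℝ}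
    (ha : IntegrableOn a (Ioo 0 T)) {G ψ : ℝ × ℝ → ℝ}
    (hGc : ContinuousOn G (Ioo 0 L ×ˢ Ioo 0 T)) (hGb : ∀ p ∈ Ioo 0 L ×ˢ Ioo 0 T, |G p| ≤ K)
    (hψc : ContinuousOn ψ (Icc 0 L ×ˢ Icc 0 T)) (hψT : ∀ x ∈ Icc 0 L, ψ (x, T) = 0)
    (hψ : ∀ x ∈ Ioo 0 L, ∀ t ∈ Ioo 0 T, HasDerivAt (fun r => ψ (x + r, t + r)) (G (x, t)) 0) :
    ∫ p, ext T a (p.2 - p.1) * G p ∂(mQ L T)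
      = (∫ t in Ioo 0 T, ext T a (t - L) * ψ (L, t)) - ∫ t in Ioo 0 T, a t * ψ (0, t) := by
  set R : Set (ℝ × ℝ) := Ioo 0 L ×ˢ Ioo 0 T with hR
  have hRm : MeasurableSet R := measurableSet_Ioo.prod measurableSet_Ioo
  set G' : ℝ × ℝ → ℝ := R.indicator G with hG'
  have hG'm : Measurable G' := by
    classical
    have := hGc.measurable_piecewise (continuousOn_const (c := (0 : ℝ))) hRm
    rw [hG', ← piecewise_eq_indicator]
    exact this
  have hai : Integrable (ext T a) := ha.integrable_indicator measurableSet_Ioo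
  have hG'b : ∀ x s, |G' (x, s)| ≤ (Ioo 0 L).indicator (fun _ => |K|) x := fun x s => by
    by_cases h : (x, s) ∈ R
    · rw [hG', indicator_of_mem h, indicator_of_mem h.1]
      exact (hGb _ h).trans (le_abs_self K)
    · rw [hG', indicator_of_notMem h, abs_zero]
      exact indicator_nonneg (fun _ _ => abs_nonneg K) _
  have hci : Integrable ((Ioo 0 L).indicator fun _ : ℝ => |K|) :=
    (integrable_indicator_iff measurableSet_Ioo).2 (by simp)
  have hint : Integrable (fun p : ℝ × ℝ => ext T a p.2 * G' (p.1, p.2 + p.1))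
      (volume.prod volume) := by
    refine Integrable.mono' (hci.mul_prod hai.norm) ?_ (Eventually.of_forall fun p => ?_)
    · exact (hai.aestronglyMeasurable.comp_snd).mul
        (hG'm.comp (by fun_prop)).aestronglyMeasurable
    · rw [norm_mul, mul_comm]
      gcongr
      exact hG'b _ _
  have e1 : ∫ p, ext T a (p.2 - p.1) * G p ∂(mQ L T)
      = ∫ p : ℝ × ℝ, ext T a (p.2 - p.1) * G' p := by
    rw [mQ_eq, ← integral_indicator hRm]
    congr 1
    ext p
    by_cases h : p ∈ R <;> simp [hG', h]
  -- In the coordinates `(x, s)` with `s = t - x` the factor `a` depends on `s` alone, and the inner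
  -- integral runs along one characteristic.
  have hshear : MeasurePreserving (fun p : ℝ × ℝ => (p.1, p.1 + p.2)) (volume.prod volume)
      (volume.prod volume) := measurePreserving_prod_add volume volume
  have e2 : ∫ p : ℝ × ℝ, ext T a (p.2 - p.1) * G' p
      = ∫ p : ℝ × ℝ, ext T a p.2 * G' (p.1, p.2 + p.1) := by
    have := hshear.integral_comp (MeasurableEquiv.shearAddRight ℝ).measurableEmbedding
      (fun p => ext T a (p.2 - p.1) * G' p)
    simp only [add_sub_cancel_left] at this
    rw [Measure.volume_eq_prod, ← this]
    simp only [add_comm]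
  have e3 : ∫ p : ℝ × ℝ, ext T a p.2 * G' (p.1, p.2 + p.1)
      = ∫ s, ext T a s * ∫ x, G' (x, s + x) := by
    have := integral_prod_symm _ hint
    rw [Measure.volume_eq_prod, this]
    simp only [integral_const_mul]
  set E : ℝ → ℝ := ext T fun t => ψ (L, t) with hE
  have e4 : ∀ s, ext T a s * ∫ x, G' (x, s + x)
      = ext T a s * E (s + L) - ext T a s * ψ (0, s) := fun s => by
    by_cases hs : s ∈ Ioo 0 T
    swap
    · simp [ext, hs]
    rw [← mul_sub]
    congr 1
    -- The characteristic starting at `(0, s)` leaves the rectangle when `x = m`, through the side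
    -- `x = L` or through the top `t = T`.
    set m := min L (T - s) with hm
    have hm0 : 0 ≤ m := le_min hL (by linarith [hs.2])
    have hmL : m ≤ L := min_le_left _ _
    have hmT : m ≤ T - s := min_le_right _ _
    have i1 : (fun x => G' (x, s + x)) = (Ioo 0 m).indicator fun x => G (x, s + x) := by
      ext x
      by_cases hx : x ∈ Ioo 0 m
      · rw [indicator_of_mem hx, hG', indicator_of_mem]
        exact ⟨⟨hx.1, hx.2.trans_le hmL⟩, by
          have := hx.1; have := hx.2; have := hs.1
          constructor <;> simp only <;> linarith⟩
      · rw [indicator_of_notMem hx, hG', indicator_of_notMem]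
        rintro ⟨⟨h1, h2⟩, h3, h4⟩
        simp only at h1 h2 h3 h4
        exact hx ⟨h1, lt_min h2 (by linarith)⟩
    have i2 : ∫ x, G' (x, s + x) = ∫ x in (0 : ℝ)..m, G (x, s + x) := by
      rw [i1, integral_indicator measurableSet_Ioo, intervalIntegral.integral_of_le hm0,
        integral_Ioc_eq_integral_Ioo]
    have i3 : ∫ x in (0 : ℝ)..m, G (x, s + x) = ψ (m, s + m) - ψ (0, s + 0) := by
      refine intervalIntegral.integral_eq_sub_of_hasDerivAt_of_le (f := fun x => ψ (x, s + x)) hm0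
        ?_ (fun x hx => ?_) ?_
      · refine hψc.comp (by fun_prop) fun x hx => ?_
        have := hs.1
        exact ⟨⟨hx.1, hx.2.trans hmL⟩, by linarith [hx.1], by linarith [hx.2]⟩
      · have := hs.1
        have h := hψ x ⟨hx.1, hx.2.trans_le hmL⟩ (s + x) ⟨by linarith [hx.1], by linarith [hx.2]⟩
        have h' := HasDerivAt.scomp x (g₁ := fun r => ψ (x + r, s + x + r)) (h := fun y => y - x)
          (by simpa using h) ((hasDerivAt_id x).sub_const x)
        rw [one_smul] at h'
        refine h'.congr_of_eventuallyEq (Eventually.of_forall fun y => ?_)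
        simp
      · rw [intervalIntegrable_iff_integrableOn_Ioo_of_le hm0]
        have : Integrable (fun x => G' (x, s + x)) :=
          hci.mono' (hG'm.comp (by fun_prop)).aestronglyMeasurable
            (Eventually.of_forall fun x => hG'b _ _)
        rw [i1] at this
        exact (integrable_indicator_iff measurableSet_Ioo).1 this
    rw [i2, i3, add_zero]
    congr 1
    -- A characteristic leaving through the top contributes nothing there, since `ψ` vanishes at
    -- time `T`; the extension by zero in `E` records this.
    rcases lt_or_ge (s + L) T with h | h
    · have : m = L := min_eq_left (by linarith)
      rw [this, hE, ext, indicator_of_mem (show s + L ∈ Ioo 0 T from ⟨by linarith [hs.1], h⟩)]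
    · have : m = T - s := min_eq_right (by linarith)
      rw [hE, ext, indicator_of_notMem (fun h' => absurd h'.2 (not_lt.2 h)), this,
        add_sub_cancel]
      exact hψT _ ⟨by linarith [hs.2], by linarith⟩
  have h0m : IntegrableOn (fun t => ext T a t * ψ (0, t)) (Icc 0 T) :=
    hai.integrableOn.mul_continuousOn (hψc.comp (f := fun t => (0, t)) (by fun_prop) fun t ht => mk_mem_prod ⟨le_rfl, hL⟩ ht)
      isCompact_Icc
  have hLm : IntegrableOn (fun t => ext T a (t - L) * ψ (L, t)) (Icc 0 T) :=
    (hai.comp_sub_right L).integrableOn.mul_continuousOn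
      (hψc.comp (f := fun t => (L, t)) (by fun_prop) fun t ht => mk_mem_prod ⟨hL, le_rfl⟩ ht) isCompact_Icc
  have k0 : Integrable fun s => ext T a s * ψ (0, s) := by
    have := (h0m.mono_set Ioo_subset_Icc_self).integrable_indicator measurableSet_Ioo
    refine this.congr (Eventually.of_forall fun s => ?_)
    by_cases hs : s ∈ Ioo 0 T <;> simp [ext, hs]
  have kL : Integrable fun t => ext T a (t - L) * E t := by
    have := (hLm.mono_set Ioo_subset_Icc_self).integrable_indicator measurableSet_Ioo
    refine this.congr (Eventually.of_forall fun s => ?_)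
    by_cases hs : s ∈ Ioo 0 T <;> simp [hE, ext, hs]
  have kL' : Integrable fun s => ext T a s * E (s + L) := by
    have := kL.comp_add_right L
    simpa using this
  rw [e1, e2, e3]
  simp only [e4]
  rw [integral_sub kL' k0, integral_mT_eq_ext, integral_mT_eq_ext]
  congr 1
  · have := integral_add_right_eq_self (μ := volume) (fun t => ext T a (t - L) * E t) L
    simp only [add_sub_cancel_right] at this
    rw [this]
    congr 1
    ext t
    by_cases ht : t ∈ Ioo 0 T <;> simp [hE, ext, ht]
  · congr 1
    ext t
    by_cases ht : t ∈ Ioo 0 T <;> simp [ext, ht]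

/-! ### Regularity of test functions on the closed rectangle -/

section Regularity

variable {L T : ℝ}

theorem uniqueDiffOn_rect (hL : 0 < L) (hT : 0 < T) :
    UniqueDiffOn ℝ (Icc 0 L ×ˢ Icc 0 T : Set (ℝ × ℝ)) :=
  (uniqueDiffOn_Icc hL).prod (uniqueDiffOn_Icc hT)

theorem derivWithin_snd_eq (hT : 0 < T) {g : ℝ × ℝ → ℝ}
    (hg : DifferentiableOn ℝ g (Icc 0 L ×ˢ Icc 0 T)) {x t : ℝ} (hx : x ∈ Icc 0 L)
    (ht : t ∈ Icc 0 T) : derivWithin (fun s => g (x, s)) (Icc 0 T) t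
      = fderivWithin ℝ g (Icc 0 L ×ˢ Icc 0 T) (x, t) (0, 1) := by
  have h1 : HasDerivWithinAt (fun s : ℝ => (x, s)) ((0, 1) : ℝ × ℝ) (Icc 0 T) t :=
    (hasDerivWithinAt_const t _ x).prodMk (hasDerivWithinAt_id t _)
  exact ((hg (x, t) (mk_mem_prod hx ht)).hasFDerivWithinAt.comp_hasDerivWithinAt t h1
    (fun s hs => mk_mem_prod hx hs)).derivWithin (uniqueDiffOn_Icc hT t ht)

theorem derivWithin_fst_eq (hL : 0 < L) {g : ℝ × ℝ → ℝ}
    (hg : DifferentiableOn ℝ g (Icc 0 L ×ˢ Icc 0 T)) {x t : ℝ} (hx : x ∈ Icc 0 L)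
    (ht : t ∈ Icc 0 T) : derivWithin (fun y => g (y, t)) (Icc 0 L) x
      = fderivWithin ℝ g (Icc 0 L ×ˢ Icc 0 T) (x, t) (1, 0) := by
  have h1 : HasDerivWithinAt (fun s : ℝ => (s, t)) ((1, 0) : ℝ × ℝ) (Icc 0 L) x :=
    (hasDerivWithinAt_id x _).prodMk (hasDerivWithinAt_const x _ t)
  exact ((hg (x, t) (mk_mem_prod hx ht)).hasFDerivWithinAt.comp_hasDerivWithinAt x h1
    (fun s hs => mk_mem_prod hs ht)).derivWithin (uniqueDiffOn_Icc hL x hx)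

variable {φ : ℝ → ℝ → ℝ}

/-- The derivative of a function of class `C²` on the closed rectangle, in the direction `v`. -/
def dirDeriv (L T : ℝ) (φ : ℝ → ℝ → ℝ) (v p : ℝ × ℝ) : ℝ :=
  fderivWithin ℝ (fun p : ℝ × ℝ => φ p.1 p.2) (Icc 0 L ×ˢ Icc 0 T) p v

theorem contDiffOn_dirDeriv (hL : 0 < L) (hT : 0 < T)
    (hφ : ContDiffOn ℝ 2 (fun p : ℝ × ℝ => φ p.1 p.2) (Icc 0 L ×ˢ Icc 0 T)) (v : ℝ × ℝ) :
    ContDiffOn ℝ 1 (dirDeriv L T φ v) (Icc 0 L ×ˢ Icc 0 T) :=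
  (hφ.fderivWithin (uniqueDiffOn_rect hL hT) (by norm_num)).clm_apply contDiffOn_const

theorem dt_eq_dirDeriv (hT : 0 < T)
    (hφ : ContDiffOn ℝ 2 (fun p : ℝ × ℝ => φ p.1 p.2) (Icc 0 L ×ˢ Icc 0 T)) {x t : ℝ}
    (hx : x ∈ Icc 0 L) (ht : t ∈ Icc 0 T) : dt T φ x t = dirDeriv L T φ (0, 1) (x, t) :=
  derivWithin_snd_eq hT (hφ.differentiableOn (by norm_num)) hx ht

theorem dx_eq_dirDeriv (hL : 0 < L)
    (hφ : ContDiffOn ℝ 2 (fun p : ℝ × ℝ => φ p.1 p.2) (Icc 0 L ×ˢ Icc 0 T)) {x t : ℝ}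
    (hx : x ∈ Icc 0 L) (ht : t ∈ Icc 0 T) : dx L φ x t = dirDeriv L T φ (1, 0) (x, t) :=
  derivWithin_fst_eq hL (hφ.differentiableOn (by norm_num)) hx ht

theorem dtt_eq (hL : 0 < L) (hT : 0 < T)
    (hφ : ContDiffOn ℝ 2 (fun p : ℝ × ℝ => φ p.1 p.2) (Icc 0 L ×ˢ Icc 0 T)) {x t : ℝ}
    (hx : x ∈ Icc 0 L) (ht : t ∈ Icc 0 T) : dtt T φ x t
      = fderivWithin ℝ (dirDeriv L T φ (0, 1)) (Icc 0 L ×ˢ Icc 0 T) (x, t) (0, 1) := by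
  rw [dtt, iteratedDerivWithin_succ, ← derivWithin_snd_eq hT
    ((contDiffOn_dirDeriv hL hT hφ _).differentiableOn (by norm_num)) hx ht]
  refine derivWithin_congr (fun s hs => ?_) ?_ <;> rw [iteratedDerivWithin_one]
  · exact dt_eq_dirDeriv hT hφ hx hs
  · exact dt_eq_dirDeriv hT hφ hx ht

theorem dxx_eq (hL : 0 < L) (hT : 0 < T)
    (hφ : ContDiffOn ℝ 2 (fun p : ℝ × ℝ => φ p.1 p.2) (Icc 0 L ×ˢ Icc 0 T)) {x t : ℝ}
    (hx : x ∈ Icc 0 L) (ht : t ∈ Icc 0 T) : dxx L φ x t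
      = fderivWithin ℝ (dirDeriv L T φ (1, 0)) (Icc 0 L ×ˢ Icc 0 T) (x, t) (1, 0) := by
  rw [dxx, iteratedDerivWithin_succ, ← derivWithin_fst_eq hL
    ((contDiffOn_dirDeriv hL hT hφ _).differentiableOn (by norm_num)) hx ht]
  refine derivWithin_congr (fun s hs => ?_) ?_ <;> rw [iteratedDerivWithin_one]
  · exact dx_eq_dirDeriv hL hφ hs ht
  · exact dx_eq_dirDeriv hL hφ hx ht

/-- `(∂_t² - ∂_x²) φ`. -/
def box (L T : ℝ) (φ : ℝ → ℝ → ℝ) (p : ℝ × ℝ) : ℝ := dtt T φ p.1 p.2 - dxx L φ p.1 p.2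

theorem continuousOn_box (hL : 0 < L) (hT : 0 < T)
    (hφ : ContDiffOn ℝ 2 (fun p : ℝ × ℝ => φ p.1 p.2) (Icc 0 L ×ˢ Icc 0 T)) :
    ContinuousOn (box L T φ) (Icc 0 L ×ˢ Icc 0 T) := by
  have h : ∀ v, ContinuousOn (fun p => fderivWithin ℝ (dirDeriv L T φ v) (Icc 0 L ×ˢ Icc 0 T) p v)
      (Icc 0 L ×ˢ Icc 0 T) := fun v =>
    ((contDiffOn_dirDeriv hL hT hφ v).continuousOn_fderivWithin (uniqueDiffOn_rect hL hT)
      (by norm_num)).clm_apply continuousOn_const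
  refine ((h (0, 1)).sub (h (1, 0))).congr fun p hp => ?_
  rw [box, dtt_eq hL hT hφ hp.1 hp.2, dxx_eq hL hT hφ hp.1 hp.2]
  rfl

/-- The two factorizations `(∂_t + ∂_x)(∂_t - ∂_x)` and `(∂_t - ∂_x)(∂_t + ∂_x)` of the wave
operator. The mixed terms cancel by symmetry of the second derivative, available in the open
rectangle. -/
theorem hasDerivAt_dirDeriv_char (hL : 0 < L) (hT : 0 < T)
    (hφ : ContDiffOn ℝ 2 (fun p : ℝ × ℝ => φ p.1 p.2) (Icc 0 L ×ˢ Icc 0 T)) {x t : ℝ}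
    (hx : x ∈ Ioo 0 L) (ht : t ∈ Ioo 0 T) :
    HasDerivAt (fun r => dirDeriv L T φ (0, 1) (x + r, t + r)
      - dirDeriv L T φ (1, 0) (x + r, t + r)) (box L T φ (x, t)) 0 ∧
    HasDerivAt (fun r => dirDeriv L T φ (0, 1) (x - r, t + r)
      + dirDeriv L T φ (1, 0) (x - r, t + r)) (box L T φ (x, t)) 0 := by
  set R : Set (ℝ × ℝ) := Icc 0 L ×ˢ Icc 0 T with hR
  have hnhds : ∀ {p : ℝ × ℝ}, p ∈ Ioo 0 L ×ˢ Ioo 0 T → R ∈ 𝓝 p := fun {p} hp =>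
    prod_mem_nhds (Icc_mem_nhds hp.1.1 hp.1.2) (Icc_mem_nhds hp.2.1 hp.2.2)
  have hp : ((x, t) : ℝ × ℝ) ∈ Ioo 0 L ×ˢ Ioo 0 T := ⟨hx, ht⟩
  set f : ℝ × ℝ → ℝ := fun p => φ p.1 p.2 with hf
  have hc : ContDiffAt ℝ 2 f (x, t) := hφ.contDiffAt (hnhds hp)
  have hsymm : IsSymmSndFDerivAt ℝ f (x, t) := hc.isSymmSndFDerivAt (by simp)
  set D' := fderiv ℝ (fderiv ℝ f) (x, t) with hD'
  have hD : HasFDerivAt (fderiv ℝ f) D' (x, t) :=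
    ((hc.fderiv_right (m := 1) (by norm_num)).differentiableAt (by norm_num)).hasFDerivAt
  have hev : ∀ v, dirDeriv L T φ v =ᶠ[𝓝 (x, t)] fun p => fderiv ℝ f p v := fun v => by
    filter_upwards [(isOpen_Ioo.prod isOpen_Ioo).mem_nhds hp] with p hp'
    rw [dirDeriv, fderivWithin_of_mem_nhds (hnhds hp')]
  have hdir : ∀ v, HasFDerivAt (dirDeriv L T φ v) (D'.flip v) (x, t) := fun v => by
    refine HasFDerivAt.congr_of_eventuallyEq ?_ (hev v)
    exact (hD.clm_apply (hasFDerivAt_const v (x, t))).congr_fderiv (by ext <;> simp)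
  have hbox : box L T φ (x, t) = D' (0, 1) (0, 1) - D' (1, 0) (1, 0) := by
    rw [box, dtt_eq hL hT hφ (Ioo_subset_Icc_self hx) (Ioo_subset_Icc_self ht),
      dxx_eq hL hT hφ (Ioo_subset_Icc_self hx) (Ioo_subset_Icc_self ht),
      fderivWithin_of_mem_nhds (hnhds hp), fderivWithin_of_mem_nhds (hnhds hp),
      (hdir _).fderiv, (hdir _).fderiv]
    rfl
  have hs := hsymm (0, 1) (1, 0)
  rw [← hD'] at hs
  have hadd : D' (1, 1) = D' (1, 0) + D' (0, 1) := by
    rw [← map_add]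
    simp
  have hsub : D' (-1, 1) = -D' (1, 0) + D' (0, 1) := by
    rw [← map_neg, ← map_add]
    simp
  have path : ∀ (σ : ℝ) v, HasDerivAt (fun r => dirDeriv L T φ v (x + σ * r, t + r))
      (D' (σ, 1) v) 0 := fun σ v => by
    have h1 : HasDerivAt (fun r : ℝ => (x + σ * r, t + r)) (σ, 1) 0 := by
      have := (((hasDerivAt_id (0 : ℝ)).const_mul σ).const_add x).prodMk
        ((hasDerivAt_id (0 : ℝ)).const_add t)
      simpa using this
    have h2 := hdir v
    rw [show ((x, t) : ℝ × ℝ) = (x + σ * 0, t + 0) by simp] at h2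
    exact h2.comp_hasDerivAt (0 : ℝ) h1
  constructor
  · have := (path 1 (0, 1)).sub (path 1 (1, 0))
    rw [hadd] at this
    simp only [add_apply] at this
    rw [hbox]
    refine HasDerivAt.congr_deriv (HasDerivAt.congr_of_eventuallyEq this ?_) ?_
    · exact Eventually.of_forall fun r => by simp
    · rw [hs]; ring
  · have := (path (-1) (0, 1)).add (path (-1) (1, 0))
    rw [hsub] at this
    simp only [add_apply, neg_apply] at this
    rw [hbox]
    refine HasDerivAt.congr_deriv (HasDerivAt.congr_of_eventuallyEq this ?_) ?_
    · exact Eventually.of_forall fun r => by simp [sub_eq_add_neg]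
    · rw [hs]; ring

end Regularity

end

section

/-! ### The weak form of the wave operator on one edge -/

/-- The conditions on a test function which concern a single edge. -/
structure IsEdgeTest (L T : ℝ) (φ : ℝ → ℝ → ℝ) : Prop where
  contDiffOn : ContDiffOn ℝ 2 (fun p : ℝ × ℝ => φ p.1 p.2) (Icc 0 L ×ˢ Icc 0 T)
  final : ∀ x ∈ Icc 0 L, φ x T = 0
  final_dt : ∀ x ∈ Icc 0 L, dt T φ x T = 0
  boundary : ∀ t ∈ Icc 0 T, φ L t = 0

theorem IsTest.edge {l : Fin 3 → ℝ} {T : ℝ} {φ : Fin 3 → ℝ → ℝ → ℝ} (h : IsTest l T φ)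
    (j : Fin 3) : IsEdgeTest (l j) T (φ j) :=
  ⟨h.contDiffOn j, h.final j, h.final_dt j, h.boundary j⟩

theorem aestronglyMeasurable_mQ {L T : ℝ} {G : ℝ × ℝ → ℝ}
    (hG : ContinuousOn G (Icc 0 L ×ˢ Icc 0 T)) : AEStronglyMeasurable G (mQ L T) := by
  rw [mQ_eq]
  exact (hG.mono (prod_mono Ioo_subset_Icc_self Ioo_subset_Icc_self)).aestronglyMeasurable
    (measurableSet_Ioo.prod measurableSet_Ioo)

theorem exists_bound_rect {L T : ℝ} {G : ℝ × ℝ → ℝ}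
    (hG : ContinuousOn G (Icc 0 L ×ˢ Icc 0 T)) :
    ∃ K, ∀ p ∈ Icc 0 L ×ˢ Icc 0 T, |G p| ≤ K :=
  (isCompact_Icc.prod isCompact_Icc).exists_bound_of_continuousOn hG

theorem ae_bound_mQ {L T : ℝ} {G : ℝ × ℝ → ℝ}
    (hG : ContinuousOn G (Icc 0 L ×ˢ Icc 0 T)) : ∃ K, ∀ᵐ p ∂(mQ L T), ‖G p‖ ≤ K := by
  obtain ⟨K, hK⟩ := exists_bound_rect hG
  exact ⟨K, (ae_mQ L T).mono fun p hp =>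
    hK p ⟨Ioo_subset_Icc_self hp.1, Ioo_subset_Icc_self hp.2⟩⟩

theorem aestronglyMeasurable_mT {T : ℝ} {c : ℝ → ℝ} (hc : ContinuousOn c (Icc 0 T)) :
    AEStronglyMeasurable c (mT T) :=
  (hc.mono Ioo_subset_Icc_self).aestronglyMeasurable measurableSet_Ioo

theorem ae_bound_mT {T : ℝ} {c : ℝ → ℝ} (hc : ContinuousOn c (Icc 0 T)) :
    ∃ K, ∀ᵐ t ∂(mT T), ‖c t‖ ≤ K := by
  obtain ⟨K, hK⟩ := isCompact_Icc.exists_bound_of_continuousOn hc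
  exact ⟨K, (ae_mT T).mono fun t ht => hK t (Ioo_subset_Icc_self ht)⟩

section Edge

variable {L T : ℝ} {φ : ℝ → ℝ → ℝ}

/-- `∂_t φ - ∂_x φ`. -/
def charM (L T : ℝ) (φ : ℝ → ℝ → ℝ) (p : ℝ × ℝ) : ℝ :=
  dirDeriv L T φ (0, 1) p - dirDeriv L T φ (1, 0) p

/-- `∂_t φ + ∂_x φ`. -/
def charP (L T : ℝ) (φ : ℝ → ℝ → ℝ) (p : ℝ × ℝ) : ℝ :=
  dirDeriv L T φ (0, 1) p + dirDeriv L T φ (1, 0) p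

namespace IsEdgeTest

variable (h : IsEdgeTest L T φ) (hL : 0 < L) (hT : 0 < T)
include h hL hT

theorem continuousOn_dirDeriv (v : ℝ × ℝ) :
    ContinuousOn (dirDeriv L T φ v) (Icc 0 L ×ˢ Icc 0 T) :=
  (contDiffOn_dirDeriv hL hT h.contDiffOn v).continuousOn

theorem continuousOn_charM : ContinuousOn (charM L T φ) (Icc 0 L ×ˢ Icc 0 T) :=
  (h.continuousOn_dirDeriv hL hT _).sub (h.continuousOn_dirDeriv hL hT _)

theorem continuousOn_charP : ContinuousOn (charP L T φ) (Icc 0 L ×ˢ Icc 0 T) :=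
  (h.continuousOn_dirDeriv hL hT _).add (h.continuousOn_dirDeriv hL hT _)

theorem dirDeriv_final {x : ℝ} (hx : x ∈ Icc 0 L) :
    dirDeriv L T φ (0, 1) (x, T) = 0 ∧ dirDeriv L T φ (1, 0) (x, T) = 0 := by
  have hTT : T ∈ Icc 0 T := ⟨hT.le, le_rfl⟩
  rw [← dt_eq_dirDeriv hT h.contDiffOn hx hTT, ← dx_eq_dirDeriv hL h.contDiffOn hx hTT]
  refine ⟨h.final_dt x hx, ?_⟩
  rw [dx, derivWithin_congr (fun y hy => h.final y hy) (h.final x hx)]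
  simp

theorem dirDeriv_boundary {t : ℝ} (ht : t ∈ Icc 0 T) : dirDeriv L T φ (0, 1) (L, t) = 0 := by
  have hLL : L ∈ Icc 0 L := ⟨hL.le, le_rfl⟩
  rw [← dt_eq_dirDeriv hT h.contDiffOn hLL ht, dt,
    derivWithin_congr (fun y hy => h.boundary y hy) (h.boundary t ht)]
  simp

theorem charM_boundary {t : ℝ} (ht : t ∈ Icc 0 T) : charM L T φ (L, t) = -dx L φ L t := by
  rw [charM, h.dirDeriv_boundary hL hT ht,
    dx_eq_dirDeriv hL h.contDiffOn (right_mem_Icc.2 hL.le) ht, zero_sub]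

theorem charP_boundary {t : ℝ} (ht : t ∈ Icc 0 T) : charP L T φ (L, t) = dx L φ L t := by
  rw [charP, h.dirDeriv_boundary hL hT ht,
    dx_eq_dirDeriv hL h.contDiffOn (right_mem_Icc.2 hL.le) ht, zero_add]

/-- Stated on a subinterval because it is used twice: on the whole edge for outgoing waves, and to
the right of a source point for the light cone. -/
theorem integral_right_wave {x₀ x₁ : ℝ} (h0 : 0 ≤ x₀) (h01 : x₀ ≤ x₁) (h1 : x₁ ≤ L) {a : ℝ → ℝ}
    (ha : IntegrableOn a (Ioo 0 T)) :
    ∫ p, ext T a (p.2 - p.1) * box L T φ (x₀ + p.1, p.2) ∂(mQ (x₁ - x₀) T)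
      = (∫ t in Ioo 0 T, ext T a (t - (x₁ - x₀)) * charM L T φ (x₁, t))
        - ∫ t in Ioo 0 T, a t * charM L T φ (x₀, t) := by
  obtain ⟨K, hK⟩ := exists_bound_rect (continuousOn_box hL hT h.contDiffOn)
  have hm : ∀ p ∈ Icc 0 (x₁ - x₀) ×ˢ Icc 0 T, ((x₀ + p.1, p.2) : ℝ × ℝ) ∈ Icc 0 L ×ˢ Icc 0 T :=
    fun p hp => ⟨⟨by linarith [hp.1.1], by linarith [hp.1.2]⟩, hp.2⟩
  have hs : (Ioo 0 (x₁ - x₀) ×ˢ Ioo 0 T : Set (ℝ × ℝ)) ⊆ Icc 0 (x₁ - x₀) ×ˢ Icc 0 T :=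
    prod_mono Ioo_subset_Icc_self Ioo_subset_Icc_self
  have := integral_wave_mul (K := K) (sub_nonneg.2 h01) ha
    (G := fun p => box L T φ (x₀ + p.1, p.2)) (ψ := fun p => charM L T φ (x₀ + p.1, p.2))
    (((continuousOn_box hL hT h.contDiffOn).comp (by fun_prop) hm).mono hs)
    (fun p hp => hK _ (hm p (hs hp)))
    ((h.continuousOn_charM hL hT).comp (by fun_prop) hm)
    (fun x hx => by
      have := h.dirDeriv_final hL hT (x := x₀ + x) ⟨by linarith [hx.1], by linarith [hx.2]⟩
      simp only [charM, this.1, this.2, sub_zero])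
    (fun x hx t ht => by
      have := (hasDerivAt_dirDeriv_char hL hT h.contDiffOn (x := x₀ + x)
        ⟨by linarith [hx.1], by linarith [hx.2]⟩ ht).1
      simpa only [charM, add_assoc] using this)
  simpa using this

theorem integral_left_wave {y : ℝ} (h0 : 0 ≤ y) (h1 : y ≤ L) {a : ℝ → ℝ}
    (ha : IntegrableOn a (Ioo 0 T)) :
    ∫ p, ext T a (p.2 - p.1) * box L T φ (y - p.1, p.2) ∂(mQ y T)
      = (∫ t in Ioo 0 T, ext T a (t - y) * charP L T φ (0, t))
        - ∫ t in Ioo 0 T, a t * charP L T φ (y, t) := by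
  obtain ⟨K, hK⟩ := exists_bound_rect (continuousOn_box hL hT h.contDiffOn)
  have hm : ∀ p ∈ Icc 0 y ×ˢ Icc 0 T, ((y - p.1, p.2) : ℝ × ℝ) ∈ Icc 0 L ×ˢ Icc 0 T :=
    fun p hp => ⟨⟨by linarith [hp.1.2], by linarith [hp.1.1]⟩, hp.2⟩
  have hs : (Ioo 0 y ×ˢ Ioo 0 T : Set (ℝ × ℝ)) ⊆ Icc 0 y ×ˢ Icc 0 T :=
    prod_mono Ioo_subset_Icc_self Ioo_subset_Icc_self
  have := integral_wave_mul (K := K) h0 ha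
    (G := fun p => box L T φ (y - p.1, p.2)) (ψ := fun p => charP L T φ (y - p.1, p.2))
    (((continuousOn_box hL hT h.contDiffOn).comp (by fun_prop) hm).mono hs)
    (fun p hp => hK _ (hm p (hs hp)))
    ((h.continuousOn_charP hL hT).comp (by fun_prop) hm)
    (fun x hx => by
      have := h.dirDeriv_final hL hT (x := y - x) ⟨by linarith [hx.2], by linarith [hx.1]⟩
      simp only [charP, this.1, this.2, add_zero])
    (fun x hx t ht => by
      have := (hasDerivAt_dirDeriv_char hL hT h.contDiffOn (x := y - x)
        ⟨by linarith [hx.2], by linarith [hx.1]⟩ ht).2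
      simpa only [charP, sub_sub] using this)
  simpa using this

theorem integral_outgoing_mul_box {a : ℝ → ℝ} (ha : IntegrableOn a (Ioo 0 T)) :
    ∫ p, waveOp T (fun x => x) a p * box L T φ p ∂(mQ L T)
      = -(∫ t in Ioo 0 T, shiftOp T L a t * dx L φ L t)
        - ∫ t in Ioo 0 T, a t * charM L T φ (0, t) := by
  have := h.integral_right_wave hL hT le_rfl hL.le le_rfl ha
  simp only [zero_add, sub_zero] at this
  rw [← integral_neg]
  refine this.trans (congrArg₂ _ (setIntegral_congr_fun measurableSet_Ioo fun t ht => ?_) rfl)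
  simp only [h.charM_boundary hL hT (Ioo_subset_Icc_self ht), shiftOp, mul_neg]

theorem integral_incoming_mul_box {b : ℝ → ℝ} (hb : IntegrableOn b (Ioo 0 T)) :
    ∫ p, waveOp T (fun x => L - x) b p * box L T φ p ∂(mQ L T)
      = (∫ t in Ioo 0 T, shiftOp T L b t * charP L T φ (0, t))
        - ∫ t in Ioo 0 T, b t * dx L φ L t := by
  have := h.integral_left_wave hL hT hL.le le_rfl hb
  have hmp : MeasurePreserving (fun x : ℝ => L - x) (mT L) (mT L) := by
    have h1 := (Measure.measurePreserving_sub_left (volume : Measure ℝ) L).restrict_preimage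
      (s := Ioo 0 L) measurableSet_Ioo
    simpa using h1
  have hmp2 : MeasurePreserving (Prod.map (fun x : ℝ => L - x) (id : ℝ → ℝ)) (mQ L T) (mQ L T) :=
    hmp.prod (MeasurePreserving.id _)
  have hemb : MeasurableEmbedding (Prod.map (fun x : ℝ => L - x) (id : ℝ → ℝ)) :=
    ((MeasurableEquiv.subLeft L).prodCongr (MeasurableEquiv.refl ℝ)).measurableEmbedding
  rw [← hmp2.integral_comp hemb]
  simp only [waveOp, Prod.map, id, sub_sub_cancel]
  refine this.trans (congrArg₂ _ rfl (setIntegral_congr_fun measurableSet_Ioo fun t ht => ?_))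
  simp only [h.charP_boundary hL hT (Ioo_subset_Icc_self ht)]

end IsEdgeTest

/-! ### Duality for the d'Alembert operator -/

/-- Fubini's theorem for the kernel of the d'Alembert operator. -/
theorem integral_dAlembert_mul {Y : Type*} [MeasurableSpace Y] {ν : Measure Y} [IsFiniteMeasure ν]
    {γ : Y → ℝ × ℝ} (hγ : Measurable γ) {f : ℝ × ℝ → ℝ} (hf : Integrable f (mQ L T)) {c : Y → ℝ}
    (hc : AEStronglyMeasurable c ν) (hcb : ∃ K, ∀ᵐ y ∂ν, ‖c y‖ ≤ K) :
    ∫ y, dAlembert L T f (γ y) * c y ∂ν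
      = ∫ z, f z * ((1 / 2) * ∫ y, {y | |(γ y).1 - z.1| < (γ y).2 - z.2}.indicator c y ∂ν) ∂(mQ L T) ∧
    Integrable (fun z => f z *
      ((1 / 2) * ∫ y, {y | |(γ y).1 - z.1| < (γ y).2 - z.2}.indicator c y ∂ν)) (mQ L T) := by
  have hS : MeasurableSet {w : Y × (ℝ × ℝ) | |(γ w.1).1 - w.2.1| < (γ w.1).2 - w.2.2} :=
    measurableSet_lt (by fun_prop) (by fun_prop)
  have hci : Integrable c ν := by
    obtain ⟨K, hK⟩ := hcb
    exact Integrable.of_bound hc K hK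
  have hint : Integrable (fun w : Y × (ℝ × ℝ) =>
      {w : Y × (ℝ × ℝ) | |(γ w.1).1 - w.2.1| < (γ w.1).2 - w.2.2}.indicator
        (fun w => 1 / 2 * (c w.1 * f w.2)) w) (ν.prod (mQ L T)) :=
    ((hci.mul_prod hf).const_mul (1 / 2)).indicator hS
  have e1 : ∀ y, dAlembert L T f (γ y) * c y = ∫ z,
      {w : Y × (ℝ × ℝ) | |(γ w.1).1 - w.2.1| < (γ w.1).2 - w.2.2}.indicator
        (fun w => 1 / 2 * (c w.1 * f w.2)) (y, z) ∂(mQ L T) := fun y => by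
    rw [dAlembert, mul_right_comm, ← integral_const_mul]
    congr 1
    ext z
    by_cases hz : |(γ y).1 - z.1| < (γ y).2 - z.2 <;> simp [hz, mul_assoc]
  have e2 : ∀ z, f z * ((1 / 2) * ∫ y, {y | |(γ y).1 - z.1| < (γ y).2 - z.2}.indicator c y ∂ν)
      = ∫ y, {w : Y × (ℝ × ℝ) | |(γ w.1).1 - w.2.1| < (γ w.1).2 - w.2.2}.indicator
        (fun w => 1 / 2 * (c w.1 * f w.2)) (y, z) ∂ν := fun z => by
    rw [← mul_assoc, ← integral_const_mul]
    congr 1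
    ext y
    by_cases hz : |(γ y).1 - z.1| < (γ y).2 - z.2
    · simp [hz]; ring
    · simp [hz]
  simp only [e1, e2]
  exact ⟨integral_integral_swap hint, hint.integral_prod_right⟩

namespace IsEdgeTest

variable (h : IsEdgeTest L T φ) (hL : 0 < L) (hT : 0 < T)
include h hL hT

theorem integral_dt_eq {y s : ℝ} (hy : y ∈ Icc 0 L) (hs : s ∈ Ioo 0 T) :
    ∫ t in Ioo 0 T, (Ioi s).indicator (fun _ => (1 : ℝ)) t * dirDeriv L T φ (0, 1) (y, t)
      = -φ y s := by
  have hc : ContinuousOn (fun t => dirDeriv L T φ (0, 1) (y, t)) (Icc 0 T) :=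
    (h.continuousOn_dirDeriv hL hT _).comp (f := fun t => (y, t)) (by fun_prop)
      fun t ht => mk_mem_prod hy ht
  have hsub : Icc s T ⊆ Icc 0 T := Icc_subset_Icc_left hs.1.le
  have e1 : ∫ t in Ioo 0 T, (Ioi s).indicator (fun _ => (1 : ℝ)) t * dirDeriv L T φ (0, 1) (y, t)
      = ∫ t in s..T, dirDeriv L T φ (0, 1) (y, t) := by
    rw [intervalIntegral.integral_of_le hs.2.le, integral_Ioc_eq_integral_Ioo,
      ← integral_indicator measurableSet_Ioo, ← integral_indicator measurableSet_Ioo]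
    congr 1
    ext t
    by_cases h1 : s < t
    · have h2 : 0 < t := hs.1.trans h1
      by_cases h3 : t < T <;> simp [indicator, h1, h2, h3]
    · simp [indicator, h1]
  rw [e1, intervalIntegral.integral_eq_sub_of_hasDerivAt_of_le (f := fun t => φ y t) hs.2.le,
    h.final y hy, zero_sub]
  · exact (h.contDiffOn.continuousOn.comp (f := fun t => (y, t)) (by fun_prop)
      fun t ht => mk_mem_prod hy (hsub ht))
  · intro t ht
    have ht' : t ∈ Ioo 0 T := ⟨hs.1.trans ht.1, ht.2⟩
    have h1 : HasDerivWithinAt (fun s : ℝ => (y, s)) ((0, 1) : ℝ × ℝ) (Icc 0 T) t :=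
      (hasDerivWithinAt_const t _ y).prodMk (hasDerivWithinAt_id t _)
    have h2 := ((h.contDiffOn.differentiableOn (by norm_num)) (y, t)
      (mk_mem_prod hy (Ioo_subset_Icc_self ht'))).hasFDerivWithinAt.comp_hasDerivWithinAt t h1
      (fun s hs => mk_mem_prod hy hs)
    exact h2.hasDerivAt (Icc_mem_nhds ht'.1 ht'.2)
  · exact (hc.mono hsub).intervalIntegrable_of_Icc hs.2.le

/-- To the right of `y` the indicator of the forward cone is a right-going wave with a Heaviside
profile jumping at time `s`, to the left it is a left-going one. The travelling wave formulas apply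
to both halves; on the line `x = y` the two derivatives add up to `2 ∂_t φ`, whose integral from `s`
to `T` is `-2 φ(y, s)`. -/
theorem integral_cone_box {y s : ℝ} (hy : y ∈ Ioo 0 L) (hs : s ∈ Ioo 0 T) :
    ∫ p, {p : ℝ × ℝ | |p.1 - y| < p.2 - s}.indicator (box L T φ) p ∂(mQ L T)
      = 2 * φ y s
        - (∫ t, {t : ℝ | |L - y| < t - s}.indicator (fun t => dx L φ L t) t ∂(mT T))
        + ∫ t, {t : ℝ | |0 - y| < t - s}.indicator (fun t => charP L T φ (0, t)) t ∂(mT T) := by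
  set a : ℝ → ℝ := (Ioi s).indicator fun _ => (1 : ℝ) with ha
  have hai : IntegrableOn a (Ioo 0 T) :=
    (integrable_const (1 : ℝ)).indicator measurableSet_Ioi
  have hbox := continuousOn_box hL hT h.contDiffOn
  have hext : ∀ t r, t ∈ Ioo 0 T → 0 ≤ r → ext T a (t - r) = {t | r < t - s}.indicator 1 t := by
    intro t r ht hr
    by_cases h1 : r < t - s
    · have h2 : t - r ∈ Ioo 0 T := ⟨by linarith [hs.1], by linarith [ht.2]⟩
      have h3 : t - r ∈ Ioi s := by simp only [mem_Ioi]; linarith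
      rw [ext, indicator_of_mem h2, ha, indicator_of_mem h3,
        indicator_of_mem (show t ∈ {t | r < t - s} from h1), Pi.one_apply]
    · have h3 : t - r ∉ Ioi s := by simp only [mem_Ioi]; linarith
      rw [indicator_of_notMem (show t ∉ {t | r < t - s} from h1), ext, ha]
      by_cases h2 : t - r ∈ Ioo 0 T
      · rw [indicator_of_mem h2, indicator_of_notMem h3]
      · rw [indicator_of_notMem h2]
  have hmeas : ∀ p : ℝ × ℝ, MeasurableSet {p : ℝ × ℝ | |p.1 - y| < p.2 - s} := fun p =>
    measurableSet_lt (by fun_prop) (by fun_prop)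
  have hint : Integrable ({p : ℝ × ℝ | |p.1 - y| < p.2 - s}.indicator (box L T φ)) (mQ L T) := by
    obtain ⟨K, hK⟩ := ae_bound_mQ hbox
    exact (Integrable.of_bound (aestronglyMeasurable_mQ hbox) K hK).indicator (hmeas 0)
  set J : ℝ → ℝ := fun x => ∫ t in Ioo 0 T,
    {p : ℝ × ℝ | |p.1 - y| < p.2 - s}.indicator (box L T φ) (x, t) with hJ
  have hJi : IntegrableOn J (Ioo 0 L) := hint.integral_prod_left
  have hJL : IntervalIntegrable J volume 0 L :=
    (intervalIntegrable_iff_integrableOn_Ioo_of_le hL.le).2 hJi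
  have e0 : ∫ p, {p : ℝ × ℝ | |p.1 - y| < p.2 - s}.indicator (box L T φ) p ∂(mQ L T)
      = (∫ x in (0 : ℝ)..y, J x) + ∫ x in y..L, J x := by
    rw [integral_prod _ hint, intervalIntegral.integral_add_adjacent_intervals,
      intervalIntegral.integral_of_le hL.le, integral_Ioc_eq_integral_Ioo]
    · exact hJL.mono_set (by
        rw [uIcc_of_le hy.1.le, uIcc_of_le hL.le]; exact Icc_subset_Icc_right hy.2.le)
    · exact hJL.mono_set (by
        rw [uIcc_of_le hy.2.le, uIcc_of_le hL.le]; exact Icc_subset_Icc_left hy.1.le)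
  have eext : ∀ L' : ℝ, ∀ G : ℝ × ℝ → ℝ, ContinuousOn G (Icc 0 L' ×ˢ Icc 0 T) →
      ∫ p, ext T a (p.2 - p.1) * G p ∂(mQ L' T)
        = ∫ x in Ioo 0 L', ∫ t in Ioo 0 T, ext T a (t - x) * G (x, t) := fun L' G hG => by
    refine integral_prod _ ?_
    obtain ⟨K, hK⟩ := ae_bound_mQ hG
    refine (Integrable.of_bound (aestronglyMeasurable_mQ hG) K hK).bdd_mul (c := 1) ?_
      (Eventually.of_forall fun p => ?_)
    · exact ((stronglyMeasurable_ext ((stronglyMeasurable_const).indicator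
        measurableSet_Ioi)).comp_measurable (by fun_prop)).aestronglyMeasurable
    · rw [ext]
      refine (norm_indicator_le_norm_self _ _).trans ((norm_indicator_le_norm_self _ _).trans ?_)
      simp
  have er : ∫ x in y..L, J x
      = ∫ p, ext T a (p.2 - p.1) * box L T φ (y + p.1, p.2) ∂(mQ (L - y) T) := by
    rw [eext _ (fun p => box L T φ (y + p.1, p.2)) (hbox.comp (by fun_prop) fun p hp =>
      mk_mem_prod (by constructor <;> linarith [hp.1.1, hp.1.2, hy.1]) hp.2)]
    have := intervalIntegral.integral_comp_add_left (a := 0) (b := L - y) J y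
    rw [add_zero, add_sub_cancel] at this
    rw [← this, intervalIntegral.integral_of_le (by linarith [hy.2]), integral_Ioc_eq_integral_Ioo]
    refine setIntegral_congr_fun measurableSet_Ioo fun x hx => ?_
    refine setIntegral_congr_fun measurableSet_Ioo fun t ht => ?_
    have h1 : |y + x - y| = x := by rw [add_sub_cancel_left, abs_of_pos hx.1]
    simp only [hext t x ht hx.1.le, indicator, mem_ofPred_eq, h1]
    split_ifs <;> simp
  have el : ∫ x in (0 : ℝ)..y, J x
      = ∫ p, ext T a (p.2 - p.1) * box L T φ (y - p.1, p.2) ∂(mQ y T) := by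
    rw [eext _ (fun p => box L T φ (y - p.1, p.2)) (hbox.comp (by fun_prop) fun p hp =>
      mk_mem_prod (by constructor <;> linarith [hp.1.1, hp.1.2, hy.2]) hp.2)]
    have := intervalIntegral.integral_comp_sub_left (a := 0) (b := y) J y
    rw [sub_zero, sub_self] at this
    rw [← this, intervalIntegral.integral_of_le hy.1.le, integral_Ioc_eq_integral_Ioo]
    refine setIntegral_congr_fun measurableSet_Ioo fun x hx => ?_
    refine setIntegral_congr_fun measurableSet_Ioo fun t ht => ?_
    have h1 : |y - x - y| = x := by rw [sub_sub_cancel_left, abs_neg, abs_of_pos hx.1]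
    simp only [hext t x ht hx.1.le, indicator, mem_ofPred_eq, h1]
    split_ifs <;> simp
  rw [e0, er, el, h.integral_right_wave hL hT hy.1.le hy.2.le le_rfl hai,
    h.integral_left_wave hL hT hy.1.le hy.2.le hai]
  have hcy : ∀ v, ContinuousOn (fun t => dirDeriv L T φ v (y, t)) (Icc 0 T) := fun v =>
    (h.continuousOn_dirDeriv hL hT _).comp (f := fun t => (y, t)) (by fun_prop)
      fun t ht => mk_mem_prod (Ioo_subset_Icc_self hy) ht
  have hiy : ∀ v, Integrable (fun t => a t * dirDeriv L T φ v (y, t)) (mT T) := fun v =>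
    (IntegrableOn.mul_continuousOn (K := Icc 0 T)
      ((integrable_const (1 : ℝ)).indicator measurableSet_Ioi) (hcy v) isCompact_Icc).mono_set
      Ioo_subset_Icc_self
  have f1 : (∫ t in Ioo 0 T, a t * charM L T φ (y, t)) + ∫ t in Ioo 0 T, a t * charP L T φ (y, t)
      = -(2 * φ y s) := by
    have := h.integral_dt_eq hL hT (Ioo_subset_Icc_self hy) hs
    simp only [charM, charP, mul_sub, mul_add]
    rw [integral_sub (hiy _) (hiy _), integral_add (hiy _) (hiy _), ha, this]
    ring
  have f2 : ∫ t in Ioo 0 T, ext T a (t - (L - y)) * charM L T φ (L, t)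
      = -∫ t, {t : ℝ | |L - y| < t - s}.indicator (fun t => dx L φ L t) t ∂(mT T) := by
    rw [← integral_neg]
    refine setIntegral_congr_fun measurableSet_Ioo fun t ht => ?_
    have h0 : 0 ≤ L - y := by linarith [hy.2]
    simp only [hext t _ ht h0, h.charM_boundary hL hT (Ioo_subset_Icc_self ht), abs_of_nonneg h0,
      indicator, mem_ofPred_eq]
    split_ifs <;> simp
  have f3 : ∫ t in Ioo 0 T, ext T a (t - y) * charP L T φ (0, t)
      = ∫ t, {t : ℝ | |0 - y| < t - s}.indicator (fun t => charP L T φ (0, t)) t ∂(mT T) := by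
    refine setIntegral_congr_fun measurableSet_Ioo fun t ht => ?_
    have h0 : |0 - y| = y := by rw [zero_sub, abs_neg, abs_of_pos hy.1]
    simp only [hext t _ ht hy.1.le, h0, indicator, mem_ofPred_eq]
    split_ifs <;> simp
  rw [f2, f3]
  linear_combination -f1

/-- All three integrals containing `D f` are rewritten by Fubini as integrals of `f` against a cone
integral. The identity then reduces to `integral_cone_box` at each source point. -/
theorem integral_dAlembert_mul_box {f : ℝ × ℝ → ℝ} (hf : Integrable f (mQ L T)) :
    ∫ p, dAlembert L T f p * box L T φ p ∂(mQ L T)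
      = (∫ p, f p * φ p.1 p.2 ∂(mQ L T))
        - (∫ t in Ioo 0 T, dAlembert L T f (L, t) * dx L φ L t)
        + ∫ t in Ioo 0 T, dAlembert L T f (0, t) * charP L T φ (0, t) := by
  have hbox := continuousOn_box hL hT h.contDiffOn
  have hdx : ContinuousOn (fun t => dx L φ L t) (Icc 0 T) := by
    have : ContinuousOn (fun t => charP L T φ (L, t)) (Icc 0 T) :=
      (h.continuousOn_charP hL hT).comp (f := fun t => (L, t)) (by fun_prop)
        fun t ht => mk_mem_prod (right_mem_Icc.2 hL.le) ht
    exact this.congr fun t ht => (h.charP_boundary hL hT ht).symm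
  have hcP : ContinuousOn (fun t => charP L T φ (0, t)) (Icc 0 T) :=
    (h.continuousOn_charP hL hT).comp (f := fun t => (0, t)) (by fun_prop)
      fun t ht => mk_mem_prod (left_mem_Icc.2 hL.le) ht
  have A := integral_dAlembert_mul (γ := id) measurable_id hf (aestronglyMeasurable_mQ hbox)
    (ae_bound_mQ hbox)
  have B := integral_dAlembert_mul (γ := fun t => (L, t)) (ν := mT T) (by fun_prop) hf
    (aestronglyMeasurable_mT hdx) (ae_bound_mT hdx)
  have C := integral_dAlembert_mul (γ := fun t => (0, t)) (ν := mT T) (by fun_prop) hf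
    (aestronglyMeasurable_mT hcP) (ae_bound_mT hcP)
  have hfφ : Integrable (fun p => f p * φ p.1 p.2) (mQ L T) := by
    obtain ⟨K, hK⟩ := ae_bound_mQ h.contDiffOn.continuousOn
    exact hf.mul_bdd (c := K) (aestronglyMeasurable_mQ h.contDiffOn.continuousOn) hK
  rw [show (∫ p, dAlembert L T f p * box L T φ p ∂(mQ L T)) = _ from A.1, B.1, C.1,
    ← integral_sub hfφ B.2]
  refine Eq.trans (integral_congr_ae ?_) (integral_add (hfφ.sub B.2) C.2)
  refine ((ae_mQ L T).mono fun z hz => ?_)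
  have := h.integral_cone_box hL hT hz.1 hz.2
  simp only [id]
  rw [this]
  ring

end IsEdgeTest

end Edge

end

section

/-! ### The weak form on the star -/

/-- The functional `a ↦ ∫ a c` on `L²(0,T)`. -/
def pairing {T : ℝ} {c : ℝ → ℝ} (hc : ContinuousOn c (Icc 0 T)) : L2 T →ₗ[ℝ] ℝ where
  toFun a := ∫ t in Ioo 0 T, a t * c t
  map_add' a b := by
    have hi : ∀ a : L2 T, Integrable (fun t => a t * c t) (mT T) := fun a => by
      obtain ⟨K, hK⟩ := ae_bound_mT hc
      exact ((Lp.memLp a).integrable (by norm_num)).mul_bdd (c := K) (aestronglyMeasurable_mT hc) hK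
    rw [← integral_add (hi a) (hi b)]
    refine integral_congr_ae ?_
    filter_upwards [Lp.coeFn_add a b] with t ht
    rw [ht, Pi.add_apply, add_mul]
  map_smul' r a := by
    rw [RingHom.id_apply, smul_eq_mul, ← integral_const_mul]
    refine integral_congr_ae ?_
    filter_upwards [Lp.coeFn_smul r a] with t ht
    rw [ht, Pi.smul_apply, smul_eq_mul, mul_assoc]

theorem pairing_apply {T : ℝ} {c : ℝ → ℝ} (hc : ContinuousOn c (Icc 0 T)) (a : L2 T) :
    pairing hc a = ∫ t in Ioo 0 T, a t * c t := rfl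

theorem pairing_congr {T : ℝ} {c : ℝ → ℝ} (hc : ContinuousOn c (Icc 0 T)) (a : L2 T)
    {a' : ℝ → ℝ} (ha : a =ᵐ[mT T] a') :
    pairing hc a = ∫ t in Ioo 0 T, a' t * c t := by
  rw [pairing_apply]
  refine integral_congr_ae ?_
  filter_upwards [ha] with t h1
  rw [h1]

theorem integrable_L2Q_mul {L T : ℝ} (f : L2Q L T) {G : ℝ × ℝ → ℝ}
    (hG : ContinuousOn G (Icc 0 L ×ˢ Icc 0 T)) : Integrable (fun p => f p * G p) (mQ L T) := by
  obtain ⟨K, hK⟩ := ae_bound_mQ hG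
  exact ((Lp.memLp f).integrable (by norm_num)).mul_bdd (c := K) (aestronglyMeasurable_mQ hG) hK

theorem integrableOn_L2 {T : ℝ} (a : L2 T) : IntegrableOn a (Ioo 0 T) :=
  (Lp.memLp a).integrable (by norm_num)

variable {l : Fin 3 → ℝ} (hl : ∀ j, 0 < l j) {T : ℝ} (hT : 0 < T)

theorem coeFn_tau (j : Fin 3) (a : L2 T) : tau hl T j a =ᵐ[mT T] shiftOp T (l j) a :=
  (isL2Op_shiftOp T (hl j)).coeFn_toCLM a

theorem coeFn_traceD (L x : ℝ) (f : L2Q L T) :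
    traceD T L x f =ᵐ[mT T] fun t => dAlembert L T f (x, t) :=
  (isL2Op_traceD T L x).coeFn_toCLM f

/-- The formula for the solution on one edge, as a function of `x` and `t`. -/
def edgeFun (L T : ℝ) (a b : ℝ → ℝ) (f : ℝ × ℝ → ℝ) (p : ℝ × ℝ) : ℝ :=
  waveOp T (fun x => x) a p + waveOp T (fun x => L - x) b p + dAlembert L T f p

theorem coeFn_edgeSol (L : ℝ) (a b : L2 T) (f : L2Q L T) :
    edgeSol T L a b f =ᵐ[mQ L T] edgeFun L T a b f := by
  filter_upwards [(isL2Op_outgoing T L).coeFn_toCLM a, (isL2Op_incoming T L).coeFn_toCLM b,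
    (isL2Op_dAlembert T L).coeFn_toCLM f,
    Lp.coeFn_add ((isL2Op_outgoing T L).toCLM a) ((isL2Op_incoming T L).toCLM b),
    Lp.coeFn_add ((isL2Op_outgoing T L).toCLM a + (isL2Op_incoming T L).toCLM b)
      ((isL2Op_dAlembert T L).toCLM f)] with p h1 h2 h3 h4 h5
  rw [edgeSol, h5, Pi.add_apply, h4, Pi.add_apply, h1, h2, h3, edgeFun]

include hT in
theorem integral_edgeSol_mul_box {j : Fin 3} {φ : ℝ → ℝ → ℝ} (h : IsEdgeTest (l j) T φ)
    (a b : L2 T) (f : L2Q (l j) T)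
    (hdx : ContinuousOn (fun t => dx (l j) φ (l j) t) (Icc 0 T))
    (hM : ContinuousOn (fun t => charM (l j) T φ (0, t)) (Icc 0 T))
    (hP : ContinuousOn (fun t => charP (l j) T φ (0, t)) (Icc 0 T)) :
    ∫ p, edgeSol T (l j) a b f p * box (l j) T φ p ∂(mQ (l j) T)
      = (∫ p, f p * φ p.1 p.2 ∂(mQ (l j) T))
        - pairing hdx (tau hl T j a + b + traceD T (l j) (l j) f)
        + pairing hP (tau hl T j b + traceD T (l j) 0 f) - pairing hM a := by
  have hbox := continuousOn_box (hl j) hT h.contDiffOn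
  have i1 := integrable_L2Q_mul ((isL2Op_outgoing T (l j)).toCLM a) hbox
  have i2 := integrable_L2Q_mul ((isL2Op_incoming T (l j)).toCLM b) hbox
  have i3 := integrable_L2Q_mul ((isL2Op_dAlembert T (l j)).toCLM f) hbox
  have e1 : ∫ p, edgeSol T (l j) a b f p * box (l j) T φ p ∂(mQ (l j) T)
      = (∫ p, (isL2Op_outgoing T (l j)).toCLM a p * box (l j) T φ p ∂(mQ (l j) T))
        + (∫ p, (isL2Op_incoming T (l j)).toCLM b p * box (l j) T φ p ∂(mQ (l j) T))
        + ∫ p, (isL2Op_dAlembert T (l j)).toCLM f p * box (l j) T φ p ∂(mQ (l j) T) := by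
    rw [← integral_add i1 i2]
    refine Eq.trans (integral_congr_ae ?_) (integral_add (i1.add i2) i3)
    filter_upwards [Lp.coeFn_add ((isL2Op_outgoing T (l j)).toCLM a)
        ((isL2Op_incoming T (l j)).toCLM b),
      Lp.coeFn_add ((isL2Op_outgoing T (l j)).toCLM a + (isL2Op_incoming T (l j)).toCLM b)
        ((isL2Op_dAlembert T (l j)).toCLM f)] with p h4 h5
    rw [edgeSol, h5, Pi.add_apply, h4, Pi.add_apply, add_mul, add_mul]
  have c1 : ∫ p, (isL2Op_outgoing T (l j)).toCLM a p * box (l j) T φ p ∂(mQ (l j) T)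
      = -pairing hdx (tau hl T j a) - pairing hM a := by
    rw [pairing_congr hdx _ (coeFn_tau hl j a), pairing_apply,
      ← h.integral_outgoing_mul_box (hl j) hT (integrableOn_L2 a)]
    refine integral_congr_ae ?_
    filter_upwards [(isL2Op_outgoing T (l j)).coeFn_toCLM a] with p hp
    rw [hp]
  have c2 : ∫ p, (isL2Op_incoming T (l j)).toCLM b p * box (l j) T φ p ∂(mQ (l j) T)
      = pairing hP (tau hl T j b) - pairing hdx b := by
    rw [pairing_congr hP _ (coeFn_tau hl j b), pairing_apply,
      ← h.integral_incoming_mul_box (hl j) hT (integrableOn_L2 b)]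
    refine integral_congr_ae ?_
    filter_upwards [(isL2Op_incoming T (l j)).coeFn_toCLM b] with p hp
    rw [hp]
  have c3 : ∫ p, (isL2Op_dAlembert T (l j)).toCLM f p * box (l j) T φ p ∂(mQ (l j) T)
      = (∫ p, f p * φ p.1 p.2 ∂(mQ (l j) T)) - pairing hdx (traceD T (l j) (l j) f)
        + pairing hP (traceD T (l j) 0 f) := by
    rw [pairing_congr hP _ (coeFn_traceD _ _ f),
      pairing_congr hdx _ (coeFn_traceD _ _ f),
      ← h.integral_dAlembert_mul_box (hl j) hT ((Lp.memLp f).integrable (by norm_num))]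
    refine integral_congr_ae ?_
    filter_upwards [(isL2Op_dAlembert T (l j)).coeFn_toCLM f] with p hp
    rw [hp]
  rw [e1, c1, c2, c3]
  simp only [map_add]
  ring

/-- The scattering matrix at the centre. -/
def scattering (i j : Fin 3) : ℝ := 2 / 3 - if i = j then 1 else 0

/-- The amplitudes of the waves which the control sends into the edges. -/
def emission (j : Fin 3) : ℝ := (if j = 2 then 1 else 0) - 1 / 3

-- After the edge formulas only pairings at the centre remain: `B_j - a_j` against the common time
-- derivative of the test function, and `B_j + a_j` against `∂_x φ_j`. The first sum vanishes
-- because the columns of `scattering` add to 1 and `emission` adds to 0. In the second, everything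
-- independent of `j` is killed by the Kirchhoff condition on `φ`, leaving `g` paired with `∂_x
-- φ_2`.
include hT in
theorem sum_integral_edgeSol_mul_box {a b h : Fin 3 → L2 T} {f : ∀ j, L2Q (l j) T} {g : L2 T}
    (ha : ∀ j, a j = ∑ i, scattering j i • (tau hl T i (b i) + traceD T (l i) 0 (f i))
      + emission j • g)
    (hb : ∀ j, b j = h j - tau hl T j (a j) - traceD T (l j) (l j) (f j))
    {φ : Fin 3 → ℝ → ℝ → ℝ} (hφ : IsTest l T φ) :
    ∑ j, ∫ p, edgeSol T (l j) (a j) (b j) (f j) p * box (l j) T (φ j) p ∂(mQ (l j) T)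
      = ∑ j, (∫ p, f j p * φ j p.1 p.2 ∂(mQ (l j) T))
        + (∫ t in Ioo 0 T, g t * dx (l 2) (φ 2) 0 t)
        - ∑ j, ∫ t in Ioo 0 T, h j t * dx (l j) (φ j) (l j) t := by
  have hcv : ∀ j v x, x ∈ Icc 0 (l j) →
      ContinuousOn (fun t => dirDeriv (l j) T (φ j) v (x, t)) (Icc 0 T) := fun j v x hx =>
    ((hφ.edge j).continuousOn_dirDeriv (hl j) hT v).comp (f := fun t => (x, t)) (by fun_prop)
      fun t ht => mk_mem_prod hx ht
  have h0 : ∀ j, (0 : ℝ) ∈ Icc 0 (l j) := fun j => left_mem_Icc.2 (hl j).le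
  have hdx : ∀ j, ∀ x ∈ Icc 0 (l j), ContinuousOn (fun t => dx (l j) (φ j) x t) (Icc 0 T) :=
    fun j x hx => (hcv j (1, 0) x hx).congr fun t ht =>
      dx_eq_dirDeriv (hl j) (hφ.contDiffOn j) hx ht
  have hdt : ∀ j, ContinuousOn (fun t => dt T (φ j) 0 t) (Icc 0 T) :=
    fun j => (hcv j (0, 1) 0 (h0 j)).congr fun t ht => dt_eq_dirDeriv hT (hφ.contDiffOn j) (h0 j) ht
  have hM : ∀ j, ContinuousOn (fun t => charM (l j) T (φ j) (0, t)) (Icc 0 T) := fun j =>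
    (hcv j (0, 1) 0 (h0 j)).sub (hcv j (1, 0) 0 (h0 j))
  have hP : ∀ j, ContinuousOn (fun t => charP (l j) T (φ j) (0, t)) (Icc 0 T) := fun j =>
    (hcv j (0, 1) 0 (h0 j)).add (hcv j (1, 0) 0 (h0 j))
  -- Continuity of the test function at the centre makes its time derivative there independent of
  -- the edge.
  have hdt0 : ∀ j, ∀ t ∈ Icc 0 T, dt T (φ j) 0 t = dt T (φ 0) 0 t := fun j t ht =>
    derivWithin_congr (fun s hs => hφ.continuous_centre j 0 s hs) (hφ.continuous_centre j 0 t ht)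
  have hint : ∀ (x : L2 T) {c : ℝ → ℝ}, ContinuousOn c (Icc 0 T) →
      Integrable (fun t => x t * c t) (mT T) := fun x c hc => by
    obtain ⟨K, hK⟩ := ae_bound_mT hc
    exact ((Lp.memLp x).integrable (by norm_num)).mul_bdd (c := K) (aestronglyMeasurable_mT hc) hK
  have hPv : ∀ j (x : L2 T), pairing (hP j) x
      = pairing (hdt 0) x + pairing (hdx j 0 (h0 j)) x := fun j x => by
    simp only [pairing_apply]
    rw [← integral_add (hint x (hdt 0)) (hint x (hdx j 0 (h0 j)))]
    refine setIntegral_congr_fun measurableSet_Ioo fun t ht => ?_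
    have ht' := Ioo_subset_Icc_self ht
    simp only [charP]
    rw [← dt_eq_dirDeriv hT (hφ.contDiffOn j) (h0 j) ht',
      ← dx_eq_dirDeriv (hl j) (hφ.contDiffOn j) (h0 j) ht', hdt0 j t ht', mul_add]
  have hMv : ∀ j (x : L2 T), pairing (hM j) x
      = pairing (hdt 0) x - pairing (hdx j 0 (h0 j)) x := fun j x => by
    simp only [pairing_apply]
    rw [← integral_sub (hint x (hdt 0)) (hint x (hdx j 0 (h0 j)))]
    refine setIntegral_congr_fun measurableSet_Ioo fun t ht => ?_
    have ht' := Ioo_subset_Icc_self ht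
    simp only [charM]
    rw [← dt_eq_dirDeriv hT (hφ.contDiffOn j) (h0 j) ht',
      ← dx_eq_dirDeriv (hl j) (hφ.contDiffOn j) (h0 j) ht', hdt0 j t ht', mul_sub]
  have hK : ∀ x : L2 T, pairing (hdx 0 0 (h0 0)) x + pairing (hdx 1 0 (h0 1)) x
      + pairing (hdx 2 0 (h0 2)) x = 0 := fun x => by
    simp only [pairing_apply]
    rw [← integral_add (hint x (hdx 0 0 (h0 0))) (hint x (hdx 1 0 (h0 1)))]
    refine Eq.trans (Eq.symm (integral_add ((hint x (hdx 0 0 (h0 0))).add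
      (hint x (hdx 1 0 (h0 1)))) (hint x (hdx 2 0 (h0 2))))) ?_
    refine (setIntegral_congr_fun (g := fun _ => 0) measurableSet_Ioo fun t ht => ?_).trans
      (integral_zero _ _)
    have := hφ.kirchhoff t (Ioo_subset_Icc_self ht)
    rw [Fin.sum_univ_three] at this
    beta_reduce
    linear_combination (x t) * this
  have hbsum : ∀ j, tau hl T j (a j) + b j + traceD T (l j) (l j) (f j) = h j := fun j => by
    rw [hb j]
    abel
  have hr : ∀ j, l j ∈ Icc 0 (l j) := fun j => right_mem_Icc.2 (hl j).le
  set B : Fin 3 → L2 T := fun i => tau hl T i (b i) + traceD T (l i) 0 (f i) with hB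
  have key : ∀ j, ∫ p, edgeSol T (l j) (a j) (b j) (f j) p * box (l j) T (φ j) p ∂(mQ (l j) T)
      = (∫ p, f j p * φ j p.1 p.2 ∂(mQ (l j) T)) - pairing (hdx j (l j) (hr j)) (h j)
        + (pairing (hdt 0) (B j) + pairing (hdx j 0 (h0 j)) (B j)
        - (pairing (hdt 0) (a j) - pairing (hdx j 0 (h0 j)) (a j))) := fun j => by
    rw [integral_edgeSol_mul_box hl hT (hφ.edge j) _ _ _ (hdx j (l j) (hr j)) (hM j) (hP j),
      hbsum j, ← hPv, ← hMv]
    ring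
  have hg : ∫ t in Ioo 0 T, g t * dx (l 2) (φ 2) 0 t = pairing (hdx 2 0 (h0 2)) g := rfl
  have hh : ∀ j, ∫ t in Ioo 0 T, h j t * dx (l j) (φ j) (l j) t
      = pairing (hdx j (l j) (hr j)) (h j) := fun j => rfl
  rw [hg]
  simp only [key, hh]
  have ha0 := ha 0
  have ha1 := ha 1
  have ha2 := ha 2
  simp only [Fin.sum_univ_three] at ha0 ha1 ha2 ⊢
  change a 0 = scattering 0 0 • B 0 + scattering 0 1 • B 1 + scattering 0 2 • B 2 + _ at ha0
  change a 1 = scattering 1 0 • B 0 + scattering 1 1 • B 1 + scattering 1 2 • B 2 + _ at ha1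
  change a 2 = scattering 2 0 • B 0 + scattering 2 1 • B 1 + scattering 2 2 • B 2 + _ at ha2
  rw [ha0, ha1, ha2]
  simp only [map_add, map_smul, smul_eq_mul, scattering, emission, Fin.reduceEq, if_true, if_false, Fin.isValue]
  have k0 := hK (B 0)
  have k1 := hK (B 1)
  have k2 := hK (B 2)
  have kg := hK g
  linear_combination (2 / 3) * k0 + (2 / 3) * k1 + (2 / 3) * k2 - (1 / 3) * kg

/-! ### Continuity in time and traces -/

/-- Continuity of translations in `L²`, for general measure preserving families because the incoming
and outgoing waves are read both along horizontal and along vertical lines, which includes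
reflections. -/
theorem tendsto_eLpNorm_comp_sub {F : ℝ → ℝ} (hF : MemLp F 2 volume) {θ : ℝ → ℝ → ℝ}
    (hθ : Continuous (Function.uncurry θ)) (hmp : ∀ r, MeasurePreserving (θ r) volume volume)
    (r₀ : ℝ) : Tendsto (fun r => eLpNorm (fun x => F (θ r x) - F (θ r₀ x)) 2 volume)
      (𝓝 r₀) (𝓝 0) := by
  set c : C(ℝ, C(ℝ, ℝ)) := ContinuousMap.curry ⟨Function.uncurry θ, hθ⟩
  have h1 : Tendsto (fun r => c r) (𝓝 r₀) (𝓝 (c r₀)) := c.continuous.tendsto r₀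
  have h2 := Filter.Tendsto.compMeasurePreservingLp (μ := volume) (ν := volume) (p := 2)
    (tendsto_const_nhds (x := hF.toLp F)) h1 (fun r => hmp r) (hmp r₀) (by norm_num)
  rw [Lp.tendsto_Lp_iff_tendsto_eLpNorm'] at h2
  refine h2.congr fun r => eLpNorm_congr_ae ?_
  filter_upwards [Lp.coeFn_compMeasurePreserving (hF.toLp F) (hmp r),
    Lp.coeFn_compMeasurePreserving (hF.toLp F) (hmp r₀),
    (hmp r).quasiMeasurePreserving.ae_eq_comp hF.coeFn_toLp,
    (hmp r₀).quasiMeasurePreserving.ae_eq_comp hF.coeFn_toLp] with x e1 e2 e3 e4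
  simp only [Function.comp] at e1 e2 e3 e4
  rw [Pi.sub_apply]
  erw [e1, e2]
  rw [e3, e4]

theorem tendsto_eLpNorm_sub_of_continuous {F : ℝ → ℝ → ℝ} (hF : Continuous (Function.uncurry F))
    (L r₀ : ℝ) : Tendsto (fun r => eLpNorm (fun x => F r x - F r₀ x) 2 (mT L)) (𝓝 r₀) (𝓝 0) := by
  rw [ENNReal.tendsto_nhds_zero]
  intro ε hε
  have h1 : Tendsto (fun δ : ℝ => (mT L) univ ^ ((2 : ENNReal).toReal⁻¹) * ENNReal.ofReal δ)
      (𝓝[>] 0) (𝓝 0) := by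
    have := ENNReal.Tendsto.const_mul (a := (mT L) univ ^ ((2 : ENNReal).toReal⁻¹))
      (ENNReal.tendsto_ofReal (tendsto_id (α := ℝ) (x := 𝓝 0)))
      (Or.inr (ENNReal.rpow_ne_top_of_nonneg (by simp) (measure_ne_top _ _)))
    simp only [ENNReal.ofReal_zero, mul_zero] at this
    exact this.mono_left nhdsWithin_le_nhds
  obtain ⟨δ, hδ, hδ0⟩ := ((h1.eventually_le_const hε).and self_mem_nhdsWithin).exists
  obtain ⟨v, hv, hv'⟩ := IsCompact.mem_uniformity_of_prod (s := univ) (isCompact_Icc (a := 0) (b := L))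
    hF.continuousOn (mem_univ r₀) (Metric.dist_mem_uniformity hδ0)
  rw [nhdsWithin_univ] at hv
  filter_upwards [hv] with r hr
  refine le_trans (eLpNorm_le_of_ae_bound ?_) hδ
  filter_upwards [ae_mT L] with x hx
  have := hv' r hr x (Ioo_subset_Icc_self hx)
  simp only [mem_ofPred_eq, Real.dist_eq] at this
  exact this.le

/-- Dominated convergence: moving the apex changes the indicator of the cone, in the limit, only on
the cone's boundary, which meets every vertical line in at most one point and is therefore null. -/
theorem continuous_dAlembert (L T : ℝ) {f : ℝ × ℝ → ℝ} (hf : Integrable f (mQ L T)) :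
    Continuous (dAlembert L T f) := by
  refine continuous_const.mul (continuous_iff_continuousAt.2 fun p₀ => ?_)
  refine continuousAt_of_dominated (bound := fun z => ‖f z‖)
    (Eventually.of_forall fun p => hf.aestronglyMeasurable.indicator (measurableSet_cone p))
    (Eventually.of_forall fun p => Eventually.of_forall fun z => norm_indicator_le_norm_self _ _)
    hf.norm ?_
  have hnull : ∀ᵐ z ∂(mQ L T), |p₀.1 - z.1| ≠ p₀.2 - z.2 := by
    have hm : MeasurableSet {z : ℝ × ℝ | |p₀.1 - z.1| = p₀.2 - z.2} :=
      measurableSet_eq_fun (by fun_prop) (by fun_prop)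
    rw [ae_iff]
    simp only [ne_eq, not_not]
    rw [mQ, Measure.measure_prod_null hm]
    refine Eventually.of_forall fun x => ?_
    refine measure_mono_null (t := {p₀.2 - |p₀.1 - x|}) (fun s hs => ?_) (by simp)
    have : |p₀.1 - x| = p₀.2 - s := hs
    rw [mem_singleton_iff, this]
    ring
  filter_upwards [hnull] with z hz
  rcases lt_or_gt_of_ne hz with h | h
  · have : ∀ᶠ p : ℝ × ℝ in 𝓝 p₀, |p.1 - z.1| < p.2 - z.2 :=
      ((by fun_prop : Continuous fun p : ℝ × ℝ => |p.1 - z.1|).continuousAt).eventually_lt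
        (by fun_prop : Continuous fun p : ℝ × ℝ => p.2 - z.2).continuousAt h
    refine (continuousAt_const (y := f z)).congr ?_
    filter_upwards [this] with p hp
    rw [indicator_of_mem (show z ∈ {z : ℝ × ℝ | |p.1 - z.1| < p.2 - z.2} from hp)]
  · have : ∀ᶠ p : ℝ × ℝ in 𝓝 p₀, p.2 - z.2 < |p.1 - z.1| :=
      (by fun_prop : Continuous fun p : ℝ × ℝ => p.2 - z.2).continuousAt.eventually_lt
        ((by fun_prop : Continuous fun p : ℝ × ℝ => |p.1 - z.1|).continuousAt) h
    refine (continuousAt_const (y := (0 : ℝ))).congr ?_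
    filter_upwards [this] with p hp
    rw [indicator_of_notMem (show z ∉ {z : ℝ × ℝ | |p.1 - z.1| < p.2 - z.2} from not_lt.2 hp.le)]

theorem memLp_ext {T : ℝ} (a : L2 T) : MemLp (ext T a) 2 volume :=
  (memLp_indicator_iff_restrict measurableSet_Ioo).2 (Lp.memLp a)

section EdgeFun

variable (L : ℝ) (a b : L2 T) (f : L2Q L T)

theorem stronglyMeasurable_edgeFun : StronglyMeasurable (edgeFun L T a b f) :=
  ((stronglyMeasurable_waveOp measurable_id (stronglyMeasurable_coe a)).add
    (stronglyMeasurable_waveOp (by fun_prop) (stronglyMeasurable_coe b))).add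
    (stronglyMeasurable_dAlembert L T (stronglyMeasurable_coe f))

/-- Sections of `edgeFun` along a family of lines depend continuously on the parameter, in `L²`. -/
theorem tendsto_edgeFun_section {γ : ℝ → ℝ → ℝ × ℝ} (hγ : Continuous (Function.uncurry γ))
    (h1 : ∀ r, MeasurePreserving (fun x => (γ r x).2 - (γ r x).1) volume volume)
    (h2 : ∀ r, MeasurePreserving (fun x => (γ r x).2 - (L - (γ r x).1)) volume volume)
    (S r₀ : ℝ) :
    Tendsto (fun r => eLpNorm (fun x => edgeFun L T a b f (γ r x) - edgeFun L T a b f (γ r₀ x)) 2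
      (mT S)) (𝓝 r₀) (𝓝 0) := by
  have hD := continuous_dAlembert L T ((Lp.memLp f).integrable (by norm_num))
  have t1 := tendsto_eLpNorm_comp_sub (memLp_ext a) (θ := fun r x => (γ r x).2 - (γ r x).1)
    (by unfold Function.uncurry at *; fun_prop) h1 r₀
  have t2 := tendsto_eLpNorm_comp_sub (memLp_ext b) (θ := fun r x => (γ r x).2 - (L - (γ r x).1))
    (by unfold Function.uncurry at *; fun_prop) h2 r₀
  have t3 := tendsto_eLpNorm_sub_of_continuous (F := fun r x => dAlembert L T f (γ r x))
    (hD.comp hγ) S r₀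
  have t := (t1.add t2).add t3
  simp only [add_zero] at t
  refine tendsto_of_tendsto_of_tendsto_of_le_of_le tendsto_const_nhds t (fun _ => zero_le)
    fun r => ?_
  have hγr : ∀ r, Measurable (γ r) := fun r => (hγ.comp (by fun_prop : Continuous fun x => (r, x))).measurable
  have m1 : ∀ r, AEStronglyMeasurable (fun x => ext T a ((γ r x).2 - (γ r x).1)) (mT S) := fun r =>
    ((stronglyMeasurable_ext (stronglyMeasurable_coe a)).comp_measurable
      (by have := hγr r; fun_prop)).aestronglyMeasurable
  have m2 : ∀ r, AEStronglyMeasurable (fun x => ext T b ((γ r x).2 - (L - (γ r x).1))) (mT S) :=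
    fun r => ((stronglyMeasurable_ext (stronglyMeasurable_coe b)).comp_measurable
      (by have := hγr r; fun_prop)).aestronglyMeasurable
  have m3 : ∀ r, AEStronglyMeasurable (fun x => dAlembert L T f (γ r x)) (mT S) := fun r =>
    (hD.measurable.comp (hγr r)).aestronglyMeasurable
  have e : (fun x => edgeFun L T a b f (γ r x) - edgeFun L T a b f (γ r₀ x))
      = ((fun x => ext T a ((γ r x).2 - (γ r x).1) - ext T a ((γ r₀ x).2 - (γ r₀ x).1))
        + fun x => ext T b ((γ r x).2 - (L - (γ r x).1)) - ext T b ((γ r₀ x).2 - (L - (γ r₀ x).1)))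
        + fun x => dAlembert L T f (γ r x) - dAlembert L T f (γ r₀ x) := by
    ext x
    simp only [edgeFun, waveOp, Pi.add_apply]
    ring
  rw [e]
  refine (eLpNorm_add_le (((m1 r).sub (m1 r₀)).add ((m2 r).sub (m2 r₀)))
    ((m3 r).sub (m3 r₀)) (by norm_num)).trans ?_
  refine add_le_add ((eLpNorm_add_le ((m1 r).sub (m1 r₀)) ((m2 r).sub (m2 r₀))
    (by norm_num)).trans (add_le_add ?_ ?_)) le_rfl
  · exact eLpNorm_restrict_le _ _ _ _
  · exact eLpNorm_restrict_le _ _ _ _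

theorem tendsto_edgeFun_time (t₀ : ℝ) :
    Tendsto (fun t => eLpNorm (fun x => edgeFun L T a b f (x, t) - edgeFun L T a b f (x, t₀)) 2
      (mT L)) (𝓝 t₀) (𝓝 0) := by
  refine tendsto_edgeFun_section L a b f (γ := fun t x => (x, t)) (by unfold Function.uncurry; fun_prop)
    (fun t => Measure.measurePreserving_sub_left volume t) (fun t => ?_) L t₀
  have := measurePreserving_add_right (volume : Measure ℝ) (t - L)
  refine (congrArg (fun F => MeasurePreserving F volume volume) ?_).mp this
  ext x
  ring

theorem tendsto_edgeFun_space (x₀ : ℝ) :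
    Tendsto (fun x => eLpNorm (fun t => edgeFun L T a b f (x, t) - edgeFun L T a b f (x₀, t)) 2
      (mT T)) (𝓝 x₀) (𝓝 0) :=
  tendsto_edgeFun_section L a b f (γ := fun x t => (x, t)) (by unfold Function.uncurry; fun_prop)
    (fun x => measurePreserving_sub_right volume x)
    (fun x => measurePreserving_sub_right volume (L - x)) T x₀

theorem memLp_edgeFun_time (t : ℝ) : MemLp (fun x => edgeFun L T a b f (x, t)) 2 (mT L) := by
  have hD := continuous_dAlembert L T ((Lp.memLp f).integrable (by norm_num))
  refine MemLp.add (MemLp.add ?_ ?_) ?_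
  · exact ((memLp_ext a).comp_measurePreserving
      (Measure.measurePreserving_sub_left volume t)).restrict _
  · have := measurePreserving_add_right (volume : Measure ℝ) (t - L)
    have h := ((memLp_ext b).comp_measurePreserving this).restrict (Ioo 0 L)
    refine (congrArg (fun F => MemLp F 2 (mT L)) ?_).mp h
    ext x
    simp only [Function.comp, waveOp]
    congr 1
    ring
  · have hc : Continuous fun x => dAlembert L T f (x, t) := by fun_prop
    obtain ⟨K, hK⟩ := ae_bound_mT (T := L) hc.continuousOn
    exact MemLp.of_bound hc.aestronglyMeasurable K hK

theorem coeFn_trace_edgeFun (hL : 0 < L) :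
    (a + (isL2Op_shiftOp T hL).toCLM b + traceD T L 0 f : L2 T)
      =ᵐ[mT T] fun t => edgeFun L T a b f (0, t) := by
  filter_upwards [(isL2Op_shiftOp T hL).coeFn_toCLM b, (isL2Op_traceD T L 0).coeFn_toCLM f,
    Lp.coeFn_add a ((isL2Op_shiftOp T hL).toCLM b),
    Lp.coeFn_add (a + (isL2Op_shiftOp T hL).toCLM b) (traceD T L 0 f), ae_mT T] with t h1 h2 h3 h4 h5
  rw [h4, Pi.add_apply, h3, Pi.add_apply, h1, traceD, h2, edgeFun]
  simp [waveOp, shiftOp, ext, h5]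

end EdgeFun

end

section

/-! ### Test functions with a prescribed right hand side -/

/-- The integral is the convolution of `F` with the image of `m` under `-θ`, which inherits the
smoothness of `F`. -/
theorem contDiff_integral_translate {Z : Type*} [MeasurableSpace Z] (m : Measure Z)
    [IsFiniteMeasure m] {θ : Z → ℝ × ℝ} (hθ : Measurable θ) {F : ℝ × ℝ → ℝ}
    (hF : ContDiff ℝ (⊤ : ℕ∞) F) (hFc : HasCompactSupport F) :
    ContDiff ℝ (⊤ : ℕ∞) (fun p => ∫ z, F (p + θ z) ∂m) := by
  have hm : Measurable fun z => -θ z := hθ.neg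
  have h := hFc.contDiff_convolution_right (μ := m.map fun z => -θ z) (f := fun _ => (1 : ℝ))
    (ContinuousLinearMap.mul ℝ ℝ) (locallyIntegrable_const 1) hF
  convert h using 1
  ext p
  rw [convolution_def, integral_map hm.aemeasurable]
  · simp [sub_neg_eq_add]
  · exact (continuous_const.mul (hF.continuous.comp (by fun_prop))).aestronglyMeasurable

/-- The integral of `F` over the segment from `p` to `p + R v`. -/
def rayInt (R : ℝ) (v : ℝ × ℝ) (F : ℝ × ℝ → ℝ) (p : ℝ × ℝ) : ℝ :=
  ∫ r in (0 : ℝ)..R, F (p + r • v)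

theorem hasDerivAt_rayInt {R : ℝ} {v : ℝ × ℝ} {F : ℝ × ℝ → ℝ} (hF : Continuous F) (p : ℝ × ℝ) :
    HasDerivAt (fun s : ℝ => rayInt R v F (p + s • v)) (F (p + R • v) - F p) 0 := by
  have hc : Continuous fun r : ℝ => F (p + r • v) := by fun_prop
  have e : (fun s : ℝ => rayInt R v F (p + s • v))
      = fun s => (∫ r in (0 : ℝ)..(R + s), F (p + r • v)) - ∫ r in (0 : ℝ)..s, F (p + r • v) := by
    ext s
    have h1 := intervalIntegral.integral_comp_add_right (a := 0) (b := R)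
      (fun r => F (p + r • v)) s
    have h2 := intervalIntegral.integral_interval_sub_left (a := 0) (b := R + s) (c := s)
      (hc.intervalIntegrable (μ := volume) _ _) (hc.intervalIntegrable _ _)
    rw [h2]
    rw [zero_add] at h1
    rw [← h1, rayInt]
    congr 1
    ext r
    rw [add_smul, add_assoc, add_comm (s • v)]
  rw [e]
  have d1 : HasDerivAt (fun x => ∫ r in (0 : ℝ)..x, F (p + r • v)) (F (p + R • v)) (R + 0) := by
    have := intervalIntegral.integral_hasDerivAt_right (hc.intervalIntegrable 0 (R + 0))
      (hc.stronglyMeasurableAtFilter volume _) hc.continuousAt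
    simpa using this
  have d2 : HasDerivAt (fun x => ∫ r in (0 : ℝ)..x, F (p + r • v)) (F p) 0 := by
    have := intervalIntegral.integral_hasDerivAt_right (hc.intervalIntegrable 0 0)
      (hc.stronglyMeasurableAtFilter volume _) hc.continuousAt
    simpa using this
  exact (d1.comp_const_add R 0).sub d2

theorem contDiff_rayInt {R : ℝ} (hR : 0 ≤ R) (v : ℝ × ℝ) {F : ℝ × ℝ → ℝ}
    (hF : ContDiff ℝ (⊤ : ℕ∞) F) (hFc : HasCompactSupport F) :
    ContDiff ℝ (⊤ : ℕ∞) (rayInt R v F) := by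
  have := contDiff_integral_translate (volume.restrict (Ioc 0 R)) (θ := fun r : ℝ => r • v)
    (by fun_prop) hF hFc
  have e : rayInt R v F = fun p => ∫ r in Ioc 0 R, F (p + r • v) :=
    funext fun p => intervalIntegral.integral_of_le hR
  rwa [e]

theorem rayInt_rayInt {R : ℝ} (hR : 0 ≤ R) (v w : ℝ × ℝ) {F : ℝ × ℝ → ℝ} (hF : Continuous F)
    (p : ℝ × ℝ) : rayInt R v (rayInt R w F) p = ∫ z : ℝ × ℝ, F (p + (z.1 • v + z.2 • w))
      ∂((volume.restrict (Ioc 0 R)).prod (volume.restrict (Ioc 0 R))) := by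
  have hc : Continuous fun z : ℝ × ℝ => F (p + (z.1 • v + z.2 • w)) := by fun_prop
  have hint : Integrable (fun z : ℝ × ℝ => F (p + (z.1 • v + z.2 • w)))
      ((volume.restrict (Ioc 0 R)).prod (volume.restrict (Ioc 0 R))) := by
    rw [Measure.prod_restrict]
    exact (hc.continuousOn.integrableOn_compact (isCompact_Icc.prod isCompact_Icc)).mono_set
      (prod_mono Ioc_subset_Icc_self Ioc_subset_Icc_self)
  rw [integral_prod _ hint, rayInt, intervalIntegral.integral_of_le hR]
  simp only [rayInt, intervalIntegral.integral_of_le hR, add_assoc]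

/-- Viewing the iterated integral as one average of translates of `F` avoids discussing the support
of the inner integral. -/
theorem contDiff_rayInt_rayInt {R : ℝ} (hR : 0 ≤ R) (v w : ℝ × ℝ) {F : ℝ × ℝ → ℝ}
    (hF : ContDiff ℝ (⊤ : ℕ∞) F) (hFc : HasCompactSupport F) :
    ContDiff ℝ (⊤ : ℕ∞) (rayInt R v (rayInt R w F)) := by
  rw [funext (rayInt_rayInt hR v w hF.continuous)]
  exact contDiff_integral_translate ((volume.restrict (Ioc 0 R)).prod (volume.restrict (Ioc 0 R)))
    (θ := fun z : ℝ × ℝ => z.1 • v + z.2 • w) (by fun_prop) hF hFc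

theorem rayInt_comm {R : ℝ} (hR : 0 ≤ R) (v w : ℝ × ℝ) {F : ℝ × ℝ → ℝ} (hF : Continuous F) :
    rayInt R v (rayInt R w F) = rayInt R w (rayInt R v F) := by
  ext p
  rw [rayInt_rayInt hR v w hF, rayInt_rayInt hR w v hF, ← integral_prod_swap]
  simp only [Prod.fst_swap, Prod.snd_swap, add_comm]

theorem rayInt_eq_zero {R : ℝ} (hR : 0 ≤ R) {v : ℝ × ℝ} {F : ℝ × ℝ → ℝ} {p : ℝ × ℝ}
    (h : ∀ r ∈ Icc 0 R, F (p + r • v) = 0) : rayInt R v F p = 0 := by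
  rw [rayInt, intervalIntegral.integral_congr (g := fun _ => 0)]
  · simp
  · intro r hr
    rw [uIcc_of_le hR] at hr
    exact h r hr

/-- The solution of `ψ_tt - ψ_xx = F` on the line with zero data at the final time. -/
def backward (R : ℝ) (F : ℝ × ℝ → ℝ) : ℝ × ℝ → ℝ := rayInt R (-1, 1) (rayInt R (1, 1) F)

section Backward

variable {T L : ℝ} {F : ℝ × ℝ → ℝ} (hT : 0 < T) (hF : ContDiff ℝ (⊤ : ℕ∞) F)
  (hFc : HasCompactSupport F) (hFs : ∀ p, p ∉ Ioo 0 L ×ˢ Ioo 0 T → F p = 0)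

include hFs in
theorem eq_zero_of_le_time {p : ℝ × ℝ} (hp : T ≤ p.2) : F p = 0 :=
  hFs p fun h => absurd h.2.2 (not_lt.2 hp)

include hT hFs in
theorem rayInt_eq_zero_of_le_time {v : ℝ × ℝ} (hv : v.2 = 1) {p : ℝ × ℝ} (hp : T ≤ p.2) :
    rayInt T v F p = 0 :=
  rayInt_eq_zero hT.le fun r hr => eq_zero_of_le_time hFs (by simp [hv]; linarith [hr.1])

include hT hFs in
theorem backward_eq_zero {p : ℝ × ℝ} (hp : T ≤ p.2) : backward T F p = 0 :=
  rayInt_eq_zero hT.le fun r hr =>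
    rayInt_eq_zero_of_le_time hT hFs (v := (1, 1)) rfl (by simp; linarith [hr.1])

include hT hF hFc in
theorem contDiff_backward : ContDiff ℝ (⊤ : ℕ∞) (backward T F) :=
  contDiff_rayInt_rayInt hT.le _ _ hF hFc

-- Differentiating a ray integral along its own direction leaves the difference of the end values.
-- The far end lies at time at least `T`, where the inner integral vanishes; a ray of length `T` is
-- thus long enough.
include hT hF hFc hFs in
theorem fderiv_backward_left {p : ℝ × ℝ} (hp : 0 ≤ p.2) :
    fderiv ℝ (backward T F) p (-1, 1) = -rayInt T (1, 1) F p := by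
  have hd : HasFDerivAt (backward T F) (fderiv ℝ (backward T F) p) (p + (0 : ℝ) • (-1, 1)) := by
    rw [zero_smul, add_zero]
    exact ((contDiff_backward hT hF hFc).differentiable (by simp) p).hasFDerivAt
  have h1 : HasDerivAt (fun s : ℝ => p + s • ((-1, 1) : ℝ × ℝ)) (-1, 1) 0 := by
    simpa using ((hasDerivAt_id (0 : ℝ)).smul_const ((-1, 1) : ℝ × ℝ)).const_add p
  have h2 := hd.comp_hasDerivAt (0 : ℝ) h1
  have h3 := hasDerivAt_rayInt (R := T) (v := (-1, 1))
    (contDiff_rayInt hT.le (1, 1) hF hFc).continuous p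
  rw [rayInt_eq_zero_of_le_time hT hFs (v := (1, 1)) rfl (p := p + T • (-1, 1))
    (by simp; linarith), zero_sub] at h3
  exact h2.unique h3

-- Since the two ray integrals commute, this derivative is minus an integral of `F` along a ray in
-- direction `(-1, 1)`. From `x = 0` that ray never enters the support of `F`. Equivalently, `∂_x =
-- -∂_t` for the backward solution at the centre.
include hT hF hFc hFs in
theorem fderiv_backward_zero {t : ℝ} (ht : 0 ≤ t) :
    fderiv ℝ (backward T F) (0, t) (1, 1) = 0 := by
  set p : ℝ × ℝ := (0, t)
  have hd : HasFDerivAt (backward T F) (fderiv ℝ (backward T F) p) (p + (0 : ℝ) • (1, 1)) := by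
    rw [zero_smul, add_zero]
    exact ((contDiff_backward hT hF hFc).differentiable (by simp) p).hasFDerivAt
  have h1 : HasDerivAt (fun s : ℝ => p + s • ((1, 1) : ℝ × ℝ)) (1, 1) 0 := by
    simpa using ((hasDerivAt_id (0 : ℝ)).smul_const ((1, 1) : ℝ × ℝ)).const_add p
  have h2 := hd.comp_hasDerivAt (0 : ℝ) h1
  have h3 := hasDerivAt_rayInt (R := T) (v := (1, 1))
    (contDiff_rayInt hT.le (-1, 1) hF hFc).continuous p
  rw [rayInt_eq_zero_of_le_time hT hFs (v := (-1, 1)) rfl (p := p + T • (1, 1))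
    (by simp [p]; linarith), zero_sub, rayInt_eq_zero hT.le (v := (-1, 1)) (p := p), neg_zero] at h3
  · rw [← rayInt_comm hT.le _ _ hF.continuous] at h3
    exact h2.unique h3
  · intro r hr
    refine hFs _ fun h => ?_
    have := h.1.1
    simp [p] at this
    linarith [hr.1]

end Backward

/-! ### The backward problem on the star -/

/-- One step of the delay system for the waves which leave the centre and the boundary. -/
def delayStep (l : Fin 3 → ℝ) (α β : Fin 3 → ℝ → ℝ) (W : (Fin 3 → ℝ → ℝ) × (Fin 3 → ℝ → ℝ)) :
    (Fin 3 → ℝ → ℝ) × (Fin 3 → ℝ → ℝ) :=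
  (fun j s => ∑ i, scattering j i * (W.2 i (s - l i) + β i s),
    fun j s => -W.1 j (s - l j) - α j s)

/-- Iteration from zero. With `ℓ` the shortest edge, the value of one more iterate at `s` only
involves the previous one at times at most `s - ℓ`, so the `n`-th iterate is stationary for `s ≤ n
ℓ`. Finitely many steps reach `S`, and smoothness requires no limit. -/
theorem exists_delay_solution {l : Fin 3 → ℝ} (hl : ∀ j, 0 < l j) {α β : Fin 3 → ℝ → ℝ}
    (hα : ∀ j, ContDiff ℝ (⊤ : ℕ∞) (α j)) (hβ : ∀ j, ContDiff ℝ (⊤ : ℕ∞) (β j))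
    (hα0 : ∀ j, ∀ s ≤ 0, α j s = 0) (hβ0 : ∀ j, ∀ s ≤ 0, β j s = 0) (S : ℝ) :
    ∃ A B : Fin 3 → ℝ → ℝ, (∀ j, ContDiff ℝ (⊤ : ℕ∞) (A j)) ∧ (∀ j, ContDiff ℝ (⊤ : ℕ∞) (B j)) ∧
      (∀ j, ∀ s ≤ 0, A j s = 0) ∧ (∀ j, ∀ s ≤ 0, B j s = 0) ∧
      (∀ j, ∀ s ≤ S, A j s = ∑ i, scattering j i * (B i (s - l i) + β i s)) ∧
      (∀ j, ∀ s ≤ S, B j s = -A j (s - l j) - α j s) := by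
  set P : ℕ → (Fin 3 → ℝ → ℝ) × (Fin 3 → ℝ → ℝ) := fun n => (delayStep l α β)^[n] 0 with hP
  have hsucc : ∀ n, P (n + 1) = delayStep l α β (P n) := fun n =>
    Function.iterate_succ_apply' _ _ _
  have hsm : ∀ n, (∀ j, ContDiff ℝ (⊤ : ℕ∞) ((P n).1 j)) ∧
      (∀ j, ContDiff ℝ (⊤ : ℕ∞) ((P n).2 j)) := by
    intro n
    induction n with
    | zero => exact ⟨fun j => contDiff_const, fun j => contDiff_const⟩
    | succ n ih =>
      rw [hsucc]
      refine ⟨fun j => ?_, fun j => ?_⟩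
      · simp only [delayStep]
        exact ContDiff.sum fun i _ => contDiff_const.mul
          (((ih.2 i).comp (contDiff_id.sub contDiff_const)).add (hβ i))
      · exact ((ih.1 j).comp (contDiff_id.sub contDiff_const)).neg.sub (hα j)
  have h0 : ∀ n, (∀ j, ∀ s ≤ 0, (P n).1 j s = 0) ∧ (∀ j, ∀ s ≤ 0, (P n).2 j s = 0) := by
    intro n
    induction n with
    | zero => exact ⟨fun j s _ => rfl, fun j s _ => rfl⟩
    | succ n ih =>
      rw [hsucc]
      refine ⟨fun j s hs => ?_, fun j s hs => ?_⟩
      · simp only [delayStep]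
        refine Finset.sum_eq_zero fun i _ => ?_
        rw [ih.2 i _ (by linarith [hl i]), hβ0 i s hs, add_zero, mul_zero]
      · simp only [delayStep]
        rw [ih.1 j _ (by linarith [hl j]), hα0 j s hs, neg_zero, sub_zero]
  obtain ⟨ℓ, hℓ, hℓl⟩ : ∃ ℓ > 0, ∀ j, ℓ ≤ l j := by
    obtain ⟨i, -, hi⟩ := Finset.exists_min_image Finset.univ l ⟨0, Finset.mem_univ _⟩
    exact ⟨l i, hl i, fun j => hi j (Finset.mem_univ j)⟩
  have hst : ∀ n : ℕ, ∀ s ≤ n * ℓ, (∀ j, (P (n + 1)).1 j s = (P n).1 j s) ∧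
      (∀ j, (P (n + 1)).2 j s = (P n).2 j s) := by
    intro n
    induction n with
    | zero =>
      intro s hs
      rw [Nat.cast_zero, zero_mul] at hs
      exact ⟨fun j => by rw [(h0 _).1 j s hs, (h0 _).1 j s hs],
        fun j => by rw [(h0 _).2 j s hs, (h0 _).2 j s hs]⟩
    | succ n ih =>
      intro s hs
      have hs' : ∀ j, s - l j ≤ n * ℓ := fun j => by
        push_cast at hs
        linarith [hℓl j]
      rw [hsucc (n + 1)]
      refine ⟨fun j => ?_, fun j => ?_⟩
      · conv_rhs => rw [hsucc n]
        simp only [delayStep]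
        refine Finset.sum_congr rfl fun i _ => ?_
        rw [(ih _ (hs' i)).2 i]
      · conv_rhs => rw [hsucc n]
        simp only [delayStep]
        rw [(ih _ (hs' j)).1 j]
  obtain ⟨n, hn⟩ := exists_nat_ge (S / ℓ)
  rw [div_le_iff₀ hℓ] at hn
  refine ⟨(P n).1, (P n).2, (hsm n).1, (hsm n).2, (h0 n).1, (h0 n).2, fun j s hs => ?_,
    fun j s hs => ?_⟩
  · rw [← (hst n s (hs.trans hn)).1 j, hsucc]
    rfl
  · rw [← (hst n s (hs.trans hn)).2 j, hsucc]
    rfl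

/-- In the reversed time `s = T - t` the free backward solution is corrected on each edge by
travelling waves from the centre and from the boundary vertex. The correction does not change the
right hand side, and the vertex conditions become the delay system. -/
theorem exists_isTest {l : Fin 3 → ℝ} (hl : ∀ j, 0 < l j) {T : ℝ} (hT : 0 < T)
    {F : Fin 3 → ℝ × ℝ → ℝ} (hF : ∀ j, ContDiff ℝ (⊤ : ℕ∞) (F j))
    (hFc : ∀ j, HasCompactSupport (F j))
    (hFs : ∀ j, ∀ p, p ∉ Ioo 0 (l j) ×ˢ Ioo 0 T → F j p = 0) :
    ∃ φ, IsTest l T φ ∧ ∀ j, ∀ p ∈ Ioo 0 (l j) ×ˢ Ioo 0 T, box (l j) T (φ j) p = F j p := by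
  set Ψ : Fin 3 → ℝ × ℝ → ℝ := fun j => backward T (F j) with hΨ
  have hΨs : ∀ j, ContDiff ℝ (⊤ : ℕ∞) (Ψ j) := fun j => contDiff_backward hT (hF j) (hFc j)
  have hΨ0 : ∀ j p, T ≤ p.2 → Ψ j p = 0 := fun j p hp => backward_eq_zero hT (hFs j) hp
  obtain ⟨A, B, hA, hB, hA0, hB0, hAe, hBe⟩ := exists_delay_solution hl
    (α := fun j s => Ψ j (l j, T - s)) (β := fun j s => Ψ j (0, T - s))
    (fun j => (hΨs j).comp (contDiff_const.prodMk (contDiff_const.sub contDiff_id)))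
    (fun j => (hΨs j).comp (contDiff_const.prodMk (contDiff_const.sub contDiff_id)))
    (fun j s hs => hΨ0 j _ (by simp only; linarith)) (fun j s hs => hΨ0 j _ (by simp only; linarith))
    -- The extra unit makes the equations hold in a neighbourhood of every reversed time in `[0,
    -- T]`, so they may be differentiated for the Kirchhoff condition.
    (T + 1)
  set φ : Fin 3 → ℝ → ℝ → ℝ := fun j x t =>
    A j (T - t - x) + B j (T - t - (l j - x)) + Ψ j (x, t) with hφ
  have hφs : ∀ j, ContDiff ℝ (⊤ : ℕ∞) (fun p : ℝ × ℝ => φ j p.1 p.2) := fun j =>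
    (((hA j).comp ((contDiff_const.sub contDiff_snd).sub contDiff_fst)).add
      ((hB j).comp ((contDiff_const.sub contDiff_snd).sub (contDiff_const.sub contDiff_fst)))).add
      (hΨs j)
  have hφ2 : ∀ j, ContDiffOn ℝ 2 (fun p : ℝ × ℝ => φ j p.1 p.2) (Icc 0 (l j) ×ˢ Icc 0 T) :=
    fun j => (contDiff_infty.1 (hφs j) 2).contDiffOn
  have hAd : ∀ j s, HasDerivAt (A j) (deriv (A j) s) s := fun j s =>
    ((hA j).differentiable (by simp) s).hasDerivAt
  have hBd : ∀ j s, HasDerivAt (B j) (deriv (B j) s) s := fun j s =>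
    ((hB j).differentiable (by simp) s).hasDerivAt
  have hΨd : ∀ j p, HasFDerivAt (Ψ j) (fderiv ℝ (Ψ j) p) p := fun j p =>
    ((hΨs j).differentiable (by simp) p).hasFDerivAt
  have hzero : ∀ j, ∀ x ∈ Icc 0 (l j), ∀ t, T ≤ t → φ j x t = 0 := fun j x hx t ht => by
    simp only [hφ]
    rw [hA0 j _ (by linarith [hx.1]), hB0 j _ (by linarith [hx.2]), hΨ0 j _ ht]
    ring
  refine ⟨φ, ⟨hφ2, fun j x hx => hzero j x hx T le_rfl, fun j x hx => ?_, fun j t ht => ?_,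
    fun i j t ht => ?_, fun t ht => ?_⟩, fun j p hp => ?_⟩
  -- The smooth function `φ j x` vanishes for all `t ≥ T`, so its derivative at `T`, computed from
  -- the right, is zero.
  · have hd : DifferentiableAt ℝ (fun s => φ j x s) T :=
      (((hφs j).comp (contDiff_const.prodMk contDiff_id)).differentiable (by simp)) T
    rw [dt, hd.derivWithin (uniqueDiffOn_Icc hT T (right_mem_Icc.2 hT.le)),
      ← hd.derivWithin (uniqueDiffWithinAt_Ici T)]
    exact (derivWithin_congr (f := fun _ => (0 : ℝ)) (s := Ici T) (fun t ht => hzero j x hx t ht)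
      (hzero j x hx T le_rfl)).trans (by simp)
  · simp only [hφ, sub_self, sub_zero]
    rw [hBe j (T - t) (by linarith [ht.1])]
    simp only [sub_sub_cancel]
    ring
  · have h1 : ∀ j, φ j 0 t
        = 2 / 3 * ∑ i, (B i (T - t - l i) + Ψ i (0, T - (T - t))) := fun j => by
      simp only [hφ, sub_zero]
      rw [hAe j (T - t) (by linarith [ht.1])]
      fin_cases j <;> simp [Fin.sum_univ_three, scattering] <;> ring
    rw [h1 i, h1 j]
  · set s := T - t with hs
    have hI : ∀ j, HasDerivAt (fun r => B j (r - l j) + Ψ j (0, T - r))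
        (deriv (B j) (s - l j) + fderiv ℝ (Ψ j) (0, t) (0, -1)) s := fun j => by
      refine ((hBd j (s - l j)).comp_sub_const s (l j)).add ?_
      have h1 : HasDerivAt (fun r : ℝ => ((0, T - r) : ℝ × ℝ)) (0, -1) s :=
        (hasDerivAt_const s (0 : ℝ)).prodMk ((hasDerivAt_id s).const_sub T)
      have h2 := hΨd j (0, T - s)
      have h3 := h2.comp_hasDerivAt s h1
      rwa [hs, sub_sub_cancel] at h3
    have hsum : HasDerivAt (fun r => ∑ j, (-A j r + (B j (r - l j) + Ψ j (0, T - r))))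
        (∑ j, (-deriv (A j) s + (deriv (B j) (s - l j) + fderiv ℝ (Ψ j) (0, t) (0, -1)))) s :=
      HasDerivAt.fun_sum fun j _ => (hAd j s).neg.add (hI j)
    have hz : (fun r => ∑ j, (-A j r + (B j (r - l j) + Ψ j (0, T - r)))) =ᶠ[𝓝 s] fun _ => 0 := by
      filter_upwards [Iio_mem_nhds (show s < T + 1 by linarith [ht.1])] with r hr
      have := fun j => hAe j r (le_of_lt hr)
      simp only [this, Fin.sum_univ_three, scattering, Fin.reduceEq, if_true, if_false, Fin.isValue]
      ring
    have hval := hsum.unique ((hasDerivAt_const s (0 : ℝ)).congr_of_eventuallyEq hz)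
    refine (Finset.sum_congr rfl fun j _ => ?_).trans hval
    have hk : fderiv ℝ (Ψ j) (0, t) (1, 0) = fderiv ℝ (Ψ j) (0, t) (0, -1) := by
      have := fderiv_backward_zero hT (hF j) (hFc j) (hFs j) ht.1
      rw [show ((1, 1) : ℝ × ℝ) = (1, 0) - (0, -1) by simp, map_sub, sub_eq_zero] at this
      exact this
    have hdx : HasDerivAt (fun x => φ j x t)
        (-deriv (A j) s + (deriv (B j) (s - l j) + fderiv ℝ (Ψ j) (0, t) (0, -1))) 0 := by
      rw [← hk, ← add_assoc]
      refine HasDerivAt.add (HasDerivAt.add ?_ ?_) ?_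
      · have h1 := hAd j (s - 0)
        rw [sub_zero] at h1
        have := HasDerivAt.comp_const_sub s (0 : ℝ) (by rw [sub_zero]; exact h1)
        exact this
      · have h1 : HasDerivAt (fun x => T - t - (l j - x)) 1 0 := by
          have := (((hasDerivAt_id (0 : ℝ)).const_sub (l j)).const_sub (T - t))
          simpa using this
        have h2 := hBd j (T - t - (l j - 0))
        have h3 := h2.comp (0 : ℝ) h1
        rw [mul_one, sub_zero] at h3
        exact h3
      · have h1 : HasDerivAt (fun x : ℝ => ((x, t) : ℝ × ℝ)) (1, 0) 0 :=
          (hasDerivAt_id (0 : ℝ)).prodMk (hasDerivAt_const (0 : ℝ) t)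
        exact (hΨd j (0, t)).comp_hasDerivAt (0 : ℝ) h1
    rw [dx, hdx.hasDerivWithinAt.derivWithin
      (uniqueDiffOn_Icc (hl j) 0 (left_mem_Icc.2 (hl j).le))]
  · obtain ⟨x, t⟩ := p
    -- Along `(-1, 1)` the wave `A` is constant. The remaining `B` term is constant along `(1, 1)`,
    -- so the second differentiation sees only the ray integral and returns `F`.
    have hchar : ∀ p ∈ Ioo 0 (l j) ×ˢ Ioo 0 T, dirDeriv (l j) T (φ j) (0, 1) p
        - dirDeriv (l j) T (φ j) (1, 0) p
          = -2 * deriv (B j) (T - p.2 - (l j - p.1)) - rayInt T (1, 1) (F j) p := by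
      intro p hp
      have hn : Icc 0 (l j) ×ˢ Icc 0 T ∈ 𝓝 p :=
        prod_mem_nhds (Icc_mem_nhds hp.1.1 hp.1.2) (Icc_mem_nhds hp.2.1 hp.2.2)
      rw [dirDeriv, dirDeriv, fderivWithin_of_mem_nhds hn, ← map_sub]
      have hv : ((0, 1) - (1, 0) : ℝ × ℝ) = (-1, 1) := by simp
      rw [hv]
      have hd : HasFDerivAt (fun p : ℝ × ℝ => φ j p.1 p.2) _ p :=
        (((hφs j).differentiable (by simp)) p).hasFDerivAt
      have hpath : HasDerivAt (fun r : ℝ => p + r • ((-1, 1) : ℝ × ℝ)) (-1, 1) 0 := by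
        simpa using ((hasDerivAt_id (0 : ℝ)).smul_const ((-1, 1) : ℝ × ℝ)).const_add p
      have hp0 : p + (0 : ℝ) • ((-1, 1) : ℝ × ℝ) = p := by simp
      rw [← hp0] at hd
      have h1 := hd.comp_hasDerivAt (0 : ℝ) hpath
      rw [hp0] at h1
      refine h1.unique ?_
      have hΨ1 := hΨd j p
      rw [← hp0] at hΨ1
      have h2 := hΨ1.comp_hasDerivAt (0 : ℝ) hpath
      rw [hp0, fderiv_backward_left hT (hF j) (hFc j) (hFs j) hp.2.1.le] at h2
      have h3 : HasDerivAt (fun r : ℝ => T - p.2 - (l j - p.1) - 2 * r) (-2) 0 := by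
        simpa using ((hasDerivAt_id (0 : ℝ)).const_mul 2).const_sub (T - p.2 - (l j - p.1))
      have h4 := hBd j (T - p.2 - (l j - p.1) - 2 * 0)
      have h5 := ((h4.comp (0 : ℝ) h3).const_add (A j (T - p.2 - p.1))).add h2
      simp only [mul_zero, sub_zero] at h5
      refine (h5.congr_of_eventuallyEq (Eventually.of_forall fun r => ?_)).congr_deriv (by ring)
      simp only [hφ, Function.comp, Pi.add_apply]
      have e1 : T - (p + r • ((-1, 1) : ℝ × ℝ)).2 - (p + r • ((-1, 1) : ℝ × ℝ)).1
          = T - p.2 - p.1 := by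
        simp
        ring
      have e2 : T - (p + r • ((-1, 1) : ℝ × ℝ)).2 - (l j - (p + r • ((-1, 1) : ℝ × ℝ)).1)
          = T - p.2 - (l j - p.1) - 2 * r := by
        simp
        ring
      rw [e1, e2]
    have h1 := (hasDerivAt_dirDeriv_char (hl j) hT (hφ2 j) hp.1 hp.2).1
    have h2 := hasDerivAt_rayInt (R := T) (v := (1, 1)) (hF j).continuous (x, t)
    rw [eq_zero_of_le_time (hFs j) (by simp; linarith [hp.2.1]), zero_sub] at h2
    have h3 := h2.const_sub (-2 * deriv (B j) (T - t - (l j - x)))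
    rw [neg_neg] at h3
    refine h1.unique (h3.congr_of_eventuallyEq ?_)
    have hev : ∀ᶠ r : ℝ in 𝓝 0, ((x + r, t + r) : ℝ × ℝ) ∈ Ioo 0 (l j) ×ˢ Ioo 0 T := by
      have hc : ContinuousAt (fun r : ℝ => ((x + r, t + r) : ℝ × ℝ)) 0 := by fun_prop
      refine hc.eventually_mem ((isOpen_Ioo.prod isOpen_Ioo).mem_nhds ?_)
      simpa using hp
    filter_upwards [hev] with r hr
    rw [hchar _ hr]
    simp only [Prod.smul_mk, smul_eq_mul, mul_one, Prod.mk_add_mk]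
    congr 3
    ring

end

section

/-! ### Generalized solutions and the system for the waves -/

variable {l : Fin 3 → ℝ} (hl : ∀ j, 0 < l j) {T : ℝ} (hT : 0 < T)

-- Choosing a test function whose right hand side is an arbitrary bump on one edge and zero on the
-- others reduces this to the fundamental lemma of the calculus of variations.
include hl hT in
theorem eq_zero_of_integral_mul_box_eq_zero {W : ∀ j, L2Q (l j) T}
    (hW : ∀ φ, IsTest l T φ → ∑ j, ∫ p, W j p * box (l j) T (φ j) p ∂(mQ (l j) T) = 0)
    (j : Fin 3) : W j = 0 := by
  have hO : IsOpen (Ioo 0 (l j) ×ˢ Ioo 0 T) := isOpen_Ioo.prod isOpen_Ioo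
  have hQ : ∀ {w : ℝ × ℝ → ℝ}, (∀ᵐ p, p ∈ Ioo 0 (l j) ×ˢ Ioo 0 T → w p = 0) →
      w =ᵐ[mQ (l j) T] 0 := fun h => by
    rw [mQ_eq]
    exact (ae_restrict_iff' hO.measurableSet).2 h
  have hI : ∀ w : ℝ × ℝ → ℝ, Integrable w (mQ (l j) T) →
      IntegrableOn w (Ioo 0 (l j) ×ˢ Ioo 0 T) := fun w h => by rwa [mQ_eq] at h
  have hS : ∀ w : ℝ × ℝ → ℝ, ∫ p, w p ∂(mQ (l j) T) = ∫ p in Ioo 0 (l j) ×ˢ Ioo 0 T, w p :=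
    fun w => by rw [mQ_eq]
  refine (Lp.eq_zero_iff_ae_eq_zero (f := W j)).2 (hQ ?_)
  refine hO.ae_eq_zero_of_integral_contDiff_smul_eq_zero (μ := volume) (f := W j) ?_ ?_
  · exact (hI _ ((Lp.memLp (W j)).integrable (by norm_num))).locallyIntegrableOn
  · intro ψ hψ hψc hψs
    have hψ0 : ∀ p, p ∉ Ioo 0 (l j) ×ˢ Ioo 0 T → ψ p = 0 := fun p hp =>
      image_eq_zero_of_notMem_tsupport fun h => hp (hψs h)
    obtain ⟨φ, hφ, hbox⟩ := exists_isTest hl hT (F := fun i => if i = j then ψ else fun _ => 0)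
      (fun i => by split_ifs; exacts [hψ, contDiff_const])
      (fun i => by split_ifs; exacts [hψc, HasCompactSupport.zero])
      (fun i p hp => by
        split_ifs with h
        · subst h
          exact hψ0 p hp
        · rfl)
    have h1 := hW φ hφ
    have h2 : ∀ i, ∫ p, W i p * box (l i) T (φ i) p ∂(mQ (l i) T)
        = ∫ p, W i p * (if i = j then ψ else fun _ => 0) p ∂(mQ (l i) T) := fun i => by
      refine integral_congr_ae ?_
      filter_upwards [ae_mQ (l i) T] with p hp
      rw [hbox i p hp]
    rw [Finset.sum_eq_single j] at h1
    · rw [h2 j, hS] at h1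
      simp only [if_true] at h1
      rw [← setIntegral_eq_integral_of_forall_compl_eq_zero (s := Ioo 0 (l j) ×ˢ Ioo 0 T)
        fun p hp => by rw [hψ0 p hp, zero_smul]]
      simpa only [smul_eq_mul, mul_comm] using h1
    · intro i _ hi
      rw [h2 i]
      simp [hi]
    · simp

/-- The data of the system: `k • g` emitted at the centre, and `h` at the boundary vertices. -/
def waveData (l : Fin 3 → ℝ) (T k : ℝ) : L2 T × (Fin 3 → L2 T) →L[ℝ] State l T :=
  (ContinuousLinearMap.pi fun j => (k * emission j) • ContinuousLinearMap.fst ℝ _ _).prod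
    ((ContinuousLinearMap.snd ℝ _ _).prod 0)

theorem waveData_apply (k : ℝ) (g : L2 T) (h : Fin 3 → L2 T) :
    waveData l T k (g, h) = (fun j => (k * emission j) • g, h, 0) := rfl

theorem abs_scattering_le (i j : Fin 3) : |scattering i j| ≤ 1 := by
  rw [scattering, abs_le]
  split_ifs <;> norm_num

-- The right hand side `M U` is treated as known. The waves it generates together with `g` and `h`
-- satisfy the same weak identity as `U`, so `U` must coincide with them.
include hT in
theorem exists_waves_of_weak (M : ∀ j, L2Q (l j) T →L[ℝ] L2Q (l j) T) {g : L2 T} {h : Fin 3 → L2 T}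
    {U : ∀ j, L2Q (l j) T}
    (hU : ∀ φ, IsTest l T φ → ∑ j, ((∫ p, U j p * box (l j) T (φ j) p ∂(mQ (l j) T))
        - ∫ p, M j (U j) p * φ j p.1 p.2 ∂(mQ (l j) T))
      = (∫ t in Ioo 0 T, g t * dx (l 2) (φ 2) 0 t)
        - ∑ j, ∫ t in Ioo 0 T, h j t * dx (l j) (φ j) (l j) t) :
    ∃ a b : Fin 3 → L2 T,
      ((a, b, U) : State l T) = sysK hl T scattering M (a, b, U) + waveData l T 1 (g, h) := by
  -- With `M = 0` only the delays couple `a` and `b`; the contributions of `M U` are moved into the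
  -- datum `d`. The third component of the state plays no role here.
  obtain ⟨R, hR⟩ := exists_sysK_resolvent hl abs_scattering_le (T := T) (M := fun _ => 0) (m := 0)
    (fun j lam f => by
      rw [_root_.zero_apply, wNorm_zero]
      exact zero_le)
  set f : ∀ j, L2Q (l j) T := fun j => M j (U j) with hf
  set d : State l T := (fun j => ∑ i, scattering j i • traceD T (l i) 0 (f i) + emission j • g,
    fun j => h j - traceD T (l j) (l j) (f j), 0) with hd
  have hy := (hR (R d) d).2 rfl
  rw [sysK_apply] at hy
  set a := (R d).1 with ha
  set b := (R d).2.1 with hb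
  have ha' : ∀ j, a j = ∑ i, scattering j i • (tau hl T i (b i) + traceD T (l i) 0 (f i))
      + emission j • g := fun j => by
    have := congrFun (congrArg Prod.fst hy) j
    simp only [Prod.fst_add, Pi.add_apply, arriving_apply, _root_.zero_apply, map_zero,
      add_zero, hd] at this
    simp only [smul_add, Finset.sum_add_distrib]
    rw [add_assoc]
    exact this
  have hb' : ∀ j, b j = h j - tau hl T j (a j) - traceD T (l j) (l j) (f j) := fun j => by
    have := congrFun (congrArg (fun y : State l T => y.2.1) hy) j
    simp only [Prod.snd_add, Prod.fst_add, Pi.add_apply, _root_.zero_apply, map_zero,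
      sub_zero, hd] at this
    refine Eq.trans this ?_
    abel
  have hW := eq_zero_of_integral_mul_box_eq_zero hl hT
    (W := fun j => U j - edgeSol T (l j) (a j) (b j) (f j)) fun φ hφ => by
      have h1 := hU φ hφ
      have h2 := sum_integral_edgeSol_mul_box hl hT ha' hb' hφ
      rw [Finset.sum_sub_distrib] at h1
      have h3 : ∀ j, ∫ p, (U j - edgeSol T (l j) (a j) (b j) (f j) : L2Q (l j) T) p
            * box (l j) T (φ j) p ∂(mQ (l j) T)
          = (∫ p, U j p * box (l j) T (φ j) p ∂(mQ (l j) T))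
            - ∫ p, edgeSol T (l j) (a j) (b j) (f j) p * box (l j) T (φ j) p ∂(mQ (l j) T) :=
        fun j => by
          have hbox := continuousOn_box (hl j) hT (hφ.contDiffOn j)
          rw [← integral_sub (integrable_L2Q_mul _ hbox) (integrable_L2Q_mul _ hbox)]
          refine integral_congr_ae ?_
          filter_upwards [Lp.coeFn_sub (U j) (edgeSol T (l j) (a j) (b j) (f j))] with p hp
          rw [hp, Pi.sub_apply, sub_mul]
      simp only [h3, Finset.sum_sub_distrib]
      simp only [hf] at h2
      linarith
  refine ⟨a, b, ?_⟩
  rw [sysK_apply, waveData_apply]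
  refine Prod.ext (funext fun j => ?_) (Prod.ext (funext fun j => ?_) (funext fun j => ?_))
  · simp only [Prod.fst_add, Pi.add_apply, arriving_apply, one_mul]
    exact ha' j
  · simp only [Prod.snd_add, Prod.fst_add, Pi.add_apply]
    rw [hb' j]
    abel
  · simp only [Prod.snd_add, Pi.add_apply, Pi.zero_apply, add_zero]
    exact sub_eq_zero.1 (hW j)

/-- Multiplication by `-q`. -/
def potential (L T : ℝ) {q : ℝ → ℝ} (hq : Measurable q) {m : NNReal} (hm : ∀ x, |q x| ≤ m) :
    L2Q L T →L[ℝ] L2Q L T := (isL2Op_potential L T hq hm).toCLM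

theorem integral_integral_mul_eq {L : ℝ} (hL : 0 < L) (hT : 0 < T) {φ : ℝ → ℝ → ℝ}
    (h : IsEdgeTest L T φ) {q : ℝ → ℝ} (hq : Measurable q) {m : NNReal} (hm : ∀ x, |q x| ≤ m)
    {u : ℝ → ℝ → ℝ} {U : L2Q L T} (hU : U =ᵐ[mQ L T] fun p => u p.1 p.2) :
    ∫ t in Ioo 0 T, ∫ x in Ioo 0 L, u x t * (dtt T φ x t - dxx L φ x t + q x * φ x t)
      = (∫ p, U p * box L T φ p ∂(mQ L T))
        - ∫ p, potential L T hq hm U p * φ p.1 p.2 ∂(mQ L T) := by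
  have i1 := integrable_L2Q_mul U (continuousOn_box hL hT h.contDiffOn)
  have i2 := integrable_L2Q_mul (potential L T hq hm U) h.contDiffOn.continuousOn
  have e : (fun p => U p * box L T φ p - potential L T hq hm U p * φ p.1 p.2) =ᵐ[mQ L T]
      fun p => u p.1 p.2 * (dtt T φ p.1 p.2 - dxx L φ p.1 p.2 + q p.1 * φ p.1 p.2) := by
    filter_upwards [hU, (isL2Op_potential L T hq hm).coeFn_toCLM U] with p h1 h2
    rw [potential, h2, h1, box]
    ring
  rw [← integral_sub i1 i2, integral_congr_ae e]
  exact (integral_prod_symm _ ((i1.sub i2).congr e)).symm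

/-- Continuity on a compact time interval bounds the spatial norms uniformly, and the squared bound
is integrable over `(0, T)`. -/
theorem memLp_of_continuous_time {L : ℝ} {u : ℝ → ℝ → ℝ}
    (hu : AEStronglyMeasurable (fun p : ℝ × ℝ => u p.1 p.2) (mQ L T))
    (hu2 : ∀ t ∈ Icc 0 T, MemLp (fun x => u x t) 2 (mT L))
    (huc : ∀ t₀ ∈ Icc 0 T, Tendsto (fun t => eLpNorm (fun x => u x t - u x t₀) 2 (mT L))
      (𝓝[Icc 0 T] t₀) (𝓝 0)) : MemLp (fun p : ℝ × ℝ => u p.1 p.2) 2 (mQ L T) := by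
  obtain ⟨K, hK⟩ : ∃ K : NNReal, ∀ t ∈ Icc 0 T, eLpNorm (fun x => u x t) 2 (mT L) ≤ K := by
    refine isCompact_Icc.induction_on (p := fun s => ∃ K : NNReal, ∀ t ∈ s,
      eLpNorm (fun x => u x t) 2 (mT L) ≤ K) ⟨0, by simp⟩ ?_ ?_ ?_
    · rintro s t hst ⟨K, hK⟩
      exact ⟨K, fun x hx => hK x (hst hx)⟩
    · rintro s t ⟨K, hK⟩ ⟨K', hK'⟩
      refine ⟨max K K', fun x hx => ?_⟩
      rcases hx with hx | hx
      · exact (hK x hx).trans (by exact_mod_cast le_max_left _ _)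
      · exact (hK' x hx).trans (by exact_mod_cast le_max_right _ _)
    · intro t₀ ht₀
      lift eLpNorm (fun x => u x t₀) 2 (mT L) to NNReal using (hu2 t₀ ht₀).2.ne with K hK
      refine ⟨_, inter_mem ((huc t₀ ht₀).eventually_le_const zero_lt_one) self_mem_nhdsWithin,
        1 + K, ?_⟩
      rintro t ⟨h1, h2⟩
      have e : (fun x => u x t) = (fun x => u x t - u x t₀) + fun x => u x t₀ := by
        ext x
        simp
      rw [e]
      refine (eLpNorm_add_le ((hu2 t h2).1.sub (hu2 t₀ ht₀).1) (hu2 t₀ ht₀).1 (by norm_num)).trans ?_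
      push_cast
      rw [hK]
      exact add_le_add h1 le_rfl
  refine ⟨hu, ?_⟩
  have h2 : eLpNorm (fun p : ℝ × ℝ => u p.1 p.2) 2 (mQ L T) ^ 2 < ⊤ := by
    rw [eLpNorm_two_sq, lintegral_prod_symm _ (hu.enorm.pow_const 2)]
    calc ∫⁻ t, ∫⁻ x, ‖u x t‖ₑ ^ 2 ∂(mT L) ∂(mT T) ≤ ∫⁻ _, (K : ENNReal) ^ 2 ∂(mT T) := by
          refine lintegral_mono_ae ?_
          filter_upwards [ae_mT T] with t ht
          rw [← eLpNorm_two_sq]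
          gcongr
          exact hK t (Ioo_subset_Icc_self ht)
      _ < ⊤ := by
          rw [lintegral_const]
          exact ENNReal.mul_lt_top (by finiteness) (measure_lt_top _ _)
  exact (ENNReal.pow_lt_top_iff (n := 2)).1 h2 |>.resolve_right (by norm_num)

section Solution

variable {q : Fin 3 → ℝ → ℝ} (hq : ∀ j, Measurable (q j)) {m : NNReal} (hm : ∀ j x, |q j x| ≤ m)

/-- The solution of the problem on the star which corresponds to a solution of the system for the
waves. -/
def waveSol (y : State l T) (j : Fin 3) (x t : ℝ) : ℝ :=
  edgeFun (l j) T (y.1 j) (y.2.1 j) (potential (l j) T (hq j) (hm j) (y.2.2 j)) (x, t)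

theorem coeFn_waveSol {g : L2 T} {h : Fin 3 → L2 T} {y : State l T}
    (hy : y = sysK hl T scattering (fun j => potential (l j) T (hq j) (hm j)) y
      + waveData l T 1 (g, h)) (j : Fin 3) :
    y.2.2 j =ᵐ[mQ (l j) T] fun p => waveSol hq hm y j p.1 p.2 := by
  have h1 : y.2.2 j = edgeSol T (l j) (y.1 j) (y.2.1 j)
      (potential (l j) T (hq j) (hm j) (y.2.2 j)) := by
    conv_lhs => rw [hy]
    rw [sysK_apply, waveData_apply]
    simp only [Prod.snd_add, Pi.add_apply, Pi.zero_apply, add_zero]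
  have h2 := coeFn_edgeSol (l j) (y.1 j) (y.2.1 j) (potential (l j) T (hq j) (hm j) (y.2.2 j))
  rw [← h1] at h2
  exact h2

include hT in
theorem isSolution_waveSol {g : L2 T} {h : Fin 3 → L2 T} {y : State l T}
    (hy : y = sysK hl T scattering (fun j => potential (l j) T (hq j) (hm j)) y
      + waveData l T 1 (g, h)) :
    IsSolution l q T g (fun j => h j) (waveSol hq hm y) where
  measurable j := (stronglyMeasurable_edgeFun _ _ _ _).aestronglyMeasurable
  memLp j t _ := memLp_edgeFun_time _ _ _ _ t
  continuous_time j t₀ _ := (tendsto_edgeFun_time _ _ _ _ t₀).mono_left nhdsWithin_le_nhds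
  weak φ hφ := by
    have ha : ∀ j, y.1 j = ∑ i, scattering j i • (tau hl T i (y.2.1 i)
        + traceD T (l i) 0 (potential (l i) T (hq i) (hm i) (y.2.2 i))) + emission j • g :=
      fun j => by
        have := congrFun (congrArg Prod.fst hy) j
        rw [sysK_apply, waveData_apply] at this
        simpa only [Prod.fst_add, Pi.add_apply, arriving_apply, one_mul] using this
    have hb : ∀ j, y.2.1 j = h j - tau hl T j (y.1 j)
        - traceD T (l j) (l j) (potential (l j) T (hq j) (hm j) (y.2.2 j)) := fun j => by
      have := congrFun (congrArg (fun y : State l T => y.2.1) hy) j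
      rw [sysK_apply, waveData_apply] at this
      simp only [Prod.snd_add, Prod.fst_add, Pi.add_apply] at this
      refine this.trans ?_
      abel
    have h1 : ∀ j, y.2.2 j = edgeSol T (l j) (y.1 j) (y.2.1 j)
        (potential (l j) T (hq j) (hm j) (y.2.2 j)) := fun j => by
      have := congrFun (congrArg (fun y : State l T => y.2.2) hy) j
      rw [sysK_apply, waveData_apply] at this
      simpa only [Prod.snd_add, Pi.add_apply, Pi.zero_apply, add_zero] using this
    have h2 := sum_integral_edgeSol_mul_box hl hT ha hb hφ
    simp only [← h1] at h2
    simp only [integral_integral_mul_eq (hl _) hT (hφ.edge _) (hq _) (hm _)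
      (coeFn_waveSol hl hq hm hy _), Finset.sum_sub_distrib]
    linarith

-- Any generalized solution yields a solution of the wave system, which the resolvent determines.
-- This gives uniqueness and at the same time an explicit formula from which the trace is read.
include hT in
theorem IsSolution.ae_eq_waveSol {R : State l T →L[ℝ] State l T}
    (hR : ∀ y d, y = sysK hl T scattering (fun j => potential (l j) T (hq j) (hm j)) y + d ↔ y = R d)
    {g : L2 T} {h : Fin 3 → L2 T} {u : Fin 3 → ℝ → ℝ → ℝ}
    (hu : IsSolution l q T g (fun j => h j) u) (j : Fin 3) :
    (fun p : ℝ × ℝ => u j p.1 p.2) =ᵐ[mQ (l j) T]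
      fun p => waveSol hq hm (R (waveData l T 1 (g, h))) j p.1 p.2 := by
  have h2 := fun j => memLp_of_continuous_time (hu.measurable j) (hu.memLp j) (hu.continuous_time j)
  obtain ⟨a, b, hy⟩ := exists_waves_of_weak hl hT
    (fun j => potential (l j) T (hq j) (hm j)) (g := g) (h := h) (U := fun j => (h2 j).toLp)
    fun φ hφ => by
      rw [← hu.weak φ hφ]
      exact Finset.sum_congr rfl fun j _ => (integral_integral_mul_eq (hl j) hT (hφ.edge j) (hq j)
        (hm j) (h2 j).coeFn_toLp).symm
  have h3 := coeFn_waveSol hl hq hm hy j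
  rw [← (hR _ _).1 hy]
  exact (h2 j).coeFn_toLp.symm.trans h3

end Solution

-- Equality on the rectangle gives equality of sections for almost every, hence for a dense set of
-- times; continuity in time extends it to every time, the end points included.
include hT in
theorem ae_eq_of_ae_eq_prod {L : ℝ} {u u' : ℝ → ℝ → ℝ}
    (hu2 : ∀ t ∈ Icc 0 T, MemLp (fun x => u x t) 2 (mT L))
    (huc : ∀ t₀ ∈ Icc 0 T, Tendsto (fun t => eLpNorm (fun x => u x t - u x t₀) 2 (mT L))
      (𝓝[Icc 0 T] t₀) (𝓝 0))
    (hu2' : ∀ t ∈ Icc 0 T, MemLp (fun x => u' x t) 2 (mT L))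
    (huc' : ∀ t₀ ∈ Icc 0 T, Tendsto (fun t => eLpNorm (fun x => u' x t - u' x t₀) 2 (mT L))
      (𝓝[Icc 0 T] t₀) (𝓝 0))
    (h : (fun p : ℝ × ℝ => u p.1 p.2) =ᵐ[mQ L T] fun p => u' p.1 p.2) {t₀ : ℝ}
    (ht₀ : t₀ ∈ Icc 0 T) : (fun x => u x t₀) =ᵐ[mT L] fun x => u' x t₀ := by
  have h1 : ∀ᵐ t ∂(mT T), (fun x => u x t) =ᵐ[mT L] fun x => u' x t :=
    Measure.ae_ae_of_ae_prod
      ((Measure.measurePreserving_swap (μ := mT T) (ν := mT L)).quasiMeasurePreserving.ae h)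
  rw [ae_restrict_iff' measurableSet_Ioo] at h1
  have hd := Measure.dense_of_ae h1
  have hcl : t₀ ∈ closure
      (Ioo 0 T ∩ {t | t ∈ Ioo 0 T → (fun x => u x t) =ᵐ[mT L] fun x => u' x t}) := by
    have := closure_mono (hd.open_subset_closure_inter (isOpen_Ioo (a := 0) (b := T)))
    rw [closure_closure, closure_Ioo hT.ne] at this
    exact this ht₀
  set A := Ioo 0 T ∩ {t | t ∈ Ioo 0 T → (fun x => u x t) =ᵐ[mT L] fun x => u' x t}
  have hne : (𝓝[A] t₀).NeBot := mem_closure_iff_nhdsWithin_neBot.1 hcl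
  have hA : A ⊆ Icc 0 T := fun t ht => Ioo_subset_Icc_self ht.1
  have hlim := ((huc t₀ ht₀).mono_left (nhdsWithin_mono _ hA)).add
    ((huc' t₀ ht₀).mono_left (nhdsWithin_mono _ hA))
  rw [add_zero] at hlim
  have h0 : eLpNorm (fun x => u x t₀ - u' x t₀) 2 (mT L) ≤ 0 := by
    refine ge_of_tendsto hlim (eventually_nhdsWithin_of_forall fun t ht => ?_)
    have e : (fun x => u x t₀ - u' x t₀)
        =ᵐ[mT L] (fun x => u' x t - u' x t₀) - fun x => u x t - u x t₀ := by
      filter_upwards [ht.2 ht.1] with x hx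
      rw [Pi.sub_apply, hx]
      ring
    rw [eLpNorm_congr_ae e, add_comm]
    exact eLpNorm_sub_le ((hu2' t (hA ht)).1.sub (hu2' t₀ ht₀).1)
      ((hu2 t (hA ht)).1.sub (hu2 t₀ ht₀).1) (by norm_num)
  have h3 := (eLpNorm_eq_zero_iff ((hu2 t₀ ht₀).1.sub (hu2' t₀ ht₀).1) (by norm_num)).1
    (le_antisymm h0 zero_le)
  filter_upwards [h3] with x hx
  exact sub_eq_zero.1 hx

/-- The explicit formula is continuous in `x` with values in `L²(0,T)`. The function `u` agrees with
it only on almost every vertical line, which is why the limit excludes null sets of `x`. -/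
theorem hasTraceAtZero_of_ae_eq {L : ℝ} (hL : 0 < L) {u : ℝ → ℝ → ℝ} {a b : L2 T} {f : L2Q L T}
    (hu : (fun p : ℝ × ℝ => u p.1 p.2) =ᵐ[mQ L T] edgeFun L T a b f) {o : L2 T}
    (ho : o = a + (isL2Op_shiftOp T hL).toCLM b + traceD T L 0 f) : HasTraceAtZero T u o := by
  have h1 : ∀ᵐ x ∂(mT L), ∀ᵐ t ∂(mT T), u x t = edgeFun L T a b f (x, t) :=
    Measure.ae_ae_of_ae_prod hu
  rw [ae_restrict_iff' measurableSet_Ioo] at h1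
  have h2 := coeFn_trace_edgeFun L a b f hL
  rw [← ho] at h2
  have h3 := (tendsto_edgeFun_space L a b f 0).mono_left
    (inf_le_left.trans nhdsWithin_le_nhds : 𝓝[>] (0 : ℝ) ⊓ ae volume ≤ 𝓝 0)
  refine h3.congr' ?_
  filter_upwards [mem_inf_of_left (Ioo_mem_nhdsGT hL), mem_inf_of_right h1] with x hx hx'
  refine eLpNorm_congr_ae ?_
  filter_upwards [h2, hx' hx] with t e1 e2
  rw [e1, e2]

end

section

/-! ### The map from the control to the observation -/

variable {l : Fin 3 → ℝ} (hl : ∀ j, 0 < l j) {T : ℝ} (hT : 0 < T)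

theorem IsSolution.congr_potential {q q' : Fin 3 → ℝ → ℝ}
    (hqq : ∀ j, ∀ x ∈ Ioo 0 (l j), q j x = q' j x) {g : ℝ → ℝ} {h : Fin 3 → ℝ → ℝ}
    {u : Fin 3 → ℝ → ℝ → ℝ} (hu : IsSolution l q T g h u) : IsSolution l q' T g h u where
  measurable := hu.measurable
  memLp := hu.memLp
  continuous_time := hu.continuous_time
  weak φ hφ := by
    rw [← hu.weak φ hφ]
    refine Finset.sum_congr rfl fun j _ => setIntegral_congr_fun measurableSet_Ioo fun t _ => ?_
    refine setIntegral_congr_fun measurableSet_Ioo fun x hx => ?_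
    rw [hqq j x hx]

/-- Extension by zero; the sum of the three bounds provides one constant valid on every edge. -/
theorem exists_measurable_extension {q : Fin 3 → ℝ → ℝ}
    (hq : ∀ j, ContinuousOn (q j) (Ioo 0 (l j)))
    (hqb : ∀ j, ∃ M : ℝ, ∀ x ∈ Ioo 0 (l j), |q j x| ≤ M) :
    ∃ (q' : Fin 3 → ℝ → ℝ) (m : NNReal), (∀ j, Measurable (q' j)) ∧ (∀ j x, |q' j x| ≤ m) ∧
      ∀ j, ∀ x ∈ Ioo 0 (l j), q j x = q' j x := by
  classical
  choose M hM using hqb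
  refine ⟨fun j => (Ioo 0 (l j)).indicator (q j), ∑ j, (M j).toNNReal, fun j => ?_, fun j x => ?_,
    fun j x hx => (indicator_of_mem hx _).symm⟩
  · beta_reduce
    rw [← piecewise_eq_indicator]
    exact (hq j).measurable_piecewise continuousOn_const measurableSet_Ioo
  · beta_reduce
    have h0 : (0 : ℝ) ≤ ((∑ j, (M j).toNNReal : NNReal) : ℝ) := NNReal.coe_nonneg _
    by_cases hx : x ∈ Ioo 0 (l j)
    · rw [indicator_of_mem hx]
      refine (hM j x hx).trans ((Real.le_coe_toNNReal (M j)).trans ?_)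
      exact_mod_cast Finset.single_le_sum (f := fun j => (M j).toNNReal) (fun _ _ => zero_le)
        (Finset.mem_univ j)
    · rw [indicator_of_notMem hx, abs_zero]
      exact h0

/-! ### Exchanging control and observation -/

/-- The scattering matrix at the centre when the observation is prescribed instead of the control. -/
def inverseScattering (i j : Fin 3) : ℝ := (1 - if i = 2 then 1 else 0) - if i = j then 1 else 0

theorem abs_inverseScattering_le (i j : Fin 3) : |inverseScattering i j| ≤ 1 := by
  fin_cases i <;> fin_cases j <;> simp [inverseScattering]

/-- The sum of the waves which arrive at the centre. -/
def totalArriving (T : ℝ) (M : ∀ j, L2Q (l j) T →L[ℝ] L2Q (l j) T) : State l T →L[ℝ] L2 T :=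
  ∑ i, arriving hl T M i

theorem totalArriving_apply (M : ∀ j, L2Q (l j) T →L[ℝ] L2Q (l j) T) (y : State l T) :
    totalArriving hl T M y = ∑ i, arriving hl T M i y := by
  simp [totalArriving]

/-- This is the elimination `g = (3/2) z - ∑ B_i` carried out in the centre condition. It is an
algebraic identity for every state, so one and the same state solves both systems; the factor 3/2
appears as the new amplitude of the datum. -/
theorem sysK_scattering_eq (M : ∀ j, L2Q (l j) T →L[ℝ] L2Q (l j) T) (y : State l T) (g : L2 T)
    (h : Fin 3 → L2 T) :
    sysK hl T scattering M y + waveData l T 1 (g, h)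
      = sysK hl T inverseScattering M y
        + waveData l T (3 / 2) ((2 / 3 : ℝ) • (totalArriving hl T M y + g), h) := by
  rw [sysK_apply, sysK_apply, waveData_apply, waveData_apply, totalArriving_apply]
  refine Prod.ext (funext fun j => ?_) rfl
  simp only [Prod.fst_add, Pi.add_apply, Fin.sum_univ_three]
  fin_cases j <;> simp [scattering, inverseScattering, emission] <;> module

/-- The observation plus the control, as a function of the control and the boundary data. -/
def response (T : ℝ) (M : ∀ j, L2Q (l j) T →L[ℝ] L2Q (l j) T) (R : State l T →L[ℝ] State l T) :
    L2 T × (Fin 3 → L2 T) →L[ℝ] L2 T :=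
  (2 / 3 : ℝ) • ((totalArriving hl T M).comp (R.comp (waveData l T 1))
    + ContinuousLinearMap.fst ℝ _ _)

/-- The control as a function of the response and the boundary data. -/
def control (T : ℝ) (M : ∀ j, L2Q (l j) T →L[ℝ] L2Q (l j) T) (R' : State l T →L[ℝ] State l T) :
    L2 T × (Fin 3 → L2 T) →L[ℝ] L2 T :=
  (3 / 2 : ℝ) • ContinuousLinearMap.fst ℝ _ _
    - (totalArriving hl T M).comp (R'.comp (waveData l T (3 / 2)))

section Inverse

variable {M : ∀ j, L2Q (l j) T →L[ℝ] L2Q (l j) T} {R R' : State l T →L[ℝ] State l T}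
  (hR : ∀ y d, y = sysK hl T scattering M y + d ↔ y = R d)
  (hR' : ∀ y d, y = sysK hl T inverseScattering M y + d ↔ y = R' d)

theorem response_apply (g : L2 T) (h : Fin 3 → L2 T) : response hl T M R (g, h)
    = (2 / 3 : ℝ) • (totalArriving hl T M (R (waveData l T 1 (g, h))) + g) := rfl

theorem control_apply (z : L2 T) (h : Fin 3 → L2 T) : control hl T M R' (z, h)
    = (3 / 2 : ℝ) • z - totalArriving hl T M (R' (waveData l T (3 / 2) (z, h))) := rfl

include hR hR' in
theorem control_response (g : L2 T) (h : Fin 3 → L2 T) :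
    control hl T M R' (response hl T M R (g, h), h) = g := by
  have hy := (hR _ (waveData l T 1 (g, h))).2 rfl
  rw [sysK_scattering_eq, ← response_apply, hR'] at hy
  rw [control_apply, ← hy, response_apply]
  module

include hR hR' in
theorem response_control (z : L2 T) (h : Fin 3 → L2 T) :
    response hl T M R (control hl T M R' (z, h), h) = z := by
  have hy := (hR' _ (waveData l T (3 / 2) (z, h))).2 rfl
  set y := R' (waveData l T (3 / 2) (z, h)) with hy0
  have hz : (2 / 3 : ℝ) • (totalArriving hl T M y + control hl T M R' (z, h)) = z := by
    rw [control_apply, ← hy0]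
    module
  have hs := sysK_scattering_eq hl M y (control hl T M R' (z, h)) h
  rw [hz, ← hy] at hs
  have hy1 := (hR _ _).1 hs.symm
  rw [response_apply, ← hy1, hz]

include hR in
-- Confirms that `response` is indeed `o + g`: the right side is the value at the centre on the
-- first edge, outgoing wave plus everything arriving.
theorem response_sub (g : L2 T) (h : Fin 3 → L2 T) :
    response hl T M R (g, h) - g
      = (R (waveData l T 1 (g, h))).1 0 + tau hl T 0 ((R (waveData l T 1 (g, h))).2.1 0)
        + traceD T (l 0) 0 (M 0 ((R (waveData l T 1 (g, h))).2.2 0)) := by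
  have hy := (hR _ (waveData l T 1 (g, h))).2 rfl
  rw [response_apply, totalArriving_apply]
  set y := R (waveData l T 1 (g, h))
  have h0 := congrFun (congrArg Prod.fst hy) 0
  rw [sysK_apply, waveData_apply] at h0
  simp only [Prod.fst_add, Pi.add_apply, Fin.sum_univ_three] at h0
  rw [h0, add_assoc, ← arriving_apply]
  simp only [Fin.sum_univ_three]
  simp [scattering, emission]
  module

end Inverse

end

end StarWave

end

/-! ### Conclusion -/

theorem propositionp3 (l : Fin 3 → ℝ) (hl : ∀ j, 0 < l j)
    (q : Fin 3 → ℝ → ℝ) (hq : ∀ j, ContinuousOn (q j) (Ioo 0 (l j)))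
    (hqb : ∀ j, ∃ M : ℝ, ∀ x ∈ Ioo 0 (l j), |q j x| ≤ M)
    (T : ℝ) (hT : 0 < T) :
    ∃ C : ℝ, ∀ h : Fin 3 → StarWave.L2 T,
      ∃ Z : StarWave.L2 T → StarWave.L2 T,
        -- `Z` is the map `g ↦ o + g`: for every `g` the solution `u` exists and is unique, and its
        -- value `o` on the first edge at the centre is `Z g - g`
        (∀ g : StarWave.L2 T,
          (∃ u, StarWave.IsSolution l q T g (fun j => h j) u) ∧
          (∀ u u', StarWave.IsSolution l q T g (fun j => h j) u →
            StarWave.IsSolution l q T g (fun j => h j) u' →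
            ∀ j, ∀ t ∈ Icc 0 T,
              (fun x => u j x t) =ᵐ[volume.restrict (Ioo 0 (l j))] (fun x => u' j x t)) ∧
          (∀ u, StarWave.IsSolution l q T g (fun j => h j) u →
            StarWave.HasTraceAtZero T (u 0) (Z g - g : StarWave.L2 T))) ∧
        -- A) surjectivity
        Function.Surjective Z ∧
        -- B) `z ↦ g` is a well-defined map, and it is bounded
        Function.Injective Z ∧
        (∀ g g' : StarWave.L2 T, ‖g - g'‖ ≤ C * ‖Z g - Z g'‖) ∧
        (∀ g : StarWave.L2 T, ‖g‖ ≤ C * (‖Z g‖ + ∑ j, ‖h j‖)) := by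
  open StarWave in
  obtain ⟨Q, m, hQ, hm, hqQ⟩ := exists_measurable_extension hq hqb
  have hM := fun j lam f => wNorm_potential_le (l j) T (hQ j) (hm j) lam f
  obtain ⟨R, hR⟩ := exists_sysK_resolvent hl abs_scattering_le
    (M := fun j => potential (l j) T (hQ j) (hm j)) hM
  obtain ⟨R', hR'⟩ := exists_sysK_resolvent hl abs_inverseScattering_le
    (M := fun j => potential (l j) T (hQ j) (hm j)) hM
  set M := fun j => potential (l j) T (hQ j) (hm j)
  set G := control hl T M R' with hG
  have hGZ := control_response hl hR hR'
  -- `G` is linear in the pair `(z, h)` jointly, so its operator norm is a constant chosen before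
  -- the boundary data; for differences with the same `h` the second argument becomes 0.
  refine ⟨‖G‖, fun h => ⟨fun g => response hl T M R (g, h), fun g => ⟨?_, ?_, ?_⟩, fun z => ?_,
    fun g g' e => ?_, fun g g' => ?_, fun g => ?_⟩⟩
  · exact ⟨_, (isSolution_waveSol hl hT hQ hm ((hR _ (waveData l T 1 (g, h))).2 rfl)).congr_potential
      fun j x hx => (hqQ j x hx).symm⟩
  · intro u u' hu hu' j t ht
    have e := (hu.congr_potential hqQ).ae_eq_waveSol hl hT hQ hm hR j
    have e' := (hu'.congr_potential hqQ).ae_eq_waveSol hl hT hQ hm hR j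
    exact ae_eq_of_ae_eq_prod hT (hu.memLp j) (hu.continuous_time j) (hu'.memLp j)
      (hu'.continuous_time j) (e.trans e'.symm) ht
  · intro u hu
    exact hasTraceAtZero_of_ae_eq (hl 0) ((hu.congr_potential hqQ).ae_eq_waveSol hl hT hQ hm hR 0)
      (response_sub hl hR g h)
  · exact ⟨_, response_control hl hR hR' z h⟩
  · have e1 := hGZ g h
    rw [show response hl T M R (g, h) = response hl T M R (g', h) from e, hGZ g' h] at e1
    exact e1.symm
  · have e1 : g - g' = G (response hl T M R (g, h) - response hl T M R (g', h), 0) := by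
      rw [← sub_self h, ← Prod.mk_sub_mk, map_sub, hG, hGZ, hGZ]
    rw [e1]
    refine (G.le_opNorm _).trans_eq ?_
    rw [Prod.norm_mk, norm_zero, max_eq_left (norm_nonneg _)]
  · conv_lhs => rw [← hGZ g h]
    refine (G.le_opNorm _).trans (mul_le_mul_of_nonneg_left ?_ (norm_nonneg _))
    have hs : 0 ≤ ∑ j, ‖h j‖ := Finset.sum_nonneg fun j _ => norm_nonneg _
    rw [Prod.norm_mk]
    refine max_le (le_add_of_nonneg_right hs) (le_add_of_nonneg_of_le (norm_nonneg _) ?_)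
    exact (pi_norm_le_iff_of_nonneg hs).2 fun j =>
      Finset.single_le_sum (f := fun j => ‖h j‖) (fun _ _ => norm_nonneg _) (Finset.mem_univ j)
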